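/- Let $d\in(0,1)$, $\alpha_1,\alpha_2,\gamma>0$, $y_0,y_1\in\mathbb R$. Let $b\in C^7[0,1]$ with $b\ge\gamma$ on $[0,1]$, and let $a,f$ be of class $C^7$ on $[0,d)$ and on $(d,1]$, with finite one-sided limits at $d$ of the functions and their derivatives up to order $7$, where $a\le-\alpha_1$ on $[0,d)$ and $a\ge\alpha_2$ on $(d,1]$. Put $\alpha=\min\{\alpha_1,\alpha_2\}$ and $\rho=\inf_{x\in[0,1]\setminus\{d\}}|b(x)/a(x)|$. For $\epsilon,\mu>0$ let $y\in C^0[0,1]\cap C^1(0,1)\cap C^2((0,d)\cup(d,1))$ be a solution of $$\epsilon y''+\mu a y'-by=f\ \text{ on }(0,d)\cup(d,1),\qquad y(0)=y_0,\quad y(1)=y_1 .$$ Let $\theta_1=\theta_2=\frac{\sqrt{\rho\alpha}}{2\sqrt\epsilon}$ if $\sqrt\alpha\mu\le\sqrt{\rho\epsilon}$, and $\theta_1=\frac{\alpha\mu}{2\epsilon}$, $\theta_2=\frac{\rho}{2\mu}$ if $\sqrt\alpha\mu>\sqrt{\rho\epsilon}$. Let $N$ be a positive multiple of $8$, $\sigma=\frac4{\theta_2}\ln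 N$, $\tau=\frac4{\theta_1}\ln N$, and suppose that $\sigma+\tau<d$ and $\sigma+\tau<1-d$. The Shishkin–Bakhvalov mesh $0=x_0<x_1<\dots<x_N=1$, with $x_{N/2}=d$, is $$x_i=\begin{cases} -\frac8{\theta_2}\ln\bigl(1+\frac{8i}N(\frac1{\sqrt N}-1)\bigr), & 0\le i\le\frac N8,\\ \sigma+4(d-\sigma-\tau)(\frac iN-\frac18), & \frac N8\le i\le\frac{3N}8,\\ d+\frac8{\theta_1}\ln\bigl(\frac{8i}N(1-\frac1{\sqrt N})+\frac4{\sqrt N}-3\bigr), & \frac{3N}8\le i\le\frac N2,\\ d-\frac8{\theta_1}\ln\bigl(\frac{8i}N(\frac1{\sqrt N}-1)+5-\frac4{\sqrt N}\bigr), & \frac N2\le i\le\frac{5N}8,\\ d+\tau+4(1-d-\sigma-\tau)(\frac iN-\frac58), & \frac{5N}8\le i\le\frac{7N}8,\\ 1+\frac8{\theta_2}\ln\bigl(\frac{8i}N(1-\frac1{\sqrt N})+\frac8{\sqrt N}-7\bigr), & \frac{7N}8\le i\le N. \end{cases}$$ For a mesh function $Y=(Y_i)_{i=0}^N$ put $D^+Y_i=\frac{Y_{i+1}-Y_i}{x_{i+1}-x_i}$,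 $D^-Y_i=\frac{Y_i-Y_{i-1}}{x_i-x_{i-1}}$, $\delta^2Y_i=\frac{2(D^+Y_i-D^-Y_i)}{x_{i+1}-x_{i-1}}$, and $D^*Y_i=D^-Y_i$ for $i<\frac N2$, $D^*Y_i=D^+Y_i$ for $i>\frac N2$. Let $Y$ be a solution of the upwind scheme $$\epsilon\delta^2Y_i+\mu a(x_i)D^*Y_i-b(x_i)Y_i=f(x_i)\quad(1\le i\le N-1,\ i\ne\tfrac N2),$$ $$Y_0=y_0,\quad Y_N=y_1,\quad D^-Y_{N/2}=D^+Y_{N/2}.$$ Suppose that $\sqrt\epsilon<N^{-1}$ if $\sqrt\alpha\mu\le\sqrt{\rho\epsilon}$, and $\max\{\epsilon/\mu,\mu\}<N^{-1}$ if $\sqrt\alpha\mu>\sqrt{\rho\epsilon}$. Then $$\max_{0\le i\le N}|Y_i-y(x_i)|\le CN^{-1},$$ where the constant $C>0$ depends only on $d,a,b,f,\alpha_1,\alpha_2,\gamma,y_0,y_1$, and not on $\epsilon$, $\mu$ or $N$. -/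

import Mathlib

open Set

noncomputable section

/-- The data of the boundary value problem
`ε y'' + μ a y' - b y = f` on `(0,d) ∪ (d,1)`, `y 0 = y₀`, `y 1 = y₁`. The perturbation
parameters `ε`, `μ` are kept separate. -/
structure BVPData where
  /-- the point of discontinuity -/
  d : ℝ
  /-- convection coefficient -/
  a : ℝ → ℝ
  /-- reaction coefficient -/
  b : ℝ → ℝ
  /-- source term -/
  f : ℝ → ℝ
  /-- lower bound of `-a` on the left of `d` -/
  α₁ : ℝ
  /-- lower bound of `a` on the right of `d` -/
  α₂ : ℝ
  /-- lower bound of `b` -/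
  γ : ℝ
  /-- left boundary value -/
  y₀ : ℝ
  /-- right boundary value -/
  y₁ : ℝ

/-- `g` is of class `C⁷` on `[0,d)` and on `(d,1]`, and `g` and its derivatives up to order `7` have
finite one-sided limits at `d` (so at most a jump there): each piece of `g` extends to
a `C⁷` function on the closed piece. The value `g d` plays no role. -/
def PiecewiseSmooth (d : ℝ) (g : ℝ → ℝ) : Prop :=
  (∃ gl : ℝ → ℝ, ContDiffOn ℝ 7 gl (Icc 0 d) ∧ EqOn g gl (Ico 0 d)) ∧
  (∃ gr : ℝ → ℝ, ContDiffOn ℝ 7 gr (Icc d 1) ∧ EqOn g gr (Ioc d 1))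

namespace BVPData

/-- The standing assumptions on the data. -/
structure Admissible (P : BVPData) : Prop where
  d_mem : P.d ∈ Ioo (0 : ℝ) 1
  α₁_pos : 0 < P.α₁
  α₂_pos : 0 < P.α₂
  γ_pos : 0 < P.γ
  a_left : ∀ x ∈ Ico 0 P.d, P.a x ≤ -P.α₁
  a_right : ∀ x ∈ Ioc P.d 1, P.α₂ ≤ P.a x
  b_lower : ∀ x ∈ Icc (0 : ℝ) 1, P.γ ≤ P.b x
  b_smooth : ContDiffOn ℝ 7 P.b (Icc 0 1)
  a_smooth : PiecewiseSmooth P.d P.a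
  f_smooth : PiecewiseSmooth P.d P.f

/-- `α = |min {α₁, α₂}|`. -/
def α (P : BVPData) : ℝ := |min P.α₁ P.α₂|

/-- `ρ`, the infimum of `|b/a|` over `[0,1] \ {d}`. -/
def ρ (P : BVPData) : ℝ := sInf ((fun x => |P.b x / P.a x|) '' (Icc 0 1 \ {P.d}))

/-- `y ∈ C⁰[0,1] ∩ C¹(0,1) ∩ C²((0,d) ∪ (d,1))` solves the boundary value problem. -/
structure IsSolution (P : BVPData) (ε μ : ℝ) (y : ℝ → ℝ) : Prop where
  continuousOn : ContinuousOn y (Icc 0 1)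
  contDiffOn_one : ContDiffOn ℝ 1 y (Ioo 0 1)
  contDiffOn_two : ContDiffOn ℝ 2 y (Ioo 0 P.d ∪ Ioo P.d 1)
  equation : ∀ x ∈ Ioo 0 P.d ∪ Ioo P.d 1,
    ε * deriv (deriv y) x + μ * P.a x * deriv y x - P.b x * y x = P.f x
  left_value : y 0 = P.y₀
  right_value : y 1 = P.y₁

open Classical in
/-- The decay rate `θ₁` of the interior layers at `d`. -/
def θ₁ (P : BVPData) (ε μ : ℝ) : ℝ :=
  if √P.α * μ ≤ √(P.ρ * ε) then √(P.ρ * P.α) / (2 * √ε) else P.α * μ / (2 * ε)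

open Classical in
/-- The decay rate `θ₂` of the boundary layers at `0` and `1`. -/
def θ₂ (P : BVPData) (ε μ : ℝ) : ℝ :=
  if √P.α * μ ≤ √(P.ρ * ε) then √(P.ρ * P.α) / (2 * √ε) else P.ρ / (2 * μ)

/-- Width `σ₁ = σ₄ = (4/θ₂) ln N` of the two boundary layer regions. -/
def σBoundary (P : BVPData) (ε μ : ℝ) (N : ℕ) : ℝ := 4 / P.θ₂ ε μ * Real.log N

/-- Width `σ₂ = σ₃ = (4/θ₁) ln N` of the two interior layer regions. -/
def σInterior (P : BVPData) (ε μ : ℝ) (N : ℕ) : ℝ := 4 / P.θ₁ ε μ * Real.log N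

/-- The points `x_i`, `0 ≤ i ≤ N`, of the Shishkin–Bakhvalov mesh (`N` a multiple of `8`). -/
def mesh (P : BVPData) (ε μ : ℝ) (N i : ℕ) : ℝ :=
  let s : ℝ := 1 / √(N : ℝ)
  let ξ : ℝ := (i : ℝ) / N
  let σ := P.σBoundary ε μ N
  let τ := P.σInterior ε μ N
  if 8 * i ≤ N then
    -(8 / P.θ₂ ε μ) * Real.log (1 + 8 * ξ * (s - 1))
  else if 8 * i ≤ 3 * N then
    σ + (P.d - σ - τ) * (ξ - 1 / 8) / (1 / 4)
  else if 8 * i ≤ 4 * N then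
    P.d + 8 / P.θ₁ ε μ * Real.log (8 * ξ * (1 - s) + 4 * s - 3)
  else if 8 * i ≤ 5 * N then
    P.d - 8 / P.θ₁ ε μ * Real.log (8 * ξ * (s - 1) + 5 - 4 * s)
  else if 8 * i ≤ 7 * N then
    P.d + τ + (1 - P.d - τ - σ) * (ξ - 5 / 8) / (1 / 4)
  else
    1 + 8 / P.θ₂ ε μ * Real.log (8 * ξ * (1 - s) + 8 * s - 7)

end BVPData

/-- Forward difference quotient of the mesh function `Y` (`Y i` is its value at `x i`). -/
def fwdDiffQuot (x Y : ℕ → ℝ) (i : ℕ) : ℝ := (Y (i + 1) - Y i) / (x (i + 1) - x i)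

/-- Backward difference quotient (used for `1 ≤ i`). -/
def bwdDiffQuot (x Y : ℕ → ℝ) (i : ℕ) : ℝ := (Y i - Y (i - 1)) / (x i - x (i - 1))

/-- Second difference quotient on a nonuniform mesh (used for `1 ≤ i`). -/
def secondDiffQuot (x Y : ℕ → ℝ) (i : ℕ) : ℝ :=
  2 * (fwdDiffQuot x Y i - bwdDiffQuot x Y i) / (x (i + 1) - x (i - 1))

/-- Upwind difference quotient: backward left of `d = x (N/2)`, forward right of it. -/
def upwindDiffQuot (N : ℕ) (x Y : ℕ → ℝ) (i : ℕ) : ℝ :=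
  if 2 * i < N then bwdDiffQuot x Y i else fwdDiffQuot x Y i

namespace BVPData

/-- The mesh function `Y` (`Y i` is its value at `x_i`, `0 ≤ i ≤ N`) solves the upwind scheme
on the Shishkin–Bakhvalov mesh with the three-point condition at `d = x_{N/2}`. -/
structure IsDiscreteSolution (P : BVPData) (ε μ : ℝ) (N : ℕ) (Y : ℕ → ℝ) : Prop where
  equation : ∀ i : ℕ, 1 ≤ i → i < N → i ≠ N / 2 →
    ε * secondDiffQuot (P.mesh ε μ N) Y i
      + μ * P.a (P.mesh ε μ N i) * upwindDiffQuot N (P.mesh ε μ N) Y i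
      - P.b (P.mesh ε μ N i) * Y i = P.f (P.mesh ε μ N i)
  left_value : Y 0 = P.y₀
  right_value : Y N = P.y₁
  three_point : bwdDiffQuot (P.mesh ε μ N) Y (N / 2) = fwdDiffQuot (P.mesh ε μ N) Y (N / 2)

end BVPData

end

/-! ### Elementary bounds for difference quotients of exponentials -/

/-! Write `δ = N⁻¹`. The smallness assumptions give `ε, μ = O(δ)` and make every layer narrower than
a multiple of `δ`. At accuracy `O(δ)` no derivative bounds for the exact solution are needed: one
explicit function approximates both `y` and `Y`, and the triangle inequality finishes
(`two_sided_error`).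

In the distance `t` to the interface both sides of `d` have the same form, `ε u'' + μ A u' - b u =
-b v` with `A > 0` and reduced solution `v = -f/b`; upwinding is a forward difference on each side,
and the `C¹` and three-point conditions say that two one-sided slopes add up to zero. On each side
the approximation (`layerApprox`) is `v + a₁ exp(-lam (ℓ - t)) + a₀ exp(-κ t)`, where `lam` and `κ`
are the exact exponential rates for coefficients frozen at the boundary and at the interface. The
`a₁` match the boundary values up to an exponential tail; the two `a₀` make the approximation
continuous and cancel the order-`κ` part of the slope jump (`exists_amplitudes`).

Consistency. Freezing a Lipschitz coefficient costs a factor `t`, and `t exp(-κ t) ≤ 1/κ = O(δ)`;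
the terms `ε v''` and `μ A v'` are `O(δ)`. On the mesh, `exp(-θ x / 8)` is linear in the index on
each graded piece, so the relative consistency error of an exponential there is `O(δ)` times a
slowly growing exponential that the layer function absorbs. Outside the graded pieces the layer
functions are themselves `O(δ)`. Since `μ κ` need not be bounded, the discrete residual of the
interface layer is only `O(δ (1 + μ κ W))`, with `W` the discrete exponential `meshExp`
(`interior_residual_near`, `interior_residual_far`).

Stability. A multiple of `δ (W + 1)`, or of its continuous analogue, is a barrier: the operator
sends `W` below a negative multiple of `μ κ W`, and the constant handles the rest. If barrier plus
error were negative at the interface, the minimum principle would put its minimum on both sides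
there, so both outward slopes would be nonnegative; but the barrier slopes, of order `-δ κ`,
outweigh the slope jump of the error (`upwind_stability`, `diff_stability`).

Finally, `θ₁`, `θ₂` bound `κ`, `lam` from below and are comparable to them in both regimes
(`exists_meshRates`). -/

lemma abs_exp_sub_quadratic_le {x : ℝ} (hx : 0 ≤ x) :
    |Real.exp x - 1 - x - x ^ 2 / 2| ≤ x ^ 3 * Real.exp x := by
  have h0 : 1 ≤ Real.exp x := Real.one_le_exp hx
  have hq := Real.quadratic_le_exp_of_nonneg hx
  rw [abs_of_nonneg (by linarith)]
  rcases le_total x 1 with h | h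
  · have hb := Real.exp_bound (x := x) (by rwa [abs_of_nonneg hx]) (n := 3) (by norm_num)
    norm_num [Finset.sum_range_succ, Nat.factorial, abs_of_nonneg hx] at hb
    have := (abs_le.1 hb).2
    have h3 : 0 ≤ x ^ 3 := by positivity
    nlinarith [mul_le_mul_of_nonneg_left h0 h3]
  · have h3 : 1 ≤ x ^ 3 := one_le_pow₀ h
    nlinarith [mul_le_mul_of_nonneg_right h3 (Real.exp_pos x).le]

lemma abs_exp_neg_sub_quadratic_le {x : ℝ} (hx : 0 ≤ x) :
    |Real.exp (-x) - 1 + x - x ^ 2 / 2| ≤ x ^ 3 := by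
  rcases le_total x 1 with h | h
  · have hb := Real.exp_bound (x := -x) (by rwa [abs_neg, abs_of_nonneg hx]) (n := 3) (by norm_num)
    norm_num [Finset.sum_range_succ, Nat.factorial, abs_of_nonneg hx] at hb
    have h3 : 0 ≤ x ^ 3 := by positivity
    rw [abs_le] at hb ⊢
    constructor <;> linarith [hb.1, hb.2]
  · have h1 : Real.exp (-x) ≤ 1 := Real.exp_le_one_iff.2 (by linarith)
    have h2 := Real.exp_pos (-x)
    rw [abs_le]
    constructor <;> nlinarith [mul_nonneg hx (sub_nonneg.2 h),
      mul_nonneg (mul_nonneg hx hx) (sub_nonneg.2 h)]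

lemma exp_sub_one_le_mul_exp (x : ℝ) : Real.exp x - 1 ≤ x * Real.exp x := by
  have h := Real.add_one_le_exp (-x)
  have h2 : Real.exp (-x) * Real.exp x = 1 := by rw [← Real.exp_add]; simp
  nlinarith [mul_le_mul_of_nonneg_right h (Real.exp_pos x).le]

lemma one_sub_exp_neg_div_le {p : ℝ} (hp : 0 < p) :
    (1 - Real.exp (-p)) / p ≤ 2 / (1 + p) := by
  have h := Real.add_one_le_exp (-p)
  have h2 := Real.exp_pos (-p)
  rw [div_le_div_iff₀ hp (by linarith)]
  rcases le_total p 1 with h1 | h1 <;> nlinarith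

lemma exp_sub_one_div_le {q : ℝ} (hq : 0 < q) :
    (Real.exp q - 1) / q ≤ 2 * Real.exp q / (1 + q) := by
  have h := one_sub_exp_neg_div_le hq
  have h2 : Real.exp (-q) * Real.exp q = 1 := by rw [← Real.exp_add]; simp
  calc (Real.exp q - 1) / q = (1 - Real.exp (-q)) / q * Real.exp q := by
        rw [div_mul_eq_mul_div]; congr 1; linarith
    _ ≤ 2 / (1 + q) * Real.exp q := mul_le_mul_of_nonneg_right h (Real.exp_pos q).le
    _ = _ := by ring

/-- The second difference quotient, with steps `p` and `q`, of a decaying exponential divided by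
its second derivative. -/
noncomputable def expStencil (p q : ℝ) : ℝ :=
  2 * ((Real.exp q - 1) / q - (1 - Real.exp (-p)) / p) / (p + q)

/-- The quadratic Taylor polynomials contribute exactly `1`; the cubic remainders, divided by the
steps, are at most `p² + q² exp q`. On unequal steps only first order can be expected. -/
lemma abs_expStencil_sub_one_le {p q : ℝ} (hp : 0 < p) (hq : 0 < q) :
    |expStencil p q - 1| ≤ 2 * (p + q) * Real.exp q := by
  have h1 := abs_exp_sub_quadratic_le hq.le
  have h2 := abs_exp_neg_sub_quadratic_le hp.le
  have he : 1 ≤ Real.exp q := Real.one_le_exp hq.le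
  have key : expStencil p q - 1 = 2 * ((Real.exp q - 1 - q - q ^ 2 / 2) / q
      + (Real.exp (-p) - 1 + p - p ^ 2 / 2) / p) / (p + q) := by
    unfold expStencil
    field_simp
    ring
  have h1' : |(Real.exp q - 1 - q - q ^ 2 / 2) / q| ≤ q ^ 2 * Real.exp q := by
    rw [abs_div, abs_of_pos hq, div_le_iff₀ hq]; linarith
  have h2' : |(Real.exp (-p) - 1 + p - p ^ 2 / 2) / p| ≤ p ^ 2 := by
    rw [abs_div, abs_of_pos hp, div_le_iff₀ hp]; linarith
  rw [key, abs_div, abs_mul, abs_two, abs_of_pos (add_pos hp hq), div_le_iff₀ (add_pos hp hq)]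
  have h3 := abs_add_le ((Real.exp q - 1 - q - q ^ 2 / 2) / q)
    ((Real.exp (-p) - 1 + p - p ^ 2 / 2) / p)
  have h4 : p ^ 2 ≤ p ^ 2 * Real.exp q := le_mul_of_one_le_right (by positivity) he
  have h5 : 0 ≤ p * q * Real.exp q := by positivity
  nlinarith

lemma expStencil_nonneg {p q : ℝ} (hp : 0 < p) (hq : 0 < q) : 0 ≤ expStencil p q := by
  have h1 : 1 ≤ (Real.exp q - 1) / q := by
    rw [le_div_iff₀ hq]; linarith [Real.add_one_le_exp q]
  have h2 : (1 - Real.exp (-p)) / p ≤ 1 := by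
    rw [div_le_iff₀ hp]; linarith [Real.add_one_le_exp (-p)]
  unfold expStencil
  apply div_nonneg _ (by linarith)
  linarith

/-- For use where the steps are not small. The denominator `(1 + p) (1 + q)` bounds the factor by
which the discrete exponential can decay over the same two steps. -/
lemma expStencil_le {p q : ℝ} (hp : 0 < p) (hq : 0 < q) :
    expStencil p q ≤ 12 * Real.exp q / ((1 + p) * (1 + q)) := by
  have he : 1 ≤ Real.exp q := Real.one_le_exp hq.le
  rcases le_total (p + q) 1 with h | h
  · have h1 := (abs_le.1 (abs_expStencil_sub_one_le hp hq)).2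
    have h2 : (1 + p) * (1 + q) ≤ 4 := by nlinarith
    have h3 : expStencil p q ≤ 3 * Real.exp q := by
      nlinarith [mul_le_mul_of_nonneg_right h (Real.exp_pos q).le]
    rw [le_div_iff₀ (by positivity)]
    calc expStencil p q * ((1 + p) * (1 + q)) ≤ 3 * Real.exp q * 4 := by
          apply mul_le_mul h3 h2 (by positivity) (by positivity)
      _ = _ := by ring
  · have h1 := exp_sub_one_div_le hq
    have h2 : 0 ≤ (1 - Real.exp (-p)) / p :=
      div_nonneg (by linarith [Real.exp_le_one_iff.2 (neg_nonpos.2 hp.le)]) hp.le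
    have h3 : 1 / (p + q) ≤ 2 / (1 + p) := by
      rw [div_le_div_iff₀ (by linarith) (by linarith)]; linarith
    calc expStencil p q ≤ 2 * (2 * Real.exp q / (1 + q)) * (1 / (p + q)) := by
          unfold expStencil
          rw [div_eq_mul_one_div]
          apply mul_le_mul_of_nonneg_right _ (by positivity)
          linarith
      _ ≤ 2 * (2 * Real.exp q / (1 + q)) * (2 / (1 + p)) := by
          apply mul_le_mul_of_nonneg_left h3 (by positivity)
      _ = 8 * Real.exp q / ((1 + p) * (1 + q)) := by field_simp; ring
      _ ≤ _ := by gcongr; norm_num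

/-! ### Maximum principles on one side of the interface -/

/-- A function with `ε e'' + μ A e' - b e ≤ 0` has no negative interior minimum. -/
lemma min_zero_le_of_diffOp_nonpos {ℓ ε μ : ℝ} {A b e e' e'' : ℝ → ℝ} (hℓ : 0 < ℓ) (hε : 0 < ε)
    (hb : ∀ t ∈ Icc 0 ℓ, 0 < b t) (hc : ContinuousOn e (Icc 0 ℓ))
    (he : ∀ t ∈ Ioo 0 ℓ, HasDerivAt e (e' t) t) (he' : ∀ t ∈ Ioo 0 ℓ, HasDerivAt e' (e'' t) t)
    (hop : ∀ t ∈ Ioo 0 ℓ, ε * e'' t + μ * A t * e' t - b t * e t ≤ 0) (hend : 0 ≤ e ℓ) :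
    ∀ t ∈ Icc 0 ℓ, min (e 0) 0 ≤ e t := by
  obtain ⟨s, hs, hmin⟩ := isCompact_Icc.exists_isMinOn (nonempty_Icc.2 hℓ.le) hc
  have hmin' : ∀ t ∈ Icc 0 ℓ, e s ≤ e t := fun t ht => hmin ht
  intro t ht
  refine le_trans ?_ (hmin' t ht)
  by_contra! hlt
  obtain ⟨h0, h1⟩ := lt_min_iff.1 hlt
  have hs0 : 0 < s := lt_of_le_of_ne hs.1 (by rintro rfl; exact lt_irrefl _ h0)
  have hsl : s < ℓ := lt_of_le_of_ne hs.2 (by rintro rfl; linarith)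
  have hsI : s ∈ Ioo 0 ℓ := ⟨hs0, hsl⟩
  have hloc : IsLocalMin e s := hmin.isLocalMin (Icc_mem_nhds hs0 hsl)
  have hd0 : e' s = 0 := by rw [← (he s hsI).deriv]; exact hloc.deriv_eq_zero
  have hdd : deriv e =ᶠ[nhds s] e' := by
    filter_upwards [Ioo_mem_nhds hs0 hsl] with x hx using (he x hx).deriv
  have hdd2 : deriv (deriv e) s = e'' s := by rw [hdd.deriv_eq]; exact (he' s hsI).deriv
  -- If the second derivative were negative, the minimum would also be a local maximum, making the
  -- function locally constant and the second derivative zero.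
  have h2 : 0 ≤ e'' s := by
    by_contra! hneg
    have hmax : IsLocalMax e s := isLocalMax_of_deriv_deriv_neg (by rw [hdd2]; exact hneg)
      (by rw [hdd.eq_of_nhds]; exact hd0) (he s hsI).continuousAt
    have hconst : e =ᶠ[nhds s] fun _ => e s := by
      filter_upwards [hloc, hmax] with x h1 h2 using le_antisymm h2 h1
    have : deriv (deriv e) s = 0 := by
      rw [hconst.deriv.deriv_eq]; simp
    linarith
  have := hop s hsI
  rw [hd0] at this
  nlinarith [hb s hs]

/-- The upwind operator on one side of the interface, on the mesh `t` of distances to it. -/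
noncomputable def upwindOp (ε μ : ℝ) (A b : ℝ → ℝ) (t G : ℕ → ℝ) (j : ℕ) : ℝ :=
  ε * secondDiffQuot t G j + μ * A (t j) * fwdDiffQuot t G j - b (t j) * G j

/-- A mesh function with nonpositive image under the upwind operator has no negative interior
minimum. -/
lemma min_zero_le_of_upwindOp_nonpos {M : ℕ} {ε μ : ℝ} {A b : ℝ → ℝ} {t G : ℕ → ℝ}
    (hε : 0 < ε) (hμ : 0 < μ) (ht : ∀ j < M, t j < t (j + 1))
    (hA : ∀ j ≤ M, 0 < A (t j)) (hb : ∀ j ≤ M, 0 < b (t j))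
    (hop : ∀ j, 1 ≤ j → j < M → upwindOp ε μ A b t G j ≤ 0) (hend : 0 ≤ G M) :
    ∀ j ≤ M, min (G 0) 0 ≤ G j := by
  obtain ⟨s, hs, hmin⟩ := Finset.exists_min_image (Finset.range (M + 1)) G ⟨0, by simp⟩
  intro j hj
  refine le_trans ?_ (hmin j (by simp; omega))
  by_contra! hlt
  obtain ⟨h0, h1⟩ := lt_min_iff.1 hlt
  have hs0 : s ≠ 0 := by rintro rfl; exact lt_irrefl _ h0
  have hsM : s ≠ M := by rintro rfl; linarith
  have hsM' : s < M := by simp at hs; omega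
  have hF : 0 ≤ fwdDiffQuot t G s :=
    div_nonneg (sub_nonneg.2 (hmin (s + 1) (by simp; omega))) (sub_nonneg.2 (ht s hsM').le)
  have htn : t (s - 1) < t s := by
    have := ht (s - 1) (by omega)
    rwa [Nat.sub_add_cancel (by omega)] at this
  have hB : bwdDiffQuot t G s ≤ 0 :=
    div_nonpos_of_nonpos_of_nonneg (sub_nonpos.2 (hmin (s - 1) (by simp; omega)))
      (sub_nonneg.2 htn.le)
  have hS : 0 ≤ secondDiffQuot t G s :=
    div_nonneg (by linarith) (by linarith [ht s hsM'])
  have := hop s (by omega) hsM'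
  unfold upwindOp at this
  have h2 := mul_nonneg (mul_pos hμ (hA s hsM'.le)).le hF
  have h3 := mul_nonneg hε.le hS
  nlinarith [hb s hsM'.le]

/-! ### The discrete exponential barrier -/

/-- The discrete analogue of `exp (-r t)` on the mesh `t`. -/
noncomputable def meshExp (r : ℝ) (t : ℕ → ℝ) (j : ℕ) : ℝ :=
  ∏ k ∈ Finset.range j, (1 + r * (t (k + 1) - t k))⁻¹

lemma meshExp_zero (r : ℝ) (t : ℕ → ℝ) : meshExp r t 0 = 1 := by simp [meshExp]

lemma meshExp_succ (r : ℝ) (t : ℕ → ℝ) (j : ℕ) :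
    meshExp r t (j + 1) = meshExp r t j * (1 + r * (t (j + 1) - t j))⁻¹ := by
  exact Finset.prod_range_succ _ _

section
variable {M : ℕ} {r : ℝ} {t : ℕ → ℝ}

lemma meshExp_pos (hr : 0 < r) (ht : ∀ j < M, t j < t (j + 1)) {j : ℕ} (hj : j ≤ M) :
    0 < meshExp r t j := by
  apply Finset.prod_pos
  intro k hk
  have := ht k (by simp at hk; omega)
  have := mul_pos hr (sub_pos.2 this)
  positivity

lemma meshExp_eq_mul (hr : 0 < r) (ht : ∀ j < M, t j < t (j + 1)) {j : ℕ} (hj : j < M) :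
    meshExp r t j = meshExp r t (j + 1) * (1 + r * (t (j + 1) - t j)) := by
  have := mul_pos hr (sub_pos.2 (ht j hj))
  rw [meshExp_succ]
  field_simp

lemma meshExp_succ_le (hr : 0 < r) (ht : ∀ j < M, t j < t (j + 1)) {j : ℕ} (hj : j < M) :
    meshExp r t (j + 1) ≤ meshExp r t j := by
  have := mul_pos hr (sub_pos.2 (ht j hj))
  rw [meshExp_eq_mul hr ht hj]
  nlinarith [meshExp_pos hr ht (j := j + 1) hj]

lemma meshExp_le_one (hr : 0 < r) (ht : ∀ j < M, t j < t (j + 1)) {j : ℕ} (hj : j ≤ M) :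
    meshExp r t j ≤ 1 := by
  induction j with
  | zero => simp [meshExp_zero]
  | succ k ih => exact (meshExp_succ_le hr ht hj).trans (ih (by omega))

/-- Factorwise `1 + x ≤ exp x`. This turns the decay of a continuous layer into a multiple of the
discrete barrier. -/
lemma exp_le_meshExp (hr : 0 < r) (ht : ∀ j < M, t j < t (j + 1)) (h0 : t 0 = 0) {j : ℕ}
    (hj : j ≤ M) : Real.exp (-(r * t j)) ≤ meshExp r t j := by
  induction j with
  | zero => simp [meshExp_zero, h0]
  | succ k ih =>
    have hp := mul_pos hr (sub_pos.2 (ht k hj))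
    have h1 := ih (by omega)
    have h2 : Real.exp (-(r * (t (k + 1) - t k))) ≤ (1 + r * (t (k + 1) - t k))⁻¹ := by
      rw [Real.exp_neg]
      apply inv_anti₀ (by linarith)
      linarith [Real.add_one_le_exp (r * (t (k + 1) - t k))]
    rw [meshExp_succ, show -(r * t (k + 1)) = -(r * t k) + -(r * (t (k + 1) - t k)) by ring,
      Real.exp_add]
    exact mul_le_mul h1 h2 (Real.exp_pos _).le ((Real.exp_pos _).le.trans h1)

lemma fwdDiffQuot_meshExp (hr : 0 < r) (ht : ∀ j < M, t j < t (j + 1)) {j : ℕ} (hj : j < M) :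
    fwdDiffQuot t (meshExp r t) j = -(r * meshExp r t (j + 1)) := by
  have := sub_pos.2 (ht j hj)
  rw [fwdDiffQuot, meshExp_eq_mul hr ht hj]
  field_simp
  ring

/-- The forward quotient is exactly `-r W (j + 1)`, and the second quotient is at most `2 r² W (j +
1)` for any ratio of neighbouring steps, because the divisor is at least the forward step. The
diffusion term is then paid by half of the convection term together with the reaction term. -/
lemma upwindOp_meshExp_le {ε μ α γ : ℝ} {A b : ℝ → ℝ} (hε : 0 < ε) (hμ : 0 < μ) (hr : 0 < r)
    (ht : ∀ j < M, t j < t (j + 1)) (hγ : 0 < γ) {j : ℕ} (h1 : 1 ≤ j) (hj : j < M)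
    (hA : α ≤ A (t j)) (hb : γ ≤ b (t j)) (hrr : 2 * ε * r ^ 2 ≤ μ * α * r / 2 + γ) :
    upwindOp ε μ A b t (meshExp r t) j ≤ -(μ * α * r / 2 * meshExp r t (j + 1)) := by
  obtain ⟨k, rfl⟩ : ∃ k, j = k + 1 := ⟨j - 1, by omega⟩
  have hm := sub_pos.2 (ht (k + 1) hj)
  have hn := sub_pos.2 (ht k (by omega))
  have hB := meshExp_pos hr ht (j := k + 1 + 1) (by omega)
  have hBle := meshExp_succ_le hr ht hj
  have hF := fwdDiffQuot_meshExp hr ht hj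
  have hBw : bwdDiffQuot t (meshExp r t) (k + 1) = -(r * meshExp r t (k + 1)) :=
    fwdDiffQuot_meshExp hr ht (j := k) (by omega)
  have hS : secondDiffQuot t (meshExp r t) (k + 1) ≤ 2 * r ^ 2 * meshExp r t (k + 1 + 1) := by
    rw [secondDiffQuot, hF, hBw, Nat.add_sub_cancel, div_le_iff₀ (by linarith),
      meshExp_eq_mul hr ht hj]
    have : 0 ≤ 2 * r ^ 2 * meshExp r t (k + 1 + 1) * (t (k + 1) - t k) := by positivity
    nlinarith
  have e1 : ε * secondDiffQuot t (meshExp r t) (k + 1)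
      ≤ (2 * ε * r ^ 2) * meshExp r t (k + 1 + 1) := by nlinarith
  have e2 := mul_le_mul_of_nonneg_right hrr hB.le
  have e3 : μ * α * (r * meshExp r t (k + 1 + 1))
      ≤ μ * A (t (k + 1)) * (r * meshExp r t (k + 1 + 1)) := by gcongr
  have e4 : γ * meshExp r t (k + 1 + 1) ≤ b (t (k + 1)) * meshExp r t (k + 1) :=
    mul_le_mul hb hBle hB.le (by linarith)
  unfold upwindOp
  rw [hF]
  nlinarith
end

/-! ### The logarithmically graded mesh and its one-sided version -/

/-- The value `exp (-θ x / 8)` at the `k`-th point of the graded mesh. -/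
noncomputable def layerWeight (N k : ℕ) : ℝ := 1 - 8 * (k : ℝ) / N * (1 - 1 / √(N : ℝ))

/-- Logarithmically graded mesh points, measured from the position of the layer. -/
noncomputable def layerMesh (θ : ℝ) (N k : ℕ) : ℝ := -(8 / θ * Real.log (layerWeight N k))

section
variable {N k : ℕ}

lemma layerWeight_zero (N : ℕ) : layerWeight N 0 = 1 := by simp [layerWeight]

lemma layerMesh_zero (θ : ℝ) (N : ℕ) : layerMesh θ N 0 = 0 := by
  simp [layerMesh, layerWeight_zero]

lemma one_div_sqrt_facts (hN : 8 ≤ N) :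
    0 < 1 / √(N : ℝ) ∧ 1 / √(N : ℝ) ≤ 1 / 2 ∧ (1 / √(N : ℝ)) ^ 2 = (N : ℝ)⁻¹ := by
  have hN' : (8 : ℝ) ≤ N := by exact_mod_cast hN
  have h2 : (2 : ℝ) ≤ √(N : ℝ) := Real.le_sqrt_of_sq_le (by linarith)
  refine ⟨by positivity, ?_, ?_⟩
  · apply one_div_le_one_div_of_le (by norm_num) h2
  · rw [div_pow, Real.sq_sqrt (by linarith), one_pow, one_div]

lemma layerWeight_ge (hN : 8 ≤ N) (hk : 8 * k ≤ N) : 1 / √(N : ℝ) ≤ layerWeight N k := by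
  obtain ⟨h0, h1, -⟩ := one_div_sqrt_facts hN
  have hN' : (0 : ℝ) < N := by exact_mod_cast (by omega : 0 < N)
  have hk' : 8 * (k : ℝ) / N ≤ 1 := by
    rw [div_le_one hN']; exact_mod_cast hk
  unfold layerWeight
  nlinarith

lemma layerWeight_pos (hN : 8 ≤ N) (hk : 8 * k ≤ N) : 0 < layerWeight N k :=
  (one_div_sqrt_facts hN).1.trans_le (layerWeight_ge hN hk)

lemma layerWeight_last (hN : 8 ≤ N) (hk : 8 * k = N) : layerWeight N k = 1 / √(N : ℝ) := by
  have hN' : (0 : ℝ) < N := by exact_mod_cast (by omega : 0 < N)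
  have hk' : 8 * (k : ℝ) / N = 1 := by
    rw [div_eq_one_iff_eq hN'.ne']; exact_mod_cast hk
  rw [layerWeight, hk']
  ring

lemma layerWeight_sub (N k : ℕ) :
    layerWeight N k - layerWeight N (k + 1) = 8 * (N : ℝ)⁻¹ * (1 - 1 / √(N : ℝ)) := by
  unfold layerWeight
  push_cast
  ring

lemma layerWeight_succ_lt (hN : 8 ≤ N) : layerWeight N (k + 1) < layerWeight N k := by
  have h := layerWeight_sub N k
  obtain ⟨h0, h1, -⟩ := one_div_sqrt_facts hN
  have hN' : (0 : ℝ) < (N : ℝ)⁻¹ := by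
    have : (0 : ℝ) < N := by exact_mod_cast (by omega : 0 < N)
    positivity
  nlinarith

lemma layerWeight_sub_le (hN : 8 ≤ N) :
    layerWeight N k - layerWeight N (k + 1) ≤ 8 * (N : ℝ)⁻¹ := by
  obtain ⟨h0, h1, -⟩ := one_div_sqrt_facts hN
  rw [layerWeight_sub]
  apply mul_le_of_le_one_right (by positivity)
  linarith

lemma inv_le_one_div_sqrt (hN : 8 ≤ N) : 2 * (N : ℝ)⁻¹ ≤ 1 / √(N : ℝ) := by
  obtain ⟨h0, h1, h2⟩ := one_div_sqrt_facts hN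
  rw [← h2]
  nlinarith

/-- One decrement is at most `8 / N ≤ 3 / √N` since `√N ≥ 8 / 3`, and every weight in the layer is
at least `1 / √N`. -/
lemma layerWeight_le_four_mul (hN : 8 ≤ N) (hk : 8 * (k + 1) ≤ N) :
    layerWeight N k ≤ 4 * layerWeight N (k + 1) := by
  have h1 := layerWeight_sub_le (k := k) hN
  have h2 := layerWeight_ge hN hk
  have h0 := (one_div_sqrt_facts hN).1
  have hN' : (8 : ℝ) ≤ N := by exact_mod_cast hN
  have h3 : (N : ℝ)⁻¹ * 8 ≤ 3 * (1 / √(N : ℝ)) := by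
    have hs : (8 / 3 : ℝ) ≤ √(N : ℝ) := Real.le_sqrt_of_sq_le (by norm_num; linarith)
    have : (1 / √(N : ℝ)) * √(N : ℝ) = 1 := by field_simp
    rw [← (one_div_sqrt_facts hN).2.2]
    nlinarith
  linarith

variable {θ : ℝ}

lemma exp_neg_layerMesh (hθ : 0 < θ) (hN : 8 ≤ N) (hk : 8 * k ≤ N) :
    Real.exp (-(θ * layerMesh θ N k / 8)) = layerWeight N k := by
  rw [layerMesh, show -(θ * -(8 / θ * Real.log (layerWeight N k)) / 8)
    = Real.log (layerWeight N k) by field_simp; try ring, Real.exp_log (layerWeight_pos hN hk)]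

lemma exp_layerMesh (hθ : 0 < θ) (hN : 8 ≤ N) (hk : 8 * k ≤ N) :
    Real.exp (θ * layerMesh θ N k / 8) = (layerWeight N k)⁻¹ := by
  rw [← exp_neg_layerMesh hθ hN hk, Real.exp_neg, inv_inv]

lemma layerMesh_lt_succ (hθ : 0 < θ) (hN : 8 ≤ N) (hk : 8 * (k + 1) ≤ N) :
    layerMesh θ N k < layerMesh θ N (k + 1) := by
  have := Real.log_lt_log (layerWeight_pos hN hk) (layerWeight_succ_lt (k := k) hN)
  have h8 : 0 < 8 / θ := by positivity
  unfold layerMesh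
  nlinarith

/-- The weights `exp(-θ x / 8)` fall by equal amounts of at most `8 / N`; apply `log z ≤ z - 1` to
the ratio of neighbouring weights. -/
lemma layerMesh_step_le (hθ : 0 < θ) (hN : 8 ≤ N) (hk : 8 * (k + 1) ≤ N) :
    θ * (layerMesh θ N (k + 1) - layerMesh θ N k)
      ≤ 64 * (N : ℝ)⁻¹ * Real.exp (θ * layerMesh θ N (k + 1) / 8) := by
  have hp := layerWeight_pos hN hk
  have hp' := layerWeight_pos (k := k) hN (by omega)
  have h1 := Real.log_le_sub_one_of_pos (div_pos hp' hp)
  rw [Real.log_div hp'.ne' hp.ne'] at h1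
  have h2 : layerWeight N k / layerWeight N (k + 1) - 1
      ≤ 8 * (N : ℝ)⁻¹ * (layerWeight N (k + 1))⁻¹ := by
    rw [div_sub_one hp.ne', div_eq_mul_inv]
    exact mul_le_mul_of_nonneg_right (layerWeight_sub_le hN) (by positivity)
  have h3 : θ * (layerMesh θ N (k + 1) - layerMesh θ N k)
      = 8 * (Real.log (layerWeight N k) - Real.log (layerWeight N (k + 1))) := by
    unfold layerMesh
    field_simp
    ring
  rw [exp_layerMesh hθ hN hk, h3]
  linarith

lemma layerMesh_step_le_const (hθ : 0 < θ) (hN : 8 ≤ N) (hk : 8 * (k + 1) ≤ N) :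
    θ * (layerMesh θ N (k + 1) - layerMesh θ N k) ≤ 64 := by
  have h := layerMesh_step_le hθ hN hk
  rw [exp_layerMesh hθ hN hk] at h
  have hp := layerWeight_pos hN hk
  have h1 : (N : ℝ)⁻¹ * (layerWeight N (k + 1))⁻¹ ≤ 1 := by
    rw [← div_eq_mul_inv, div_le_one hp]
    have := inv_le_one_div_sqrt hN
    have := layerWeight_ge hN hk
    have : (0 : ℝ) ≤ (N : ℝ)⁻¹ := by positivity
    linarith
  linarith

lemma exp_neg_layerMesh_quarter (hθ : 0 < θ) (hN : 8 ≤ N) (hk : 8 * k ≤ N) :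
    Real.exp (-(θ * layerMesh θ N k / 4)) = layerWeight N k ^ 2 := by
  rw [← exp_neg_layerMesh hθ hN hk, ← Real.exp_nat_mul]
  congr 1
  push_cast
  ring

lemma layerMesh_last (hN : 8 ≤ N) (hk : 8 * k = N) :
    layerMesh θ N k = 4 / θ * Real.log N := by
  rw [layerMesh, layerWeight_last hN hk, one_div, Real.log_inv, Real.log_sqrt (by positivity)]
  ring

/-- At the transition point the value is exactly `1 / N`. The node just before it is needed because
the three-point stencil at the transition point reaches back to it; the weight ratio `4`, squared,
costs the factor `16`. -/
lemma exp_neg_layerMesh_pred_last_le (hθ : 0 < θ) (hN : 8 ≤ N) (hk : 8 * (k + 1) = N) :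
    Real.exp (-(θ * layerMesh θ N k / 4)) ≤ 16 * (N : ℝ)⁻¹ := by
  rw [exp_neg_layerMesh_quarter hθ hN (by omega), ← (one_div_sqrt_facts hN).2.2,
    ← layerWeight_last hN hk]
  have h1 := layerWeight_le_four_mul (k := k) hN hk.le
  have h2 := layerWeight_pos (k := k) hN (by omega)
  nlinarith

/-- The Shishkin–Bakhvalov mesh on one side of the interface, as distances to it. -/
noncomputable def halfMesh (ℓ θ₁ θ₂ : ℝ) (N j : ℕ) : ℝ :=
  let σ := 4 / θ₂ * Real.log N
  let τ := 4 / θ₁ * Real.log N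
  if 8 * j ≤ N then layerMesh θ₁ N j
  else if 8 * j ≤ 3 * N then τ + (ℓ - σ - τ) * (4 * ((j : ℝ) / N) - 1 / 2)
  else ℓ - layerMesh θ₂ N (N / 2 - j)

/-- What the error analysis uses about the mesh. -/
structure LayerAdapted (N : ℕ) (ℓ θ₁ θ₂ : ℝ) (t : ℕ → ℝ) : Prop where
  zero : t 0 = 0
  last : t (N / 2) = ℓ
  lt_succ : ∀ j < N / 2, t j < t (j + 1)
  inner_step : ∀ j, 8 * (j + 1) ≤ N →
    θ₁ * (t (j + 1) - t j) ≤ 64 * (N : ℝ)⁻¹ * Real.exp (θ₁ * t (j + 1) / 8)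
  inner_step_const : ∀ j, 8 * (j + 1) ≤ N → θ₁ * (t (j + 1) - t j) ≤ 64
  inner_far : ∀ j ≤ N / 2, N ≤ 8 * (j + 1) → Real.exp (-(θ₁ * t j / 4)) ≤ 16 * (N : ℝ)⁻¹
  outer_step : ∀ j < N / 2, 3 * N ≤ 8 * j →
    θ₂ * (t (j + 1) - t j) ≤ 64 * (N : ℝ)⁻¹ * Real.exp (θ₂ * (ℓ - t j) / 8)
  outer_step_const : ∀ j < N / 2, 3 * N ≤ 8 * j → θ₂ * (t (j + 1) - t j) ≤ 64
  outer_far : ∀ j < N / 2, 8 * j ≤ 3 * N →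
    Real.exp (-(θ₂ * (ℓ - t (j + 1)) / 4)) ≤ 16 * (N : ℝ)⁻¹
  first_le : t 1 ≤ ℓ / 2

lemma LayerAdapted.mono {N : ℕ} {ℓ θ₁ θ₂ : ℝ} {t : ℕ → ℝ} (h : LayerAdapted N ℓ θ₁ θ₂ t)
    {i j : ℕ} (hij : i ≤ j) (hj : j ≤ N / 2) : t i ≤ t j := by
  induction j, hij using Nat.le_induction with
  | base => exact le_rfl
  | succ k _ ih => exact (ih (by omega)).trans (h.lt_succ k (by omega)).le

lemma LayerAdapted.mem_Icc {N : ℕ} {ℓ θ₁ θ₂ : ℝ} {t : ℕ → ℝ} (h : LayerAdapted N ℓ θ₁ θ₂ t)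
    {j : ℕ} (hj : j ≤ N / 2) : t j ∈ Icc 0 ℓ :=
  ⟨h.zero ▸ h.mono (Nat.zero_le j) hj, h.last ▸ h.mono hj le_rfl⟩

section
variable {N j : ℕ} {ℓ θ₁ θ₂ : ℝ}

lemma halfMesh_of_le (hj : 8 * j ≤ N) : halfMesh ℓ θ₁ θ₂ N j = layerMesh θ₁ N j := by
  simp [halfMesh, hj]

/-- Includes the transition index `8 j = 3 N`, where the definition takes the uniform branch; both
formulas agree there. The graded piece is indexed backwards from the boundary. -/
lemma halfMesh_of_ge (h8 : 8 ∣ N) (hN : 8 ≤ N) (h1 : 3 * N ≤ 8 * j) :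
    halfMesh ℓ θ₁ θ₂ N j = ℓ - layerMesh θ₂ N (N / 2 - j) := by
  have hne : ¬ 8 * j ≤ N := by omega
  by_cases h : 8 * j ≤ 3 * N
  · have hj : 8 * (N / 2 - j) = N := by omega
    have hjN : (j : ℝ) / N = 3 / 8 := by
      have : (8 * (j : ℝ)) = 3 * N := by exact_mod_cast le_antisymm h h1
      have hN' : (0 : ℝ) < N := by exact_mod_cast (by omega : 0 < N)
      field_simp
      linarith
    simp only [halfMesh, hne, h, if_true, if_false, layerMesh_last hN hj, hjN]
    ring
  · simp [halfMesh, hne, h]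

lemma halfMesh_of_mid (hN : 8 ≤ N) (h1 : N ≤ 8 * j) (h2 : 8 * j ≤ 3 * N) :
    halfMesh ℓ θ₁ θ₂ N j = 4 / θ₁ * Real.log N
      + (ℓ - 4 / θ₂ * Real.log N - 4 / θ₁ * Real.log N) * (4 * ((j : ℝ) / N) - 1 / 2) := by
  by_cases h : 8 * j ≤ N
  · have hj : 8 * j = N := by omega
    have hjN : (j : ℝ) / N = 1 / 8 := by
      have : (8 * (j : ℝ)) = N := by exact_mod_cast hj
      have hN' : (0 : ℝ) < N := by exact_mod_cast (by omega : 0 < N)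
      field_simp
      linarith
    rw [halfMesh_of_le h, layerMesh_last hN hj, hjN]
    ring
  · simp [halfMesh, h, h2]

lemma halfMesh_lt_succ (hθ₁ : 0 < θ₁) (hθ₂ : 0 < θ₂) (h8 : 8 ∣ N) (hN : 8 ≤ N)
    (hℓ : 4 / θ₂ * Real.log N + 4 / θ₁ * Real.log N < ℓ) (hj : j < N / 2) :
    halfMesh ℓ θ₁ θ₂ N j < halfMesh ℓ θ₁ θ₂ N (j + 1) := by
  by_cases h1 : 8 * (j + 1) ≤ N
  · rw [halfMesh_of_le h1, halfMesh_of_le (by omega)]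
    exact layerMesh_lt_succ hθ₁ hN h1
  by_cases h2 : 8 * (j + 1) ≤ 3 * N
  · rw [halfMesh_of_mid hN (by omega) h2, halfMesh_of_mid hN (by omega) (by omega)]
    have hN' : (0 : ℝ) < N := by exact_mod_cast (by omega : 0 < N)
    have : (j : ℝ) / N < ((j + 1 : ℕ) : ℝ) / N := by
      gcongr
      omega
    nlinarith
  · rw [halfMesh_of_ge h8 hN (by omega), halfMesh_of_ge h8 hN (by omega)]
    have h := layerMesh_lt_succ (k := N / 2 - (j + 1)) hθ₂ hN (by omega)
    rw [show N / 2 - (j + 1) + 1 = N / 2 - j by omega] at h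
    linarith

lemma layerAdapted_halfMesh (hθ₂ : 0 < θ₂) (hθ : θ₂ ≤ θ₁) (h8 : 8 ∣ N) (hN : 8 ≤ N)
    (hℓ : 4 / θ₂ * Real.log N + 4 / θ₁ * Real.log N < ℓ) :
    LayerAdapted N ℓ θ₁ θ₂ (halfMesh ℓ θ₁ θ₂ N) := by
  have hθ₁ : 0 < θ₁ := hθ₂.trans_le hθ
  have hlast : halfMesh ℓ θ₁ θ₂ N (N / 2) = ℓ := by
    rw [halfMesh_of_ge h8 hN (by omega), Nat.sub_self, layerMesh_zero, sub_zero]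
  have hmono : ∀ i j, i ≤ j → j ≤ N / 2 → halfMesh ℓ θ₁ θ₂ N i ≤ halfMesh ℓ θ₁ θ₂ N j := by
    intro i j hij hj
    induction j, hij using Nat.le_induction with
    | base => exact le_rfl
    | succ k _ ih =>
      exact (ih (by omega)).trans (halfMesh_lt_succ hθ₁ hθ₂ h8 hN hℓ (by omega)).le
  refine ⟨by rw [halfMesh_of_le (by omega), layerMesh_zero], hlast,
    fun j hj => halfMesh_lt_succ hθ₁ hθ₂ h8 hN hℓ hj, ?_, ?_, ?_, ?_, ?_, ?_, ?_⟩
  · intro j hj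
    rw [halfMesh_of_le hj, halfMesh_of_le (by omega)]
    exact layerMesh_step_le hθ₁ hN hj
  · intro j hj
    rw [halfMesh_of_le hj, halfMesh_of_le (by omega)]
    exact layerMesh_step_le_const hθ₁ hN hj
  · intro j hj hj8
    -- By monotonicity the worst index is the one just inside the interior layer.
    have h := hmono (N / 8 - 1) j (by omega) hj
    rw [halfMesh_of_le (by omega)] at h
    refine le_trans ?_ (exp_neg_layerMesh_pred_last_le (k := N / 8 - 1) hθ₁ hN (by omega))
    rw [Real.exp_le_exp]
    nlinarith
  · intro j hj hj8
    rw [halfMesh_of_ge h8 hN (by omega), halfMesh_of_ge h8 hN (by omega)]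
    have h := layerMesh_step_le (k := N / 2 - (j + 1)) hθ₂ hN (by omega)
    rw [show N / 2 - (j + 1) + 1 = N / 2 - j by omega] at h
    rw [sub_sub_cancel]
    linarith
  · intro j hj hj8
    rw [halfMesh_of_ge h8 hN (by omega), halfMesh_of_ge h8 hN (by omega)]
    have h := layerMesh_step_le_const (k := N / 2 - (j + 1)) hθ₂ hN (by omega)
    rw [show N / 2 - (j + 1) + 1 = N / 2 - j by omega] at h
    linarith
  · intro j hj hj8
    -- Here the worst node is the first one inside the boundary layer, again one step beyond the
    -- transition point.
    have h := hmono (j + 1) (3 * (N / 8) + 1) (by omega) (by omega)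
    rw [halfMesh_of_ge (j := 3 * (N / 8) + 1) h8 hN (by omega)] at h
    refine le_trans ?_ (exp_neg_layerMesh_pred_last_le (k := N / 2 - (3 * (N / 8) + 1)) hθ₂ hN
      (by omega))
    rw [Real.exp_le_exp]
    nlinarith
  -- The first node is at most `τ`, and `τ ≤ σ` because `θ₂ ≤ θ₁`; so `2 τ ≤ σ + τ < ℓ`.
  · have h := hmono 1 (N / 8) (by omega) (by omega)
    rw [halfMesh_of_le (j := N / 8) (by omega), layerMesh_last hN (by omega)] at h
    have hlog : 0 ≤ Real.log N := Real.log_natCast_nonneg N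
    have : 4 / θ₁ * Real.log N ≤ 4 / θ₂ * Real.log N := by gcongr
    linarith
end

/-! ### Data on one side of the interface and layer rates -/

/-- The coefficients `A`, `b` and the reduced solution `v` on one side of the interface, with all
bounds expressed by a single constant `K`. -/
structure HalfProblem (K ℓ : ℝ) (A b v v' v'' : ℝ → ℝ) : Prop where
  one_le : 1 ≤ K
  len_pos : 0 < ℓ
  len : 1 ≤ K * ℓ
  A_lower : ∀ t ∈ Icc 0 ℓ, K⁻¹ ≤ A t
  A_upper : ∀ t ∈ Icc 0 ℓ, A t ≤ K
  b_lower : ∀ t ∈ Icc 0 ℓ, K⁻¹ ≤ b t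
  b_upper : ∀ t ∈ Icc 0 ℓ, b t ≤ K
  A_lip : ∀ t ∈ Icc 0 ℓ, ∀ s ∈ Icc 0 ℓ, |A t - A s| ≤ K * |t - s|
  b_lip : ∀ t ∈ Icc 0 ℓ, ∀ s ∈ Icc 0 ℓ, |b t - b s| ≤ K * |t - s|
  v_bound : ∀ t ∈ Icc 0 ℓ, |v t| ≤ K
  v'_bound : ∀ t ∈ Icc 0 ℓ, |v' t| ≤ K
  v''_bound : ∀ t ∈ Icc 0 ℓ, |v'' t| ≤ K
  v_deriv : ∀ t ∈ Icc 0 ℓ, HasDerivWithinAt v (v' t) (Icc 0 ℓ) t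
  v'_deriv : ∀ t ∈ Icc 0 ℓ, HasDerivWithinAt v' (v'' t) (Icc 0 ℓ) t

/-- The exact layer rates `κ` (at the interface) and `lam` (at the boundary) of the operator with
frozen coefficients, compared with the mesh rates `θ₁`, `θ₂`; `δ` is the mesh parameter. -/
structure LayerRates (K ℓ ε μ δ θ₁ θ₂ κ lam : ℝ) (A b : ℝ → ℝ) : Prop where
  ε_pos : 0 < ε
  μ_pos : 0 < μ
  θ₂_pos : 0 < θ₂
  θ₂_le_θ₁ : θ₂ ≤ θ₁
  ε_le : ε ≤ K * δ
  μ_le : μ ≤ K * δ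
  one_le_θ₂ : 1 ≤ K * δ * θ₂
  θ₂_le : θ₂ ≤ lam
  lam_le : lam ≤ K * θ₂
  θ₁_le : θ₁ ≤ κ
  κ_le : κ ≤ K * θ₁
  lam_eq : ε * lam ^ 2 + μ * A ℓ * lam = b ℓ
  κ_eq : ε * κ ^ 2 = μ * A 0 * κ + b 0

lemma mul_exp_neg_le_one (x : ℝ) : x * Real.exp (-x) ≤ 1 := by
  have h := Real.add_one_le_exp x
  have h2 : Real.exp x * Real.exp (-x) = 1 := by rw [← Real.exp_add]; simp
  nlinarith [Real.exp_pos (-x)]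

section
variable {K ℓ ε μ δ θ₁ θ₂ κ lam : ℝ} {A b v v' v'' : ℝ → ℝ}

lemma HalfProblem.v_hasDerivAt (H : HalfProblem K ℓ A b v v' v'') {t : ℝ} (ht : t ∈ Ioo 0 ℓ) :
    HasDerivAt v (v' t) t :=
  (H.v_deriv t (Ioo_subset_Icc_self ht)).hasDerivAt (Icc_mem_nhds ht.1 ht.2)

lemma HalfProblem.v'_hasDerivAt (H : HalfProblem K ℓ A b v v' v'') {t : ℝ} (ht : t ∈ Ioo 0 ℓ) :
    HasDerivAt v' (v'' t) t :=
  (H.v'_deriv t (Ioo_subset_Icc_self ht)).hasDerivAt (Icc_mem_nhds ht.1 ht.2)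

lemma HalfProblem.zero_mem (H : HalfProblem K ℓ A b v v' v'') : (0 : ℝ) ∈ Icc 0 ℓ :=
  ⟨le_rfl, H.len_pos.le⟩

lemma HalfProblem.len_mem (H : HalfProblem K ℓ A b v v' v'') : ℓ ∈ Icc 0 ℓ :=
  ⟨H.len_pos.le, le_rfl⟩

lemma HalfProblem.A_pos (H : HalfProblem K ℓ A b v v' v'') {t : ℝ} (ht : t ∈ Icc 0 ℓ) : 0 < A t :=
  (inv_pos.2 (zero_lt_one.trans_le H.one_le)).trans_le (H.A_lower t ht)

lemma HalfProblem.b_pos (H : HalfProblem K ℓ A b v v' v'') {t : ℝ} (ht : t ∈ Icc 0 ℓ) : 0 < b t :=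
  (inv_pos.2 (zero_lt_one.trans_le H.one_le)).trans_le (H.b_lower t ht)

lemma LayerRates.lam_pos (R : LayerRates K ℓ ε μ δ θ₁ θ₂ κ lam A b) : 0 < lam :=
  R.θ₂_pos.trans_le R.θ₂_le

lemma LayerRates.κ_pos (R : LayerRates K ℓ ε μ δ θ₁ θ₂ κ lam A b) : 0 < κ :=
  (R.θ₂_pos.trans_le R.θ₂_le_θ₁).trans_le R.θ₁_le

variable (H : HalfProblem K ℓ A b v v' v'') (R : LayerRates K ℓ ε μ δ θ₁ θ₂ κ lam A b)
include H R

lemma LayerRates.δ_pos : 0 < δ := by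
  have := R.one_le_θ₂
  have h1 := R.θ₂_pos
  have hK := H.one_le
  by_contra! h
  have : K * δ * θ₂ ≤ 0 := mul_nonpos_of_nonpos_of_nonneg (by nlinarith) h1.le
  linarith

lemma LayerRates.one_le_lam : 1 ≤ K * δ * lam := by
  have hd := R.δ_pos H
  have hK := H.one_le
  exact R.one_le_θ₂.trans (mul_le_mul_of_nonneg_left R.θ₂_le (by positivity))

lemma LayerRates.one_le_κ : 1 ≤ K * δ * κ := by
  have hd := R.δ_pos H
  have hK := H.one_le
  exact R.one_le_θ₂.trans
    (mul_le_mul_of_nonneg_left (R.θ₂_le_θ₁.trans R.θ₁_le) (by positivity))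

/-- No uniform bound on `μ κ` is available (in the convection regime `κ` is of order `μ / ε`). This
is the source of the factor `1 + μ κ W` in all interface residuals. -/
lemma LayerRates.ε_mul_κ_sq_le : ε * κ ^ 2 ≤ K * (μ * κ + 1) := by
  have h := mul_pos R.μ_pos R.κ_pos
  have h1 := H.A_upper 0 H.zero_mem
  have h2 := H.b_upper 0 H.zero_mem
  rw [R.κ_eq]
  nlinarith

lemma LayerRates.ε_mul_lam_sq_le : ε * lam ^ 2 ≤ K := by
  have h := mul_pos (mul_pos R.μ_pos (H.A_pos H.len_mem)) R.lam_pos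
  linarith [R.lam_eq, H.b_upper ℓ H.len_mem]

lemma LayerRates.μ_mul_lam_le : μ * lam ≤ K ^ 2 := by
  have h := mul_pos R.μ_pos R.lam_pos
  have h1 := H.A_lower ℓ H.len_mem
  have h2 := H.b_upper ℓ H.len_mem
  have h3 : 0 ≤ ε * lam ^ 2 := mul_nonneg R.ε_pos.le (sq_nonneg _)
  have hK : 0 < K := by linarith [H.one_le]
  have h4 : K⁻¹ * (μ * lam) ≤ K := by nlinarith [R.lam_eq]
  rw [inv_mul_le_iff₀ hK] at h4
  linarith

lemma LayerRates.barrier_pos : 0 < κ / (4 * K ^ 2) := by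
  have := R.κ_pos
  have := H.one_le
  positivity

lemma LayerRates.barrier_le : κ / (4 * K ^ 2) ≤ κ / 4 := by
  have := R.κ_pos
  have := H.one_le
  apply div_le_div_of_nonneg_left (by positivity) (by norm_num)
  nlinarith

/-- The condition required by `upwindOp_meshExp_le`. Dividing `κ` by `4 K²` makes the quadratic
diffusion term small enough for the lower bounds `K⁻¹` of the coefficients. -/
lemma LayerRates.barrier_rate : 2 * ε * (κ / (4 * K ^ 2)) ^ 2
    ≤ μ * K⁻¹ * (κ / (4 * K ^ 2)) / 2 + K⁻¹ := by
  have hK := H.one_le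
  have hK0 : 0 < K := by linarith
  have h := R.ε_mul_κ_sq_le H
  have hm := mul_pos R.μ_pos R.κ_pos
  have e1 : 2 * ε * (κ / (4 * K ^ 2)) ^ 2 = (ε * κ ^ 2) / (8 * K ^ 4) := by field_simp; ring
  have e2 : μ * K⁻¹ * (κ / (4 * K ^ 2)) / 2 + K⁻¹ = (K * (μ * κ) + 8 * K ^ 3) / (8 * K ^ 4) := by
    field_simp
    ring
  rw [e1, e2]
  gcongr
  have : K ≤ K ^ 3 := le_self_pow₀ hK (by norm_num)
  nlinarith

/-- By the choice of `κ` only coefficient differences remain, at most `(μ κ + 1) K t`. Since `x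
exp(-x) ≤ 1`, the exponential turns `μ κ t` into `μ` and `t` into `1 / κ`, both `O(δ)`. -/
lemma interior_frozen_residual {t : ℝ} (ht : t ∈ Icc 0 ℓ) :
    |(ε * κ ^ 2 - μ * A t * κ - b t) * Real.exp (-(κ * t))| ≤ 2 * K ^ 2 * δ := by
  have hκ := R.κ_pos
  have hμ := R.μ_pos
  have hK := H.one_le
  have hx := mul_exp_neg_le_one (κ * t)
  have hE := Real.exp_pos (-(κ * t))
  have hA := H.A_lip 0 H.zero_mem t ht
  have hb := H.b_lip 0 H.zero_mem t ht
  rw [zero_sub, abs_neg, abs_of_nonneg ht.1] at hA hb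
  have h1 : |ε * κ ^ 2 - μ * A t * κ - b t| ≤ (μ * κ + 1) * (K * t) := by
    rw [R.κ_eq, show μ * A 0 * κ + b 0 - μ * A t * κ - b t
      = μ * κ * (A 0 - A t) + (b 0 - b t) by ring]
    refine (abs_add_le _ _).trans ?_
    rw [abs_mul, abs_of_pos (mul_pos hμ hκ)]
    nlinarith [mul_pos hμ hκ]
  have h2 := R.one_le_κ H
  have h3 := R.μ_le
  have hd := R.δ_pos H
  rw [abs_mul, abs_of_pos hE]
  have ht0 := ht.1
  have h4 : t * Real.exp (-(κ * t)) ≤ K * δ := by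
    have : t * Real.exp (-(κ * t)) ≤ K * δ * κ * (t * Real.exp (-(κ * t))) :=
      le_mul_of_one_le_left (by positivity) h2
    have : K * δ * (κ * t * Real.exp (-(κ * t))) ≤ K * δ * 1 := by gcongr
    linarith
  have h5 : μ * (κ * t * Real.exp (-(κ * t))) ≤ K * δ * 1 := by gcongr
  calc _ ≤ (μ * κ + 1) * (K * t) * Real.exp (-(κ * t)) := by gcongr
    _ = K * (μ * (κ * t * Real.exp (-(κ * t))) + t * Real.exp (-(κ * t))) := by ring
    _ ≤ K * (K * δ * 1 + K * δ) := by gcongr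
    _ = _ := by ring

lemma boundary_frozen_residual {t : ℝ} (ht : t ∈ Icc 0 ℓ) :
    |(ε * lam ^ 2 + μ * A t * lam - b t) * Real.exp (-(lam * (ℓ - t)))| ≤ 2 * K ^ 4 * δ := by
  have hl := R.lam_pos
  have hμ := R.μ_pos
  have hK := H.one_le
  have hx := mul_exp_neg_le_one (lam * (ℓ - t))
  have hE := Real.exp_pos (-(lam * (ℓ - t)))
  have hA := H.A_lip t ht ℓ H.len_mem
  have hb := H.b_lip ℓ H.len_mem t ht
  have ht0 : 0 ≤ ℓ - t := sub_nonneg.2 ht.2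
  rw [abs_sub_comm t, abs_of_nonneg ht0] at hA
  rw [abs_of_nonneg ht0] at hb
  have hd := R.δ_pos H
  have h1 : |ε * lam ^ 2 + μ * A t * lam - b t| ≤ (K ^ 2 + 1) * (K * (ℓ - t)) := by
    rw [show ε * lam ^ 2 + μ * A t * lam - b t
      = μ * lam * (A t - A ℓ) + (b ℓ - b t) by rw [← R.lam_eq]; ring]
    refine (abs_add_le _ _).trans ?_
    rw [abs_mul, abs_of_pos (mul_pos hμ hl), add_mul, one_mul]
    exact add_le_add (mul_le_mul (R.μ_mul_lam_le H) hA (abs_nonneg _) (by positivity)) hb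
  have h2 := R.one_le_lam H
  rw [abs_mul, abs_of_pos hE]
  have h4 : (ℓ - t) * Real.exp (-(lam * (ℓ - t))) ≤ K * δ := by
    have : (ℓ - t) * Real.exp (-(lam * (ℓ - t)))
        ≤ K * δ * lam * ((ℓ - t) * Real.exp (-(lam * (ℓ - t)))) :=
      le_mul_of_one_le_left (by positivity) h2
    have : K * δ * (lam * (ℓ - t) * Real.exp (-(lam * (ℓ - t)))) ≤ K * δ * 1 := by gcongr
    linarith
  have h5 : K ^ 2 + 1 ≤ 2 * K ^ 2 := by nlinarith
  calc _ ≤ (K ^ 2 + 1) * (K * (ℓ - t)) * Real.exp (-(lam * (ℓ - t))) := by gcongr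
    _ = (K ^ 2 + 1) * K * ((ℓ - t) * Real.exp (-(lam * (ℓ - t)))) := by ring
    _ ≤ 2 * K ^ 2 * K * (K * δ) := by gcongr
    _ = _ := by ring

lemma smooth_residual {t x y : ℝ} (ht : t ∈ Icc 0 ℓ) (hx : |x| ≤ 2 * K) (hy : |y| ≤ K) :
    |ε * x + μ * A t * y| ≤ 3 * K ^ 3 * δ := by
  have hd := R.δ_pos H
  have hK := H.one_le
  have hμ := R.μ_pos
  have hε := R.ε_pos
  have hA := H.A_pos ht
  refine (abs_add_le _ _).trans ?_
  rw [abs_mul, abs_mul, abs_mul, abs_of_pos hμ, abs_of_pos hε, abs_of_pos hA]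
  have h1 : ε * |x| ≤ K * δ * (2 * K) :=
    mul_le_mul R.ε_le hx (abs_nonneg _) (by positivity)
  have h2 : μ * A t * |y| ≤ K * δ * K * K :=
    mul_le_mul (mul_le_mul R.μ_le (H.A_upper t ht) hA.le (by positivity)) hy (abs_nonneg _)
      (by positivity)
  have h3 : K ^ 2 * δ ≤ K ^ 3 * δ := by gcongr; norm_num
  nlinarith
end

/-! ### Difference quotients of the components -/

section
variable {t : ℕ → ℝ} {k : ℕ} {r : ℝ}

lemma fwdDiffQuot_exp_neg (hr : 0 < r) (hm : t k < t (k + 1)) :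
    fwdDiffQuot t (fun i => Real.exp (-(r * t i))) k
      = -(r * Real.exp (-(r * t k))
        * ((1 - Real.exp (-(r * (t (k + 1) - t k)))) / (r * (t (k + 1) - t k)))) := by
  have hm' := sub_pos.2 hm
  have e : Real.exp (-(r * t (k + 1)))
      = Real.exp (-(r * t k)) * Real.exp (-(r * (t (k + 1) - t k))) := by
    rw [← Real.exp_add]; congr 1; ring
  simp only [fwdDiffQuot, e]
  field_simp
  ring

lemma secondDiffQuot_exp_neg (hr : 0 < r) (hn : t k < t (k + 1)) (hm : t (k + 1) < t (k + 2)) :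
    secondDiffQuot t (fun i => Real.exp (-(r * t i))) (k + 1)
      = r ^ 2 * Real.exp (-(r * t (k + 1)))
        * expStencil (r * (t (k + 2) - t (k + 1))) (r * (t (k + 1) - t k)) := by
  have hm' := sub_pos.2 hm
  have hn' := sub_pos.2 hn
  have hF := fwdDiffQuot_exp_neg hr hm
  have hB : bwdDiffQuot t (fun i => Real.exp (-(r * t i))) (k + 1)
      = -(r * Real.exp (-(r * t (k + 1)))
        * ((Real.exp (r * (t (k + 1) - t k)) - 1) / (r * (t (k + 1) - t k)))) := by
    have e : Real.exp (-(r * t k))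
        = Real.exp (-(r * t (k + 1))) * Real.exp (r * (t (k + 1) - t k)) := by
      rw [← Real.exp_add]; congr 1; ring
    simp only [bwdDiffQuot, Nat.add_sub_cancel, e]
    field_simp
    ring
  have hs : t (k + 2) - t k = (t (k + 2) - t (k + 1)) + (t (k + 1) - t k) := by ring
  rw [secondDiffQuot, hF, hB, expStencil, Nat.add_sub_cancel, show k + 1 + 1 = k + 2 from rfl, hs]
  generalize t (k + 2) - t (k + 1) = m at *
  generalize t (k + 1) - t k = n at *
  have : 0 < m + n := by linarith
  field_simp
  ring

lemma fwdDiffQuot_exp {ℓ : ℝ} (hr : 0 < r) (hm : t k < t (k + 1)) :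
    fwdDiffQuot t (fun i => Real.exp (-(r * (ℓ - t i)))) k
      = r * Real.exp (-(r * (ℓ - t k)))
        * ((Real.exp (r * (t (k + 1) - t k)) - 1) / (r * (t (k + 1) - t k))) := by
  have hm' := sub_pos.2 hm
  have e : Real.exp (-(r * (ℓ - t (k + 1))))
      = Real.exp (-(r * (ℓ - t k))) * Real.exp (r * (t (k + 1) - t k)) := by
    rw [← Real.exp_add]; congr 1; ring
  simp only [fwdDiffQuot, e]
  field_simp

lemma secondDiffQuot_exp {ℓ : ℝ} (hr : 0 < r) (hn : t k < t (k + 1)) (hm : t (k + 1) < t (k + 2)) :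
    secondDiffQuot t (fun i => Real.exp (-(r * (ℓ - t i)))) (k + 1)
      = r ^ 2 * Real.exp (-(r * (ℓ - t (k + 1))))
        * expStencil (r * (t (k + 1) - t k)) (r * (t (k + 2) - t (k + 1))) := by
  have hm' := sub_pos.2 hm
  have hn' := sub_pos.2 hn
  have hF := fwdDiffQuot_exp (ℓ := ℓ) hr hm
  have hB : bwdDiffQuot t (fun i => Real.exp (-(r * (ℓ - t i)))) (k + 1)
      = r * Real.exp (-(r * (ℓ - t (k + 1))))
        * ((1 - Real.exp (-(r * (t (k + 1) - t k)))) / (r * (t (k + 1) - t k))) := by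
    have e : Real.exp (-(r * (ℓ - t k)))
        = Real.exp (-(r * (ℓ - t (k + 1)))) * Real.exp (-(r * (t (k + 1) - t k))) := by
      rw [← Real.exp_add]; congr 1; ring
    simp only [bwdDiffQuot, Nat.add_sub_cancel, e]
    field_simp
  have hs : t (k + 2) - t k = (t (k + 2) - t (k + 1)) + (t (k + 1) - t k) := by ring
  rw [secondDiffQuot, hF, hB, expStencil, Nat.add_sub_cancel, show k + 1 + 1 = k + 2 from rfl, hs]
  generalize t (k + 2) - t (k + 1) = m at *
  generalize t (k + 1) - t k = n at *
  have : 0 < m + n := by linarith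
  field_simp
  ring

variable {K ℓ : ℝ} {A b v v' v'' : ℝ → ℝ}

lemma HalfProblem.slope (H : HalfProblem K ℓ A b v v' v'') {x y : ℝ} (hx : 0 ≤ x) (hxy : x < y)
    (hy : y ≤ ℓ) : ∃ ξ ∈ Ioo x y, (v y - v x) / (y - x) = v' ξ := by
  obtain ⟨ξ, h1, h2⟩ := exists_hasDerivAt_eq_slope v v' hxy
    (fun z hz => ((H.v_deriv z ⟨hx.trans hz.1, hz.2.trans hy⟩).continuousWithinAt).mono
      (Icc_subset_Icc hx hy))
    (fun z hz => H.v_hasDerivAt ⟨hx.trans_lt hz.1, hz.2.trans_le hy⟩)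
  exact ⟨ξ, h1, h2.symm⟩

lemma HalfProblem.abs_fwdDiffQuot_le (H : HalfProblem K ℓ A b v v' v'') (hx : 0 ≤ t k)
    (hxy : t k < t (k + 1)) (hy : t (k + 1) ≤ ℓ) : |fwdDiffQuot t (fun i => v (t i)) k| ≤ K := by
  obtain ⟨ξ, h1, h2⟩ := H.slope hx hxy hy
  rw [fwdDiffQuot, h2]
  exact H.v'_bound ξ ⟨hx.trans h1.1.le, h1.2.le.trans hy⟩

/-- The two one-sided quotients are values of `v'` at points of the stencil interval, whose distance
is at most its length. Boundedness suffices, since this quotient is multiplied by `ε = O(δ)`. -/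
lemma HalfProblem.abs_secondDiffQuot_le (H : HalfProblem K ℓ A b v v' v'') (hx : 0 ≤ t k)
    (hn : t k < t (k + 1)) (hm : t (k + 1) < t (k + 2)) (hy : t (k + 2) ≤ ℓ) :
    |secondDiffQuot t (fun i => v (t i)) (k + 1)| ≤ 2 * K := by
  obtain ⟨ξ, h1, h2⟩ := H.slope hx hn (hm.le.trans hy)
  obtain ⟨η, h3, h4⟩ := H.slope (hx.trans hn.le) hm hy
  have hξ : ξ ∈ Icc 0 ℓ := ⟨hx.trans h1.1.le, h1.2.le.trans (hm.le.trans hy)⟩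
  have hη : η ∈ Icc 0 ℓ := ⟨(hx.trans hn.le).trans h3.1.le, h3.2.le.trans hy⟩
  have h5 := (convex_Icc 0 ℓ).norm_image_sub_le_of_norm_hasDerivWithin_le
    (f := v') (C := K) H.v'_deriv H.v''_bound hξ hη
  rw [Real.norm_eq_abs, Real.norm_eq_abs, abs_of_pos (show 0 < η - ξ by linarith [h1.2, h3.1])] at h5
  have hK := H.one_le
  have h6 : |v' η - v' ξ| ≤ K * (t (k + 2) - t k) := by
    refine h5.trans ?_
    gcongr
    · exact h3.2.le
    · exact h1.1.le
  simp only [secondDiffQuot, fwdDiffQuot, bwdDiffQuot, Nat.add_sub_cancel]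
  rw [show k + 1 + 1 = k + 2 from rfl, h2, h4, abs_div, abs_mul, abs_two,
    abs_of_pos (show 0 < t (k + 2) - t k by linarith), div_le_iff₀ (by linarith)]
  linarith
end

/-! ### Discrete residuals of the layer components -/

lemma abs_one_sub_exp_neg_div_sub_one_le {p : ℝ} (hp : 0 < p) :
    |(1 - Real.exp (-p)) / p - 1| ≤ p := by
  have h1 := Real.add_one_le_exp (-p)
  have h3 : Real.exp (-p) * Real.exp p = 1 := by rw [← Real.exp_add]; simp
  have h4 := Real.exp_pos (-p)
  have h6 : p * Real.exp (-p) ≤ 1 - Real.exp (-p) := by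
    nlinarith [Real.add_one_le_exp p]
  have h7 : (1 - Real.exp (-p)) / p ≤ 1 := by rw [div_le_one hp]; linarith
  have h8 : Real.exp (-p) ≤ (1 - Real.exp (-p)) / p := by rw [le_div_iff₀ hp]; linarith
  rw [abs_of_nonpos (by linarith)]
  linarith

lemma abs_exp_sub_one_div_sub_one_le {p : ℝ} (hp : 0 < p) :
    |(Real.exp p - 1) / p - 1| ≤ p * Real.exp p := by
  have h1 := exp_sub_one_le_mul_exp p
  have h2 := Real.add_one_le_exp p
  have h7 : (Real.exp p - 1) / p ≤ Real.exp p := by rw [div_le_iff₀ hp]; linarith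
  have h8 : 1 ≤ (Real.exp p - 1) / p := by rw [le_div_iff₀ hp]; linarith
  rw [abs_of_nonneg (by linarith)]
  linarith

/-- Small steps: `r` is the frozen-coefficient residual, `S` and `D` are the ratios of second and
first difference quotients to derivatives, and `g` is the layer function. -/
lemma abs_perturbed_residual_le {e m g S D F Q r c : ℝ} (hg : 0 ≤ g) (he : |e| ≤ Q) (hm : |m| ≤ Q)
    (hS : |S - 1| ≤ 2 * F) (hD : |D - 1| ≤ F) (hr : |r| ≤ c) :
    |r + e * g * (S - 1) + m * g * (D - 1)| ≤ c + 3 * Q * (F * g) := by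
  have hQ : 0 ≤ Q := (abs_nonneg _).trans he
  have h1 : |e * g * (S - 1)| ≤ Q * g * (2 * F) := by
    rw [abs_mul, abs_mul, abs_of_nonneg hg]
    exact mul_le_mul (mul_le_mul_of_nonneg_right he hg) hS (abs_nonneg _) (by positivity)
  have h2 : |m * g * (D - 1)| ≤ Q * g * F := by
    rw [abs_mul, abs_mul, abs_of_nonneg hg]
    exact mul_le_mul (mul_le_mul_of_nonneg_right hm hg) hD (abs_nonneg _) (by positivity)
  refine (abs_add_three _ _ _).trans ?_
  linarith

/-- Steps of arbitrary size: no cancellation is used and each of the three terms is small by itself.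
Here `P = μ κ`, `W` and `X` are the discrete exponential at the forward node and at the node itself,
and `g E` is the layer function at the backward node; the denominators in `S` and `D` undo the decay
of `W` over the stencil. -/
lemma abs_far_residual_le {K P X e m β g S D E p q W δ : ℝ} (hK : 0 ≤ K) (hP : 0 ≤ P) (hδ : 0 ≤ δ)
    (he0 : 0 ≤ e) (he : e ≤ K * (P + 1)) (hm0 : 0 ≤ m) (hm : m ≤ K * P) (hβ0 : 0 ≤ β)
    (hβ : β ≤ K) (hg : 0 ≤ g) (hp : 0 < p) (hq : 0 < q) (hS0 : 0 ≤ S)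
    (hS : S ≤ 12 * E / ((1 + p) * (1 + q))) (hD0 : 0 ≤ D) (hD : D ≤ 2 / (1 + p)) (hW0 : 0 ≤ W)
    (hW1 : W ≤ 1) (hX1 : X ≤ 1) (hXW : X ≤ W * (1 + p)) (hgX : g ≤ 16 * δ * X)
    (hgE : g * E ≤ 16 * δ * (W * (1 + p) * (1 + q))) :
    |e * g * S - m * g * D - β * g| ≤ 224 * K * δ * (1 + P * W) := by
  have u1 : g * (E / ((1 + p) * (1 + q))) ≤ 16 * δ * W := by
    rw [← mul_div_assoc, div_le_iff₀ (by positivity)]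
    linarith
  have u2 : g * (1 / (1 + p)) ≤ 16 * δ * W := by
    rw [mul_one_div, div_le_iff₀ (by positivity)]
    have := mul_le_mul_of_nonneg_left hXW (by positivity : 0 ≤ 16 * δ)
    linarith
  have u3 : g ≤ 16 * δ := hgX.trans (mul_le_of_le_one_right (by positivity) hX1)
  have t1 : e * g * S ≤ K * (P + 1) * (192 * δ * W) := by
    calc e * g * S ≤ K * (P + 1) * g * (12 * E / ((1 + p) * (1 + q))) :=
          mul_le_mul (mul_le_mul_of_nonneg_right he hg) hS hS0 (by positivity)
      _ = K * (P + 1) * (12 * (g * (E / ((1 + p) * (1 + q))))) := by ring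
      _ ≤ K * (P + 1) * (12 * (16 * δ * W)) := by gcongr
      _ = _ := by ring
  have t2 : m * g * D ≤ K * P * (32 * δ * W) := by
    calc m * g * D ≤ K * P * g * (2 / (1 + p)) :=
          mul_le_mul (mul_le_mul_of_nonneg_right hm hg) hD hD0 (by positivity)
      _ = K * P * (2 * (g * (1 / (1 + p)))) := by ring
      _ ≤ K * P * (2 * (16 * δ * W)) := by gcongr
      _ = _ := by ring
  have t3 : β * g ≤ K * (16 * δ) := mul_le_mul hβ u3 hg hK
  have n1 : 0 ≤ e * g * S := by positivity
  have n2 : 0 ≤ m * g * D := by positivity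
  have n3 : 0 ≤ β * g := by positivity
  have hX : 0 ≤ K * δ := by positivity
  have hY : 0 ≤ K * δ * (P * W) := by positivity
  have hZ : K * δ * W ≤ K * δ := mul_le_of_le_one_right hX hW1
  rw [abs_le]
  constructor <;> linarith

section
variable {K ℓ ε μ θ₁ θ₂ κ lam : ℝ} {A b v v' v'' : ℝ → ℝ} {N : ℕ} {t : ℕ → ℝ}
  (H : HalfProblem K ℓ A b v v' v'') (R : LayerRates K ℓ ε μ (N : ℝ)⁻¹ θ₁ θ₂ κ lam A b)
  (T : LayerAdapted N ℓ θ₁ θ₂ t)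
include H R T

lemma interior_step_le {k : ℕ} (hk : 8 * (k + 1) ≤ N) : κ * (t (k + 1) - t k) ≤ 64 * K := by
  have hn := sub_pos.2 (T.lt_succ k (by omega))
  have h1 := T.inner_step_const k hk
  have h2 := mul_le_mul_of_nonneg_right R.κ_le hn.le
  nlinarith [H.one_le]

lemma interior_step_le_exp {k j : ℕ} (hk : 8 * (k + 1) ≤ N) (hkj : k + 1 ≤ j) (hj : j ≤ N / 2) :
    κ * (t (k + 1) - t k) ≤ 64 * K * (N : ℝ)⁻¹ * Real.exp (κ * t j / 8) := by
  have hn := sub_pos.2 (T.lt_succ k (by omega))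
  have h1 := T.inner_step k hk
  have h2 := mul_le_mul_of_nonneg_right R.κ_le hn.le
  have hδ := R.δ_pos H
  have hK := H.one_le
  have h3 : Real.exp (θ₁ * t (k + 1) / 8) ≤ Real.exp (κ * t j / 8) := by
    rw [Real.exp_le_exp]
    have := mul_le_mul R.θ₁_le (T.mono hkj hj) (T.mem_Icc (j := k + 1) (by omega)).1 R.κ_pos.le
    linarith
  calc κ * (t (k + 1) - t k) ≤ K * (θ₁ * (t (k + 1) - t k)) := by linarith
    _ ≤ K * (64 * (N : ℝ)⁻¹ * Real.exp (θ₁ * t (k + 1) / 8)) :=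
        mul_le_mul_of_nonneg_left h1 (by linarith)
    _ ≤ K * (64 * (N : ℝ)⁻¹ * Real.exp (κ * t j / 8)) := by gcongr
    _ = _ := by ring

/-- The grading allows steps growing like `exp(κ t / 8)`, whereas the layer decays like `exp(-κ t)`;
what is left beats the barrier rate, which is at most `κ / 4`. Moving from one node to the next
costs only `exp(64 K)`. -/
lemma interior_steps_mul_exp_le {k : ℕ} (hk : 8 * (k + 2) ≤ N) :
    (κ * (t (k + 2) - t (k + 1)) + κ * (t (k + 1) - t k)) * Real.exp (κ * (t (k + 1) - t k))
      * Real.exp (-(κ * t (k + 1)))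
      ≤ 128 * K * Real.exp (128 * K) * (N : ℝ)⁻¹ * meshExp (κ / (4 * K ^ 2)) t (k + 2) := by
  have hκ := R.κ_pos
  have hK := H.one_le
  have hδ := R.δ_pos H
  have ht2 := (T.mem_Icc (j := k + 2) (by omega)).1
  have hWe := exp_le_meshExp (R.barrier_pos H) T.lt_succ T.zero (j := k + 2) (by omega)
  have hp1 := interior_step_le H R T (k := k + 1) hk
  have hq1 := interior_step_le H R T (k := k) (by omega)
  have hp2 := interior_step_le_exp H R T (k := k + 1) (j := k + 2) hk le_rfl (by omega)
  have hq2 := interior_step_le_exp H R T (k := k) (j := k + 2) (by omega) (by omega) (by omega)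
  have heq : Real.exp (κ * (t (k + 1) - t k)) ≤ Real.exp (64 * K) := Real.exp_le_exp.2 hq1
  have hGW : Real.exp (κ * t (k + 2) / 8) * Real.exp (-(κ * t (k + 1)))
      ≤ Real.exp (64 * K) * meshExp (κ / (4 * K ^ 2)) t (k + 2) := by
    refine le_trans ?_ (mul_le_mul_of_nonneg_left hWe (Real.exp_pos _).le)
    rw [← Real.exp_add, ← Real.exp_add, Real.exp_le_exp]
    have h2 := mul_le_mul_of_nonneg_right (R.barrier_le H) ht2
    have h3 : 0 ≤ κ * t (k + 2) := by positivity
    linarith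
  have hE := Real.exp_pos (-(κ * t (k + 1)))
  calc _ ≤ (64 * K * (N : ℝ)⁻¹ * Real.exp (κ * t (k + 2) / 8)
          + 64 * K * (N : ℝ)⁻¹ * Real.exp (κ * t (k + 2) / 8)) * Real.exp (64 * K)
          * Real.exp (-(κ * t (k + 1))) := by
        apply mul_le_mul_of_nonneg_right _ hE.le
        exact mul_le_mul (add_le_add hp2 hq2) heq (Real.exp_pos _).le (by positivity)
    _ = 128 * K * (N : ℝ)⁻¹ * Real.exp (64 * K)
          * (Real.exp (κ * t (k + 2) / 8) * Real.exp (-(κ * t (k + 1)))) := by ring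
    _ ≤ 128 * K * (N : ℝ)⁻¹ * Real.exp (64 * K)
          * (Real.exp (64 * K) * meshExp (κ / (4 * K ^ 2)) t (k + 2)) :=
        mul_le_mul_of_nonneg_left hGW (by positivity)
    _ = 128 * K * (Real.exp (64 * K) * Real.exp (64 * K)) * (N : ℝ)⁻¹
          * meshExp (κ / (4 * K ^ 2)) t (k + 2) := by ring
    _ = _ := by rw [← Real.exp_add]; ring_nf

lemma interior_residual_near {k : ℕ} (hk : 8 * (k + 2) ≤ N) :
    |upwindOp ε μ A b t (fun i => Real.exp (-(κ * t i))) (k + 1)|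
      ≤ (2 * K ^ 2 + 384 * K ^ 2 * Real.exp (128 * K)) * (N : ℝ)⁻¹
        * (1 + μ * κ * meshExp (κ / (4 * K ^ 2)) t (k + 2)) := by
  have hκ := R.κ_pos
  have hμ := R.μ_pos
  have hK := H.one_le
  have hδ := R.δ_pos H
  have hn := T.lt_succ k (by omega)
  have hm := T.lt_succ (k + 1) (by omega)
  have hn' : 0 < κ * (t (k + 1) - t k) := mul_pos hκ (sub_pos.2 hn)
  have hm' : 0 < κ * (t (k + 2) - t (k + 1)) := mul_pos hκ (sub_pos.2 hm)
  have htI := T.mem_Icc (j := k + 1) (by omega)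
  have hA := H.A_upper _ htI
  have hA0 := H.A_pos htI
  have hc0 := R.barrier_pos H
  have hW1 := meshExp_le_one hc0 T.lt_succ (j := k + 2) (by omega)
  have hW0 := meshExp_pos hc0 T.lt_succ (j := k + 2) (by omega)
  have hμκ : 0 < μ * κ := mul_pos hμ hκ
  have he : |ε * κ ^ 2| ≤ K * (μ * κ + 1) := by
    rw [abs_of_nonneg (mul_nonneg R.ε_pos.le (sq_nonneg _))]
    exact R.ε_mul_κ_sq_le H
  have hmA : |-(μ * A (t (k + 1)) * κ)| ≤ K * (μ * κ + 1) := by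
    rw [abs_neg, abs_of_nonneg (by positivity)]
    nlinarith
  have hS := abs_expStencil_sub_one_le hm' hn'
  have hD : |(1 - Real.exp (-(κ * (t (k + 2) - t (k + 1))))) / (κ * (t (k + 2) - t (k + 1))) - 1|
      ≤ (κ * (t (k + 2) - t (k + 1)) + κ * (t (k + 1) - t k))
        * Real.exp (κ * (t (k + 1) - t k)) := by
    refine (abs_one_sub_exp_neg_div_sub_one_le hm').trans ?_
    have : 1 ≤ Real.exp (κ * (t (k + 1) - t k)) := Real.one_le_exp hn'.le
    nlinarith
  have hall := abs_perturbed_residual_le (Real.exp_pos (-(κ * t (k + 1)))).le he hmA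
    (by rw [← mul_assoc]; exact hS) hD (interior_frozen_residual H R htI)
  have hpq := interior_steps_mul_exp_le H R T hk
  have hop : upwindOp ε μ A b t (fun i => Real.exp (-(κ * t i))) (k + 1)
      = (ε * κ ^ 2 - μ * A (t (k + 1)) * κ - b (t (k + 1))) * Real.exp (-(κ * t (k + 1)))
        + ε * κ ^ 2 * Real.exp (-(κ * t (k + 1)))
          * (expStencil (κ * (t (k + 2) - t (k + 1))) (κ * (t (k + 1) - t k)) - 1)
        + -(μ * A (t (k + 1)) * κ) * Real.exp (-(κ * t (k + 1)))
          * ((1 - Real.exp (-(κ * (t (k + 2) - t (k + 1))))) / (κ * (t (k + 2) - t (k + 1))) - 1)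
      := by
    rw [upwindOp, fwdDiffQuot_exp_neg hκ hm, secondDiffQuot_exp_neg hκ hn hm]
    ring
  rw [hop]
  refine hall.trans ?_
  generalize meshExp (κ / (4 * K ^ 2)) t (k + 2) = W at *
  have h1 := mul_le_mul_of_nonneg_left hpq (by positivity : 0 ≤ 3 * (K * (μ * κ + 1)))
  have h2 : 0 ≤ 384 * K ^ 2 * Real.exp (128 * K) * (N : ℝ)⁻¹ := by positivity
  have h3 := mul_le_mul_of_nonneg_left hW1 h2
  have h4 : 0 ≤ 2 * K ^ 2 * (N : ℝ)⁻¹ * (μ * κ * W) := by positivity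
  linarith

lemma interior_residual_far (h8 : 8 ∣ N) {k : ℕ} (hk : N < 8 * (k + 2)) (hkN : k + 1 < N / 2) :
    |upwindOp ε μ A b t (fun i => Real.exp (-(κ * t i))) (k + 1)|
      ≤ 224 * K * (N : ℝ)⁻¹ * (1 + μ * κ * meshExp (κ / (4 * K ^ 2)) t (k + 2)) := by
  have hκ := R.κ_pos
  have hμ := R.μ_pos
  have hK := H.one_le
  have hδ := R.δ_pos H
  have hε := R.ε_pos
  have hn := T.lt_succ k (by omega)
  have hm := T.lt_succ (k + 1) (by omega)
  have hn' : 0 < κ * (t (k + 1) - t k) := mul_pos hκ (sub_pos.2 hn)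
  have hm' : 0 < κ * (t (k + 2) - t (k + 1)) := mul_pos hκ (sub_pos.2 hm)
  have htI := T.mem_Icc (j := k + 1) (by omega)
  have htk := (T.mem_Icc (j := k) (by omega)).1
  have hA := H.A_upper _ htI
  have hA0 := H.A_pos htI
  have hb := H.b_upper _ htI
  have hb0 := H.b_pos htI
  have hc0 := R.barrier_pos H
  have hc1 := R.barrier_le H
  have hW1 := meshExp_le_one hc0 T.lt_succ (j := k + 2) (by omega)
  have hW1' := meshExp_le_one hc0 T.lt_succ (j := k + 1) (by omega)
  have hW0 := meshExp_pos hc0 T.lt_succ (j := k + 2) (by omega)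
  have hεκ := R.ε_mul_κ_sq_le H
  have hS := expStencil_le hm' hn'
  have hS0 := expStencil_nonneg hm' hn'
  have hD := one_sub_exp_neg_div_le hm'
  have hD0 : 0 ≤ (1 - Real.exp (-(κ * (t (k + 2) - t (k + 1))))) / (κ * (t (k + 2) - t (k + 1))) :=
    div_nonneg (by linarith [Real.exp_le_one_iff.2 (neg_nonpos.2 hm'.le)]) hm'.le
  -- Split the decay: a rate `θ₁ / 4 ≤ κ / 4` yields the factor `16 δ`, and the barrier rate, also
  -- at most `κ / 4`, yields `W`.
  have hfar : ∀ j, j ≤ N / 2 → N ≤ 8 * (j + 1) → 0 ≤ t j → Real.exp (-(κ * t j))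
      ≤ 16 * (N : ℝ)⁻¹ * meshExp (κ / (4 * K ^ 2)) t j := by
    intro j hj hj8 htj
    have h1 := T.inner_far j hj hj8
    have h2 := exp_le_meshExp hc0 T.lt_succ T.zero hj
    refine le_trans ?_ (mul_le_mul h1 h2 (Real.exp_pos _).le (by positivity))
    rw [← Real.exp_add, Real.exp_le_exp]
    have h3 := mul_le_mul_of_nonneg_right hc1 htj
    have h4 := mul_le_mul_of_nonneg_right R.θ₁_le htj
    have h5 : 0 ≤ κ * t j := by positivity
    linarith
  have hgk := hfar k (by omega) (by omega) htk
  have hgk1 := hfar (k + 1) (by omega) (by omega) htI.1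
  have hWk := meshExp_eq_mul hc0 T.lt_succ (j := k) (by omega)
  have hWk1 := meshExp_eq_mul hc0 T.lt_succ (j := k + 1) (by omega)
  have hge : Real.exp (-(κ * t k))
      = Real.exp (-(κ * t (k + 1))) * Real.exp (κ * (t (k + 1) - t k)) := by
    rw [← Real.exp_add]; congr 1; ring
  have hop : upwindOp ε μ A b t (fun i => Real.exp (-(κ * t i))) (k + 1)
      = ε * κ ^ 2 * Real.exp (-(κ * t (k + 1)))
          * expStencil (κ * (t (k + 2) - t (k + 1))) (κ * (t (k + 1) - t k))
        - μ * A (t (k + 1)) * κ * Real.exp (-(κ * t (k + 1)))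
          * ((1 - Real.exp (-(κ * (t (k + 2) - t (k + 1))))) / (κ * (t (k + 2) - t (k + 1))))
        - b (t (k + 1)) * Real.exp (-(κ * t (k + 1))) := by
    rw [upwindOp, fwdDiffQuot_exp_neg hκ hm, secondDiffQuot_exp_neg hκ hn hm]
    ring
  have hcm : κ / (4 * K ^ 2) * (t (k + 2) - t (k + 1)) ≤ κ * (t (k + 2) - t (k + 1)) :=
    mul_le_mul_of_nonneg_right (by linarith) (sub_pos.2 hm).le
  have hcn : κ / (4 * K ^ 2) * (t (k + 1) - t k) ≤ κ * (t (k + 1) - t k) :=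
    mul_le_mul_of_nonneg_right (by linarith) (sub_pos.2 hn).le
  have hWp : meshExp (κ / (4 * K ^ 2)) t (k + 1)
      ≤ meshExp (κ / (4 * K ^ 2)) t (k + 2) * (1 + κ * (t (k + 2) - t (k + 1))) := by
    rw [hWk1]; exact mul_le_mul_of_nonneg_left (by linarith) hW0.le
  have hWq : meshExp (κ / (4 * K ^ 2)) t k ≤ meshExp (κ / (4 * K ^ 2)) t (k + 2)
      * (1 + κ * (t (k + 2) - t (k + 1))) * (1 + κ * (t (k + 1) - t k)) := by
    rw [hWk]
    exact mul_le_mul hWp (by linarith) (by linarith [mul_pos hc0 (sub_pos.2 hn)]) (by positivity)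
  rw [hop]
  refine abs_far_residual_le (by linarith) (mul_pos hμ hκ).le hδ.le (by positivity) hεκ
    (by positivity) ?_ hb0.le hb (Real.exp_pos _).le hm' hn' hS0 hS hD0 hD hW0.le hW1 hW1' hWp hgk1
    (hge ▸ hgk.trans (mul_le_mul_of_nonneg_left hWq (by positivity)))
  nlinarith [mul_le_mul_of_nonneg_left hA (mul_pos hμ hκ).le]

lemma boundary_step_le {k : ℕ} (hk : 3 * N ≤ 8 * k) (hkN : k < N / 2) :
    lam * (t (k + 1) - t k) ≤ 64 * K := by
  have hn := sub_pos.2 (T.lt_succ k hkN)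
  have h1 := T.outer_step_const k hkN hk
  have h2 := mul_le_mul_of_nonneg_right R.lam_le hn.le
  nlinarith [H.one_le]

lemma boundary_step_le_exp {j k : ℕ} (hk : 3 * N ≤ 8 * k) (hjk : j ≤ k) (hkN : k < N / 2) :
    lam * (t (k + 1) - t k) ≤ 64 * K * (N : ℝ)⁻¹ * Real.exp (lam * (ℓ - t j) / 8) := by
  have hn := sub_pos.2 (T.lt_succ k hkN)
  have h1 := T.outer_step k hkN hk
  have h2 := mul_le_mul_of_nonneg_right R.lam_le hn.le
  have hδ := R.δ_pos H
  have hK := H.one_le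
  have h3 : Real.exp (θ₂ * (ℓ - t k) / 8) ≤ Real.exp (lam * (ℓ - t j) / 8) := by
    rw [Real.exp_le_exp]
    have := mul_le_mul R.θ₂_le (sub_le_sub_left (T.mono hjk hkN.le) ℓ)
      (sub_nonneg.2 (T.mem_Icc hkN.le).2) R.lam_pos.le
    linarith
  calc lam * (t (k + 1) - t k) ≤ K * (θ₂ * (t (k + 1) - t k)) := by linarith
    _ ≤ K * (64 * (N : ℝ)⁻¹ * Real.exp (θ₂ * (ℓ - t k) / 8)) :=
        mul_le_mul_of_nonneg_left h1 (by linarith)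
    _ ≤ K * (64 * (N : ℝ)⁻¹ * Real.exp (lam * (ℓ - t j) / 8)) := by gcongr
    _ = _ := by ring

lemma boundary_steps_mul_exp_le {k : ℕ} (hk : 3 * N ≤ 8 * k) (hkN : k + 1 < N / 2) :
    (lam * (t (k + 1) - t k) + lam * (t (k + 2) - t (k + 1)))
      * Real.exp (lam * (t (k + 2) - t (k + 1))) * Real.exp (-(lam * (ℓ - t (k + 1))))
      ≤ 128 * K * Real.exp (128 * K) * (N : ℝ)⁻¹ := by
  have hl := R.lam_pos
  have hK := H.one_le
  have hδ := R.δ_pos H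
  have hp1 := boundary_step_le H R T (k := k + 1) (by omega) hkN
  have hq1 := boundary_step_le H R T (k := k) hk (by omega)
  have hp2 := boundary_step_le_exp H R T (j := k) (k := k + 1) (by omega) (by omega) hkN
  have hq2 := boundary_step_le_exp H R T (j := k) (k := k) hk le_rfl (by omega)
  have hep : Real.exp (lam * (t (k + 2) - t (k + 1))) ≤ Real.exp (64 * K) :=
    Real.exp_le_exp.2 hp1
  have hGW : Real.exp (lam * (ℓ - t k) / 8) * Real.exp (-(lam * (ℓ - t (k + 1))))
      ≤ Real.exp (64 * K) := by
    rw [← Real.exp_add, Real.exp_le_exp]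
    have h3 : 0 ≤ lam * (ℓ - t (k + 1)) :=
      mul_nonneg hl.le (sub_nonneg.2 (T.mem_Icc (j := k + 1) (by omega)).2)
    linarith
  have hE := Real.exp_pos (-(lam * (ℓ - t (k + 1))))
  calc _ ≤ (64 * K * (N : ℝ)⁻¹ * Real.exp (lam * (ℓ - t k) / 8)
          + 64 * K * (N : ℝ)⁻¹ * Real.exp (lam * (ℓ - t k) / 8)) * Real.exp (64 * K)
          * Real.exp (-(lam * (ℓ - t (k + 1)))) := by
        apply mul_le_mul_of_nonneg_right _ hE.le
        exact mul_le_mul (add_le_add hq2 hp2) hep (Real.exp_pos _).le (by positivity)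
    _ = 128 * K * (N : ℝ)⁻¹ * Real.exp (64 * K)
          * (Real.exp (lam * (ℓ - t k) / 8) * Real.exp (-(lam * (ℓ - t (k + 1))))) := by ring
    _ ≤ 128 * K * (N : ℝ)⁻¹ * Real.exp (64 * K) * Real.exp (64 * K) :=
        mul_le_mul_of_nonneg_left hGW (by positivity)
    _ = 128 * K * (Real.exp (64 * K) * Real.exp (64 * K)) * (N : ℝ)⁻¹ := by ring
    _ = _ := by rw [← Real.exp_add]; ring_nf

lemma boundary_residual {k : ℕ} (h8 : 8 ∣ N) (hkN : k + 1 < N / 2) :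
    |upwindOp ε μ A b t (fun i => Real.exp (-(lam * (ℓ - t i)))) (k + 1)|
      ≤ (224 * K ^ 3 + 2 * K ^ 4 + 384 * K ^ 4 * Real.exp (128 * K)) * (N : ℝ)⁻¹ := by
  have hl := R.lam_pos
  have hμ := R.μ_pos
  have hK := H.one_le
  have hδ := R.δ_pos H
  have hn := T.lt_succ k (by omega)
  have hm := T.lt_succ (k + 1) (by omega)
  have hn' : 0 < lam * (t (k + 1) - t k) := mul_pos hl (sub_pos.2 hn)
  have hm' : 0 < lam * (t (k + 2) - t (k + 1)) := mul_pos hl (sub_pos.2 hm)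
  have htI := T.mem_Icc (j := k + 1) (by omega)
  have hA := H.A_upper _ htI
  have hA0 := H.A_pos htI
  have hKK : K ≤ K ^ 3 := le_self_pow₀ hK (by norm_num)
  have he0 : 0 ≤ ε * lam ^ 2 := mul_nonneg R.ε_pos.le (sq_nonneg _)
  have he := (R.ε_mul_lam_sq_le H).trans hKK
  have hm0 : 0 ≤ μ * A (t (k + 1)) * lam := by positivity
  have hmA : μ * A (t (k + 1)) * lam ≤ K ^ 3 := by
    have := mul_le_mul (R.μ_mul_lam_le H) hA hA0.le (by positivity)
    linarith
  have hF := fwdDiffQuot_exp (ℓ := ℓ) hl hm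
  have hSe := secondDiffQuot_exp (ℓ := ℓ) hl hn hm
  -- Either both steps of the stencil lie in the graded boundary piece, or its forward node is at
  -- most one step inside that piece.
  by_cases hk : 3 * N ≤ 8 * k
  · have hD : |(Real.exp (lam * (t (k + 2) - t (k + 1))) - 1) / (lam * (t (k + 2) - t (k + 1))) - 1|
        ≤ (lam * (t (k + 1) - t k) + lam * (t (k + 2) - t (k + 1)))
          * Real.exp (lam * (t (k + 2) - t (k + 1))) := by
      refine (abs_exp_sub_one_div_sub_one_le hm').trans ?_
      have := Real.exp_pos (lam * (t (k + 2) - t (k + 1)))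
      gcongr
      linarith
    have hall := abs_perturbed_residual_le (Real.exp_pos (-(lam * (ℓ - t (k + 1))))).le
      ((abs_of_nonneg he0).trans_le he) ((abs_of_nonneg hm0).trans_le hmA)
      (by rw [← mul_assoc]; exact abs_expStencil_sub_one_le hn' hm') hD
      (boundary_frozen_residual H R htI)
    have hpq := boundary_steps_mul_exp_le H R T hk hkN
    have hop : upwindOp ε μ A b t (fun i => Real.exp (-(lam * (ℓ - t i)))) (k + 1)
        = (ε * lam ^ 2 + μ * A (t (k + 1)) * lam - b (t (k + 1)))
            * Real.exp (-(lam * (ℓ - t (k + 1))))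
          + ε * lam ^ 2 * Real.exp (-(lam * (ℓ - t (k + 1))))
            * (expStencil (lam * (t (k + 1) - t k)) (lam * (t (k + 2) - t (k + 1))) - 1)
          + μ * A (t (k + 1)) * lam * Real.exp (-(lam * (ℓ - t (k + 1))))
            * ((Real.exp (lam * (t (k + 2) - t (k + 1))) - 1) / (lam * (t (k + 2) - t (k + 1))) - 1)
        := by
      rw [upwindOp, hF, hSe]
      ring
    rw [hop]
    refine hall.trans ?_
    have h1 := mul_le_mul_of_nonneg_left hpq (by positivity : 0 ≤ 3 * K ^ 3)
    have h2 : 0 ≤ 224 * K ^ 3 * (N : ℝ)⁻¹ := by positivity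
    linarith
  · have hS := (expStencil_le hn' hm').trans (div_le_self (by positivity)
      (one_le_mul_of_one_le_of_one_le (by linarith) (by linarith)))
    have hS0 := expStencil_nonneg hn' hm'
    have hD : (Real.exp (lam * (t (k + 2) - t (k + 1))) - 1) / (lam * (t (k + 2) - t (k + 1)))
        ≤ Real.exp (lam * (t (k + 2) - t (k + 1))) := by
      rw [div_le_iff₀ hm']; linarith [exp_sub_one_le_mul_exp (lam * (t (k + 2) - t (k + 1)))]
    have hD0 : 0 ≤ (Real.exp (lam * (t (k + 2) - t (k + 1))) - 1)
        / (lam * (t (k + 2) - t (k + 1))) :=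
      div_nonneg (by linarith [Real.one_le_exp hm'.le]) hm'.le
    have hfar : Real.exp (-(lam * (ℓ - t (k + 1)))) * Real.exp (lam * (t (k + 2) - t (k + 1)))
        ≤ 16 * (N : ℝ)⁻¹ := by
      -- The product is the boundary layer function at the forward node, the largest of its three
      -- stencil values.
      refine le_trans ?_ (T.outer_far (k + 1) hkN (by omega))
      rw [← Real.exp_add, Real.exp_le_exp]
      have h0 : 0 ≤ ℓ - t (k + 2) := sub_nonneg.2 (T.mem_Icc (j := k + 2) (by omega)).2
      have h1 := mul_le_mul_of_nonneg_right R.θ₂_le h0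
      have h2 := mul_nonneg hl.le h0
      linarith
    have hb := (H.b_upper _ htI).trans hKK
    have hb0 := H.b_pos htI
    have hE1 : 1 ≤ Real.exp (lam * (t (k + 2) - t (k + 1))) := Real.one_le_exp hm'.le
    rw [upwindOp, hF, hSe]
    generalize Real.exp (lam * (t (k + 2) - t (k + 1))) = E at *
    have hg0 := Real.exp_pos (-(lam * (ℓ - t (k + 1))))
    generalize Real.exp (-(lam * (ℓ - t (k + 1)))) = g at *
    generalize (E - 1) / (lam * (t (k + 2) - t (k + 1))) = D at *
    generalize expStencil (lam * (t (k + 1) - t k)) (lam * (t (k + 2) - t (k + 1))) = S at *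
    have t1 : ε * lam ^ 2 * (g * S) ≤ K ^ 3 * (12 * (16 * (N : ℝ)⁻¹)) :=
      mul_le_mul he (by nlinarith) (by positivity) (by positivity)
    have t2 : μ * A (t (k + 1)) * lam * (g * D) ≤ K ^ 3 * (16 * (N : ℝ)⁻¹) :=
      mul_le_mul hmA (by nlinarith) (by positivity) (by positivity)
    have t3 : b (t (k + 1)) * g ≤ K ^ 3 * (16 * (N : ℝ)⁻¹) :=
      mul_le_mul hb (by nlinarith) (by positivity) (by positivity)
    have n1 : 0 ≤ ε * lam ^ 2 * (g * S) := by positivity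
    have n2 : 0 ≤ μ * A (t (k + 1)) * lam * (g * D) := by positivity
    have n3 : 0 ≤ b (t (k + 1)) * g := by positivity
    have n4 : 0 ≤ (2 * K ^ 4 + 384 * K ^ 4 * Real.exp (128 * K)) * (N : ℝ)⁻¹ := by positivity
    rw [abs_le]
    constructor <;> nlinarith

lemma smooth_upwind_residual {k : ℕ} (hkN : k + 1 < N / 2) :
    |upwindOp ε μ A b t (fun i => v (t i)) (k + 1) + b (t (k + 1)) * v (t (k + 1))|
      ≤ 3 * K ^ 3 * (N : ℝ)⁻¹ := by
  have htI := T.mem_Icc (j := k + 1) (by omega)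
  have h0 := (T.mem_Icc (j := k) (by omega)).1
  have h2 := (T.mem_Icc (j := k + 2) (by omega)).2
  have hn := T.lt_succ k (by omega)
  have hm := T.lt_succ (k + 1) (by omega)
  rw [upwindOp, sub_add_cancel]
  exact smooth_residual H R htI (H.abs_secondDiffQuot_le h0 hn hm h2)
    (H.abs_fwdDiffQuot_le htI.1 hm h2)
end

/-! ### The explicit approximation on one side of the interface -/

/-- The reduced solution `v` plus a boundary layer of amplitude `a₁` and an interface layer of
amplitude `a₀`. -/
noncomputable def layerApprox (ℓ κ lam a₀ a₁ : ℝ) (v : ℝ → ℝ) (t : ℝ) : ℝ :=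
  v t + a₁ * Real.exp (-(lam * (ℓ - t))) + a₀ * Real.exp (-(κ * t))

/-- A constant dominating all consistency errors of `layerApprox`. -/
noncomputable def approxConst (K : ℝ) : ℝ :=
  16 * K ^ 3 + 6 * K * (224 * K ^ 3 + 2 * K ^ 4 + 384 * K ^ 4 * Real.exp (128 * K))
    + 6 * K * (2 * K ^ 2 + 384 * K ^ 2 * Real.exp (128 * K) + 224 * K)
    + 384 * K ^ 2 * Real.exp (8 * K)

/-- The family is closed under differentiation: amplitudes are multiplied by `-κ` and `lam`. Second
derivatives follow by applying this twice. -/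
lemma layerApprox_hasDerivWithinAt {ℓ κ lam a₀ a₁ : ℝ} {v v' : ℝ → ℝ} {s : Set ℝ} {t : ℝ}
    (hv : HasDerivWithinAt v (v' t) s t) :
    HasDerivWithinAt (layerApprox ℓ κ lam a₀ a₁ v)
      (layerApprox ℓ κ lam (-(a₀ * κ)) (a₁ * lam) v' t) s t := by
  have h1 : HasDerivAt (fun t => a₁ * Real.exp (-(lam * (ℓ - t))))
      (a₁ * lam * Real.exp (-(lam * (ℓ - t)))) t := by
    have := ((((hasDerivAt_id t).const_sub ℓ).const_mul lam).fun_neg.exp).const_mul a₁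
    exact this.congr_deriv (by simp only [id]; ring)
  have h2 : HasDerivAt (fun t => a₀ * Real.exp (-(κ * t)))
      (-(a₀ * κ) * Real.exp (-(κ * t))) t := by
    have := (((hasDerivAt_id t).const_mul κ).fun_neg.exp).const_mul a₀
    exact this.congr_deriv (by simp only [id]; ring)
  exact (hv.add h1.hasDerivWithinAt).add h2.hasDerivWithinAt

lemma layerApprox_hasDerivAt {ℓ κ lam a₀ a₁ : ℝ} {v v' : ℝ → ℝ} {t : ℝ}
    (hv : HasDerivAt v (v' t) t) :
    HasDerivAt (layerApprox ℓ κ lam a₀ a₁ v)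
      (layerApprox ℓ κ lam (-(a₀ * κ)) (a₁ * lam) v' t) t := by
  rw [← hasDerivWithinAt_univ] at hv ⊢
  exact layerApprox_hasDerivWithinAt hv

lemma mul_abs_le_mul {x y c d : ℝ} (hx : |x| ≤ c) (hy : |y| ≤ d) : |x * y| ≤ c * d := by
  rw [abs_mul]
  exact mul_le_mul hx hy (abs_nonneg _) ((abs_nonneg _).trans hx)

section
variable {K ℓ ε μ δ θ₁ θ₂ κ lam a₀ a₁ : ℝ} {A b v v' v'' : ℝ → ℝ}
  (H : HalfProblem K ℓ A b v v' v'')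
include H

lemma HalfProblem.approxConst_pos : 0 < approxConst K := by
  have := H.one_le
  unfold approxConst
  positivity

variable (R : LayerRates K ℓ ε μ δ θ₁ θ₂ κ lam A b)
include R

lemma layerApprox_residual (h₀ : |a₀| ≤ 6 * K) (h₁ : |a₁| ≤ 6 * K) {t : ℝ} (ht : t ∈ Icc 0 ℓ) :
    |ε * layerApprox ℓ κ lam (-(-(a₀ * κ) * κ)) (a₁ * lam * lam) v'' t
      + μ * A t * layerApprox ℓ κ lam (-(a₀ * κ)) (a₁ * lam) v' t
      - b t * layerApprox ℓ κ lam a₀ a₁ v t + b t * v t| ≤ approxConst K * δ := by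
  have hK := H.one_le
  have hδ := R.δ_pos H
  have e1 := smooth_residual H R ht (x := v'' t) (y := v' t)
    ((H.v''_bound t ht).trans (by linarith)) (H.v'_bound t ht)
  have e2 := mul_abs_le_mul h₁ (boundary_frozen_residual H R ht)
  have e3 := mul_abs_le_mul h₀ (interior_frozen_residual H R ht)
  have hE1 := Real.exp_pos (128 * K)
  have hE2 := Real.exp_pos (8 * K)
  have hC : 3 * K ^ 3 * δ + 6 * K * (2 * K ^ 4 * δ) + 6 * K * (2 * K ^ 2 * δ)
      ≤ approxConst K * δ := by
    rw [approxConst]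
    have : 0 ≤ (13 * K ^ 3 + 6 * K * (224 * K ^ 3 + 384 * K ^ 4 * Real.exp (128 * K))
      + 6 * K * (384 * K ^ 2 * Real.exp (128 * K) + 224 * K)
      + 384 * K ^ 2 * Real.exp (8 * K)) * δ := by positivity
    linarith
  refine le_trans ?_ hC
  refine le_trans (le_of_eq ?_) ((abs_add_three (ε * v'' t + μ * A t * v' t) _ _).trans
    (add_le_add (add_le_add e1 e2) e3))
  congr 1
  simp only [layerApprox]
  ring

/-- The only mismatch is the tail of the interface layer, and `exp(-κ ℓ) ≤ 1 / (κ ℓ) = O(δ)`. -/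
lemma layerApprox_boundary (h₀ : |a₀| ≤ 6 * K) {y : ℝ} (ha : a₁ = y - v ℓ) :
    |y - layerApprox ℓ κ lam a₀ a₁ v ℓ| ≤ approxConst K * δ := by
  have hK := H.one_le
  have hδ := R.δ_pos H
  have hκ := R.κ_pos
  have hℓ := H.len_pos
  have h1 : Real.exp (-(κ * ℓ)) ≤ K ^ 2 * δ := by
    have h2 := mul_exp_neg_le_one (κ * ℓ)
    have h3 : 1 ≤ K * δ * κ * (K * ℓ) :=
      one_le_mul_of_one_le_of_one_le (R.one_le_κ H) H.len
    have h4 := Real.exp_pos (-(κ * ℓ))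
    calc Real.exp (-(κ * ℓ)) ≤ K * δ * κ * (K * ℓ) * Real.exp (-(κ * ℓ)) :=
          le_mul_of_one_le_left h4.le h3
      _ = K ^ 2 * δ * (κ * ℓ * Real.exp (-(κ * ℓ))) := by ring
      _ ≤ K ^ 2 * δ * 1 := by gcongr
      _ = _ := by ring
  have h2 := mul_abs_le_mul h₀ ((abs_of_pos (Real.exp_pos (-(κ * ℓ)))).trans_le h1)
  have hE1 := Real.exp_pos (128 * K)
  have hE2 := Real.exp_pos (8 * K)
  have hC : 6 * K * (K ^ 2 * δ) ≤ approxConst K * δ := by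
    rw [approxConst]
    have : 0 ≤ (10 * K ^ 3 + 6 * K * (224 * K ^ 3 + 2 * K ^ 4 + 384 * K ^ 4 * Real.exp (128 * K))
      + 6 * K * (2 * K ^ 2 + 384 * K ^ 2 * Real.exp (128 * K) + 224 * K)
      + 384 * K ^ 2 * Real.exp (8 * K)) * δ := by positivity
    linarith
  refine le_trans (le_of_eq ?_) (h2.trans hC)
  rw [← abs_neg]
  congr 1
  simp only [layerApprox, ha, sub_self, mul_zero, neg_zero, Real.exp_zero]
  ring

/-- A slope of order one is harmless at the interface, because `1 ≤ K δ κ`. The bound `13 K²` covers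
`v'` (at most `K`) and the boundary layer (at most `6 K · 2 K`). -/
lemma approx_jump_const {x y : ℝ} (hx : |x| ≤ 13 * K ^ 2) (hy : |y| ≤ 384 * K ^ 2 * Real.exp (8 * K)
    * δ * κ) : |x + y| ≤ approxConst K * δ * κ := by
  have hK := H.one_le
  have hδ := R.δ_pos H
  have hκ := R.κ_pos
  have h1 : 13 * K ^ 2 ≤ 13 * K ^ 2 * (K * δ * κ) :=
    le_mul_of_one_le_right (by positivity) (R.one_le_κ H)
  have hE1 := Real.exp_pos (128 * K)
  have : 0 ≤ (3 * K ^ 3 + 6 * K * (224 * K ^ 3 + 2 * K ^ 4 + 384 * K ^ 4 * Real.exp (128 * K))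
      + 6 * K * (2 * K ^ 2 + 384 * K ^ 2 * Real.exp (128 * K) + 224 * K)) * (δ * κ) := by positivity
  refine (abs_add_le _ _).trans ?_
  rw [approxConst]
  linarith

/-- At distance at least `ℓ / 2` from the boundary, `x exp(-x) ≤ 1` bounds the slope by `2 / ℓ`. It
is applied at the interface and at the first mesh node. -/
lemma boundary_layer_slope_le {s : ℝ} (hs : s ≤ ℓ / 2) :
    lam * Real.exp (-(lam * (ℓ - s))) ≤ 2 * K := by
  have hK := H.one_le
  have hl := R.lam_pos
  have hℓ := H.len
  have hℓ0 := H.len_pos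
  have h1 := mul_exp_neg_le_one (lam * (ℓ - s))
  have h2 := Real.exp_pos (-(lam * (ℓ - s)))
  have h3 : 1 ≤ 2 * K * (ℓ - s) := by nlinarith
  calc lam * Real.exp (-(lam * (ℓ - s)))
      ≤ 2 * K * (ℓ - s) * (lam * Real.exp (-(lam * (ℓ - s)))) :=
        le_mul_of_one_le_left (by positivity) h3
    _ = 2 * K * (lam * (ℓ - s) * Real.exp (-(lam * (ℓ - s)))) := by ring
    _ ≤ 2 * K * 1 := by gcongr
    _ = _ := by ring

lemma layerApprox_slope_zero (h₁ : |a₁| ≤ 6 * K) :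
    |layerApprox ℓ κ lam (-(a₀ * κ)) (a₁ * lam) v' 0 + a₀ * κ| ≤ approxConst K * δ * κ := by
  have hK := H.one_le
  have hδ := R.δ_pos H
  have hκ := R.κ_pos
  have hl := R.lam_pos
  have h1 := boundary_layer_slope_le H R (s := 0) (by linarith [H.len_pos])
  have h2 := mul_abs_le_mul h₁ ((abs_of_pos (by positivity)).trans_le h1)
  have h3 := approx_jump_const H R (x := v' 0 + a₁ * (lam * Real.exp (-(lam * (ℓ - 0))))) (y := 0)
    ((abs_add_le _ _).trans (by nlinarith [H.v'_bound 0 H.zero_mem]))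
    (by rw [abs_zero]; positivity)
  refine le_trans (le_of_eq ?_) h3
  congr 1
  simp only [layerApprox, mul_zero, neg_zero, Real.exp_zero]
  ring
end

section
variable {K ℓ ε μ θ₁ θ₂ κ lam a₀ a₁ : ℝ} {A b v v' v'' : ℝ → ℝ} {N : ℕ} {t : ℕ → ℝ}
  (H : HalfProblem K ℓ A b v v' v'') (R : LayerRates K ℓ ε μ (N : ℝ)⁻¹ θ₁ θ₂ κ lam A b)
  (T : LayerAdapted N ℓ θ₁ θ₂ t)
include H R T

lemma layerApprox_upwind_residual (h8 : 8 ∣ N) (h₀ : |a₀| ≤ 6 * K) (h₁ : |a₁| ≤ 6 * K) {k : ℕ}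
    (hkN : k + 1 < N / 2) :
    |upwindOp ε μ A b t (fun i => layerApprox ℓ κ lam a₀ a₁ v (t i)) (k + 1)
        + b (t (k + 1)) * v (t (k + 1))|
      ≤ approxConst K * (N : ℝ)⁻¹ * (1 + μ * κ * meshExp (κ / (4 * K ^ 2)) t (k + 2)) := by
  have hK := H.one_le
  have hδ := R.δ_pos H
  have hμκ := mul_pos R.μ_pos R.κ_pos
  have hW0 := meshExp_pos (R.barrier_pos H) T.lt_succ (j := k + 2) (by omega)
  have hE1 := Real.exp_pos (128 * K)
  have hE2 := Real.exp_pos (8 * K)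
  have e1 := smooth_upwind_residual H R T hkN
  have e2 := mul_abs_le_mul h₁ (boundary_residual H R T h8 hkN)
  have e3' : |upwindOp ε μ A b t (fun i => Real.exp (-(κ * t i))) (k + 1)|
      ≤ (2 * K ^ 2 + 384 * K ^ 2 * Real.exp (128 * K) + 224 * K) * (N : ℝ)⁻¹
        * (1 + μ * κ * meshExp (κ / (4 * K ^ 2)) t (k + 2)) := by
    by_cases hk : 8 * (k + 2) ≤ N
    · refine (interior_residual_near H R T hk).trans ?_
      exact mul_le_mul_of_nonneg_right (mul_le_mul_of_nonneg_right (by linarith) hδ.le)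
        (by positivity)
    · refine (interior_residual_far H R T h8 (by omega) hkN).trans ?_
      gcongr
      have : 0 ≤ 2 * K ^ 2 + 384 * K ^ 2 * Real.exp (128 * K) := by positivity
      linarith
  have e3 := mul_abs_le_mul h₀ e3'
  have hlin : upwindOp ε μ A b t (fun i => layerApprox ℓ κ lam a₀ a₁ v (t i)) (k + 1)
        + b (t (k + 1)) * v (t (k + 1))
      = (upwindOp ε μ A b t (fun i => v (t i)) (k + 1) + b (t (k + 1)) * v (t (k + 1)))
        + a₁ * upwindOp ε μ A b t (fun i => Real.exp (-(lam * (ℓ - t i)))) (k + 1)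
        + a₀ * upwindOp ε μ A b t (fun i => Real.exp (-(κ * t i))) (k + 1) := by
    simp only [layerApprox, upwindOp, secondDiffQuot, fwdDiffQuot, bwdDiffQuot]
    ring
  rw [hlin]
  refine (abs_add_three _ _ _).trans ((add_le_add (add_le_add e1 e2) e3).trans ?_)
  generalize meshExp (κ / (4 * K ^ 2)) t (k + 2) = W at *
  rw [approxConst]
  have g1 : 0 ≤ (16 * K ^ 3 + 6 * K * (224 * K ^ 3 + 2 * K ^ 4 + 384 * K ^ 4 * Real.exp (128 * K))
    + 384 * K ^ 2 * Real.exp (8 * K)) * (N : ℝ)⁻¹ * (μ * κ * W) := by positivity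
  have g2 : 0 ≤ (13 * K ^ 3 + 384 * K ^ 2 * Real.exp (8 * K)) * (N : ℝ)⁻¹ := by positivity
  linarith

lemma layerApprox_fwdDiffQuot_zero (hN : 8 ≤ N) (h₀ : |a₀| ≤ 6 * K) (h₁ : |a₁| ≤ 6 * K) :
    |fwdDiffQuot t (fun i => layerApprox ℓ κ lam a₀ a₁ v (t i)) 0 + a₀ * κ|
      ≤ approxConst K * (N : ℝ)⁻¹ * κ := by
  have hK := H.one_le
  have hδ := R.δ_pos H
  have hκ := R.κ_pos
  have hl := R.lam_pos
  have hm := T.lt_succ 0 (by omega)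
  have hp : 0 < κ * (t 1 - t 0) := mul_pos hκ (sub_pos.2 hm)
  have hp' : 0 < lam * (t 1 - t 0) := mul_pos hl (sub_pos.2 hm)
  have e1 := H.abs_fwdDiffQuot_le (t := t) (k := 0) T.zero.ge hm (T.mem_Icc (by omega)).2
  have e2' : |fwdDiffQuot t (fun i => Real.exp (-(lam * (ℓ - t i)))) 0| ≤ 2 * K := by
    rw [fwdDiffQuot_exp hl hm, zero_add]
    have h0 : 0 ≤ (Real.exp (lam * (t 1 - t 0)) - 1) / (lam * (t 1 - t 0)) :=
      div_nonneg (by linarith [Real.one_le_exp hp'.le]) hp'.le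
    have h1 : (Real.exp (lam * (t 1 - t 0)) - 1) / (lam * (t 1 - t 0))
        ≤ Real.exp (lam * (t 1 - t 0)) := by
      rw [div_le_iff₀ hp']; linarith [exp_sub_one_le_mul_exp (lam * (t 1 - t 0))]
    rw [abs_of_nonneg (by positivity)]
    refine (mul_le_mul_of_nonneg_left h1 (by positivity)).trans ?_
    rw [mul_assoc, ← Real.exp_add, show -(lam * (ℓ - t 0)) + lam * (t 1 - t 0)
      = -(lam * (ℓ - t 1)) by ring]
    exact boundary_layer_slope_le H R T.first_le
  have e2 := mul_abs_le_mul h₁ e2'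
  -- The relative error of the first quotient is at most `κ t 1`, which is `O(δ)` by the grading;
  -- the factor `exp(8 K)` comes from `κ t 1 ≤ 64 K` in `exp(κ t 1 / 8)`.
  have e3' : |κ * ((1 - Real.exp (-(κ * (t 1 - t 0)))) / (κ * (t 1 - t 0)) - 1)|
      ≤ κ * (64 * K * (N : ℝ)⁻¹ * Real.exp (8 * K)) := by
    rw [abs_mul, abs_of_pos hκ]
    apply mul_le_mul_of_nonneg_left _ hκ.le
    refine (abs_one_sub_exp_neg_div_sub_one_le hp).trans ?_
    refine (interior_step_le_exp H R T (k := 0) (j := 1) (by omega) le_rfl (by omega)).trans ?_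
    gcongr
    have := interior_step_le H R T (k := 0) (by omega)
    rw [T.zero, sub_zero, zero_add] at this
    linarith
  have e3 := mul_abs_le_mul h₀ e3'
  have h3 := approx_jump_const H R
    (x := fwdDiffQuot t (fun i => v (t i)) 0
      + a₁ * fwdDiffQuot t (fun i => Real.exp (-(lam * (ℓ - t i)))) 0)
    (y := -(a₀ * (κ * ((1 - Real.exp (-(κ * (t 1 - t 0)))) / (κ * (t 1 - t 0)) - 1))))
    ((abs_add_le _ _).trans (by nlinarith)) (by rw [abs_neg]; linarith)
  refine le_trans (le_of_eq ?_) h3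
  congr 1
  have hlin : fwdDiffQuot t (fun i => layerApprox ℓ κ lam a₀ a₁ v (t i)) 0
      = fwdDiffQuot t (fun i => v (t i)) 0
        + a₁ * fwdDiffQuot t (fun i => Real.exp (-(lam * (ℓ - t i)))) 0
        + a₀ * fwdDiffQuot t (fun i => Real.exp (-(κ * t i))) 0 := by
    simp only [layerApprox, fwdDiffQuot]
    ring
  rw [hlin, fwdDiffQuot_exp_neg hκ hm, zero_add, T.zero]
  simp only [mul_zero, neg_zero, Real.exp_zero]
  ring
end

/-! ### Stability across the interface -/

section
variable {K ℓ ε μ θ₁ θ₂ κ lam : ℝ} {A b v v' v'' : ℝ → ℝ} {N : ℕ} {t : ℕ → ℝ}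

/-- The discrete exponential absorbs the `μ κ W` part of the residual and the constant `K C δ` the
rest, through `b ≥ K⁻¹`. The minimum principle then leaves only the interface value open. -/
lemma upwind_barrier_min (H : HalfProblem K ℓ A b v v' v'')
    (R : LayerRates K ℓ ε μ (N : ℝ)⁻¹ θ₁ θ₂ κ lam A b) (T : LayerAdapted N ℓ θ₁ θ₂ t)
    {C : ℝ} (hC : 0 < C) {E : ℕ → ℝ}
    (hE : ∀ k, k + 1 < N / 2 → |upwindOp ε μ A b t E (k + 1)|
      ≤ C * (N : ℝ)⁻¹ * (1 + μ * κ * meshExp (κ / (4 * K ^ 2)) t (k + 2)))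
    (hend : |E (N / 2)| ≤ C * (N : ℝ)⁻¹) :
    ∀ j ≤ N / 2, min (300 * K ^ 3 * C * (N : ℝ)⁻¹ + (K * C * (N : ℝ)⁻¹ + E 0)) 0
      ≤ 300 * K ^ 3 * C * (N : ℝ)⁻¹ * meshExp (κ / (4 * K ^ 2)) t j
        + (K * C * (N : ℝ)⁻¹ + E j) := by
  have hK := H.one_le
  have hδ := R.δ_pos H
  have hμ := R.μ_pos
  have hκ := R.κ_pos
  have hc := R.barrier_pos H
  have hK0 : 0 < K⁻¹ := by positivity
  have := min_zero_le_of_upwindOp_nonpos (M := N / 2) (ε := ε) (μ := μ) (A := A) (b := b) (t := t)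
    (G := fun j => 300 * K ^ 3 * C * (N : ℝ)⁻¹ * meshExp (κ / (4 * K ^ 2)) t j
        + (K * C * (N : ℝ)⁻¹ + E j)) R.ε_pos hμ T.lt_succ
    (fun j hj => H.A_pos (T.mem_Icc hj)) (fun j hj => H.b_pos (T.mem_Icc hj)) ?_ ?_
  · simpa only [meshExp_zero, mul_one] using this
  · intro j hj1 hj
    obtain ⟨k, rfl⟩ : ∃ k, j = k + 1 := ⟨j - 1, by omega⟩
    have htI := T.mem_Icc hj.le
    have hbar := upwindOp_meshExp_le (A := A) (b := b) R.ε_pos hμ hc T.lt_succ hK0 hj1 hj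
      (H.A_lower _ htI) (H.b_lower _ htI) (R.barrier_rate H)
    have hEk := (abs_le.1 (hE k hj)).2
    have hW0 := meshExp_pos hc T.lt_succ (j := k + 2) (by omega)
    have hb := H.b_lower _ htI
    have hlin : upwindOp ε μ A b t (fun j => 300 * K ^ 3 * C * (N : ℝ)⁻¹
          * meshExp (κ / (4 * K ^ 2)) t j + (K * C * (N : ℝ)⁻¹ + E j)) (k + 1)
        = 300 * K ^ 3 * C * (N : ℝ)⁻¹ * upwindOp ε μ A b t (meshExp (κ / (4 * K ^ 2)) t) (k + 1)
          - b (t (k + 1)) * (K * C * (N : ℝ)⁻¹) + upwindOp ε μ A b t E (k + 1) := by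
      simp only [upwindOp, secondDiffQuot, fwdDiffQuot, bwdDiffQuot]
      ring
    rw [hlin]
    have h1 := mul_le_mul_of_nonneg_left hbar (by positivity : 0 ≤ 300 * K ^ 3 * C * (N : ℝ)⁻¹)
    have h2 := mul_le_mul_of_nonneg_right hb (by positivity : 0 ≤ K * C * (N : ℝ)⁻¹)
    have h3 : K⁻¹ * (K * C * (N : ℝ)⁻¹) = C * (N : ℝ)⁻¹ := by field_simp
    rw [show k + 1 + 1 = k + 2 from rfl] at h1
    generalize meshExp (κ / (4 * K ^ 2)) t (k + 2) = W at *
    have h4 : 300 * K ^ 3 * C * (N : ℝ)⁻¹ * -(μ * K⁻¹ * (κ / (4 * K ^ 2)) / 2 * W)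
        = -(75 / 2 * (C * (N : ℝ)⁻¹ * (μ * κ * W))) := by
      field_simp
      norm_num
    have h5 : 0 ≤ C * (N : ℝ)⁻¹ * (μ * κ * W) := by positivity
    linarith
  · have h1 := (abs_le.1 hend).1
    have h2 : C * (N : ℝ)⁻¹ ≤ K * C * (N : ℝ)⁻¹ := by
      rw [mul_assoc]; exact le_mul_of_one_le_left (by positivity) hK
    have hW0 := meshExp_pos hc T.lt_succ (j := N / 2) le_rfl
    have : 0 ≤ 300 * K ^ 3 * C * (N : ℝ)⁻¹ * meshExp (κ / (4 * K ^ 2)) t (N / 2) := by positivity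
    show 0 ≤ 300 * K ^ 3 * C * (N : ℝ)⁻¹ * meshExp (κ / (4 * K ^ 2)) t (N / 2)
        + (K * C * (N : ℝ)⁻¹ + E (N / 2))
    linarith

/-- The first step satisfies `κ t 1 ≤ 64 K`, so the discrete exponential at node `1` is at least `1
/ (65 K)`. The coefficient `300` exceeds `4 · 65`, which makes the slope strictly steeper than `-C δ
κ`. -/
lemma upwind_barrier_slope (H : HalfProblem K ℓ A b v v' v'')
    (R : LayerRates K ℓ ε μ (N : ℝ)⁻¹ θ₁ θ₂ κ lam A b) (T : LayerAdapted N ℓ θ₁ θ₂ t)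
    (hN : 8 ≤ N) {C : ℝ} (hC : 0 < C) :
    300 * K ^ 3 * C * (N : ℝ)⁻¹ * fwdDiffQuot t (meshExp (κ / (4 * K ^ 2)) t) 0
      < -(C * (N : ℝ)⁻¹ * κ) := by
  have hK := H.one_le
  have hδ := R.δ_pos H
  have hκ := R.κ_pos
  have hc := R.barrier_pos H
  have hstep := interior_step_le H R T (k := 0) (by omega)
  have hm := sub_pos.2 (T.lt_succ 0 (by omega))
  rw [zero_add] at hstep hm
  rw [fwdDiffQuot_meshExp hc T.lt_succ (by omega : 0 < N / 2), meshExp_succ, meshExp_zero, one_mul,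
    zero_add]
  have h1 : κ / (4 * K ^ 2) * (t 1 - t 0) ≤ 64 * K := by
    refine le_trans ?_ hstep
    gcongr
    linarith [R.barrier_le H]
  have h2 : (65 * K)⁻¹ ≤ (1 + κ / (4 * K ^ 2) * (t 1 - t 0))⁻¹ := by
    apply inv_anti₀ (by positivity) (by linarith)
  have h3 : 300 * K ^ 3 * C * (N : ℝ)⁻¹ * (κ / (4 * K ^ 2) * (65 * K)⁻¹)
      = 15 / 13 * (C * (N : ℝ)⁻¹ * κ) := by
    field_simp
    norm_num
  have h4 : 300 * K ^ 3 * C * (N : ℝ)⁻¹ * (κ / (4 * K ^ 2) * (65 * K)⁻¹)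
      ≤ 300 * K ^ 3 * C * (N : ℝ)⁻¹
        * (κ / (4 * K ^ 2) * (1 + κ / (4 * K ^ 2) * (t 1 - t 0))⁻¹) := by gcongr
  have h5 : 0 < C * (N : ℝ)⁻¹ * κ := by positivity
  linarith
end

lemma fwdDiffQuot_nonneg_of_min {t G : ℕ → ℝ} (ht : t 0 < t 1) (h0 : G 0 < 0)
    (h : min (G 0) 0 ≤ G 1) : 0 ≤ fwdDiffQuot t G 0 := by
  rw [min_eq_left h0.le] at h
  exact div_nonneg (sub_nonneg.2 h) (sub_nonneg.2 ht.le)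

section
variable {K ε μ θ₁ θ₂ : ℝ} {N : ℕ}
  {ℓ κ lam : ℝ} {A b v v' v'' : ℝ → ℝ} {t : ℕ → ℝ}
  {ℓ₂ κ₂ lam₂ : ℝ} {A₂ b₂ v₂ v₂' v₂'' : ℝ → ℝ} {t₂ : ℕ → ℝ}

lemma upwind_lower_bound (H : HalfProblem K ℓ A b v v' v'')
    (R : LayerRates K ℓ ε μ (N : ℝ)⁻¹ θ₁ θ₂ κ lam A b) (T : LayerAdapted N ℓ θ₁ θ₂ t)
    (H₂ : HalfProblem K ℓ₂ A₂ b₂ v₂ v₂' v₂'')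
    (R₂ : LayerRates K ℓ₂ ε μ (N : ℝ)⁻¹ θ₁ θ₂ κ₂ lam₂ A₂ b₂) (T₂ : LayerAdapted N ℓ₂ θ₁ θ₂ t₂)
    (hN : 8 ≤ N) {C : ℝ} (hC : 0 < C) {E E₂ : ℕ → ℝ} (h0 : E 0 = E₂ 0)
    (hE : ∀ k, k + 1 < N / 2 → |upwindOp ε μ A b t E (k + 1)|
      ≤ C * (N : ℝ)⁻¹ * (1 + μ * κ * meshExp (κ / (4 * K ^ 2)) t (k + 2)))
    (hend : |E (N / 2)| ≤ C * (N : ℝ)⁻¹)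
    (hE₂ : ∀ k, k + 1 < N / 2 → |upwindOp ε μ A₂ b₂ t₂ E₂ (k + 1)|
      ≤ C * (N : ℝ)⁻¹ * (1 + μ * κ₂ * meshExp (κ₂ / (4 * K ^ 2)) t₂ (k + 2)))
    (hend₂ : |E₂ (N / 2)| ≤ C * (N : ℝ)⁻¹)
    (hjump : |fwdDiffQuot t E 0 + fwdDiffQuot t₂ E₂ 0| ≤ C * (N : ℝ)⁻¹ * κ + C * (N : ℝ)⁻¹ * κ₂) :
    (∀ j ≤ N / 2, -(301 * K ^ 3 * C * (N : ℝ)⁻¹) ≤ E j) ∧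
    (∀ j ≤ N / 2, -(301 * K ^ 3 * C * (N : ℝ)⁻¹) ≤ E₂ j) := by
  have hK := H.one_le
  have hδ := R.δ_pos H
  have m1 := upwind_barrier_min H R T hC hE hend
  have m2 := upwind_barrier_min H₂ R₂ T₂ hC hE₂ hend₂
  have s1 := upwind_barrier_slope H R T hN hC
  have s2 := upwind_barrier_slope H₂ R₂ T₂ hN hC
  have hlin : ∀ (x : ℕ → ℝ) (r : ℝ) (F : ℕ → ℝ),
      fwdDiffQuot x (fun j => 300 * K ^ 3 * C * (N : ℝ)⁻¹ * meshExp r x j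
        + (K * C * (N : ℝ)⁻¹ + F j)) 0
      = 300 * K ^ 3 * C * (N : ℝ)⁻¹ * fwdDiffQuot x (meshExp r x) 0 + fwdDiffQuot x F 0 := by
    intro x r F
    simp only [fwdDiffQuot]
    ring
  -- A negative common interface value would be the minimum on both sides, so both first quotients
  -- would be nonnegative; their sum is negative by the barrier slopes and the jump bound.
  have hG0 : 0 ≤ 300 * K ^ 3 * C * (N : ℝ)⁻¹ + (K * C * (N : ℝ)⁻¹ + E 0) := by
    by_contra! hneg
    have f1 := fwdDiffQuot_nonneg_of_min (t := t) (G := fun j => 300 * K ^ 3 * C * (N : ℝ)⁻¹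
      * meshExp (κ / (4 * K ^ 2)) t j + (K * C * (N : ℝ)⁻¹ + E j)) (T.lt_succ 0 (by omega))
      (by simpa only [meshExp_zero, mul_one] using hneg)
      (by simpa only [meshExp_zero, mul_one] using m1 1 (by omega))
    have f2 := fwdDiffQuot_nonneg_of_min (t := t₂) (G := fun j => 300 * K ^ 3 * C * (N : ℝ)⁻¹
      * meshExp (κ₂ / (4 * K ^ 2)) t₂ j + (K * C * (N : ℝ)⁻¹ + E₂ j)) (T₂.lt_succ 0 (by omega))
      (by simpa only [meshExp_zero, mul_one, h0] using hneg)
      (by simpa only [meshExp_zero, mul_one] using m2 1 (by omega))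
    rw [hlin] at f1 f2
    have := (abs_le.1 hjump).2
    linarith
  have hKC : K * C * (N : ℝ)⁻¹ ≤ K ^ 3 * C * (N : ℝ)⁻¹ := by
    gcongr
    exact le_self_pow₀ hK (by norm_num)
  have hpos : 0 ≤ 300 * K ^ 3 * C * (N : ℝ)⁻¹ := by positivity
  constructor
  · intro j hj
    have h1 := m1 j hj
    rw [min_eq_right hG0] at h1
    have h2 := mul_le_of_le_one_right hpos (meshExp_le_one (R.barrier_pos H) T.lt_succ hj)
    linarith
  · intro j hj
    have h1 := m2 j hj
    rw [← h0, min_eq_right hG0] at h1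
    have h2 := mul_le_of_le_one_right hpos (meshExp_le_one (R₂.barrier_pos H₂) T₂.lt_succ hj)
    linarith

lemma upwind_stability (H : HalfProblem K ℓ A b v v' v'')
    (R : LayerRates K ℓ ε μ (N : ℝ)⁻¹ θ₁ θ₂ κ lam A b) (T : LayerAdapted N ℓ θ₁ θ₂ t)
    (H₂ : HalfProblem K ℓ₂ A₂ b₂ v₂ v₂' v₂'')
    (R₂ : LayerRates K ℓ₂ ε μ (N : ℝ)⁻¹ θ₁ θ₂ κ₂ lam₂ A₂ b₂) (T₂ : LayerAdapted N ℓ₂ θ₁ θ₂ t₂)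
    (hN : 8 ≤ N) {C : ℝ} (hC : 0 < C) {E E₂ : ℕ → ℝ} (h0 : E 0 = E₂ 0)
    (hE : ∀ k, k + 1 < N / 2 → |upwindOp ε μ A b t E (k + 1)|
      ≤ C * (N : ℝ)⁻¹ * (1 + μ * κ * meshExp (κ / (4 * K ^ 2)) t (k + 2)))
    (hend : |E (N / 2)| ≤ C * (N : ℝ)⁻¹)
    (hE₂ : ∀ k, k + 1 < N / 2 → |upwindOp ε μ A₂ b₂ t₂ E₂ (k + 1)|
      ≤ C * (N : ℝ)⁻¹ * (1 + μ * κ₂ * meshExp (κ₂ / (4 * K ^ 2)) t₂ (k + 2)))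
    (hend₂ : |E₂ (N / 2)| ≤ C * (N : ℝ)⁻¹)
    (hjump : |fwdDiffQuot t E 0 + fwdDiffQuot t₂ E₂ 0| ≤ C * (N : ℝ)⁻¹ * κ + C * (N : ℝ)⁻¹ * κ₂) :
    (∀ j ≤ N / 2, |E j| ≤ 301 * K ^ 3 * C * (N : ℝ)⁻¹) ∧
    (∀ j ≤ N / 2, |E₂ j| ≤ 301 * K ^ 3 * C * (N : ℝ)⁻¹) := by
  have hop : ∀ (A b : ℝ → ℝ) (t E : ℕ → ℝ) (j : ℕ),
      upwindOp ε μ A b t (fun i => -E i) j = -upwindOp ε μ A b t E j := by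
    intro A b t E j
    simp only [upwindOp, secondDiffQuot, fwdDiffQuot, bwdDiffQuot]
    ring
  have hfw : ∀ (t E : ℕ → ℝ), fwdDiffQuot t (fun i => -E i) 0 = -fwdDiffQuot t E 0 := by
    intro t E
    simp only [fwdDiffQuot]
    ring
  have l1 := upwind_lower_bound H R T H₂ R₂ T₂ hN hC h0 hE hend hE₂ hend₂ hjump
  have l2 := upwind_lower_bound H R T H₂ R₂ T₂ hN hC (E := fun i => -E i) (E₂ := fun i => -E₂ i)
    (by simp [h0]) (by simpa only [hop, abs_neg] using hE) (by simpa only [abs_neg] using hend)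
    (by simpa only [hop, abs_neg] using hE₂) (by simpa only [abs_neg] using hend₂)
    (by rw [hfw, hfw, ← neg_add, abs_neg]; exact hjump)
  exact ⟨fun j hj => abs_le.2 ⟨l1.1 j hj, by linarith [l2.1 j hj]⟩,
    fun j hj => abs_le.2 ⟨l1.2 j hj, by linarith [l2.2 j hj]⟩⟩
end

/-! ### Stability of the differential problem across the interface -/

lemma HasDerivWithinAt.nonneg_of_min_left {G : ℝ → ℝ} {g ℓ : ℝ} (hℓ : 0 < ℓ)
    (hG : HasDerivWithinAt G g (Icc 0 ℓ) 0) (hmin : ∀ t ∈ Icc 0 ℓ, G 0 ≤ G t) : 0 ≤ g := by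
  have h1 : HasDerivWithinAt G g (Ioo 0 ℓ) 0 := hG.mono Ioo_subset_Icc_self
  rw [hasDerivWithinAt_iff_tendsto_slope' (by simp)] at h1
  have hne : (nhdsWithin (0 : ℝ) (Ioo 0 ℓ)).NeBot := by
    rw [nhdsWithin_Ioo_eq_nhdsGT hℓ]; infer_instance
  refine ge_of_tendsto h1 ?_
  filter_upwards [self_mem_nhdsWithin] with t ht
  rw [slope_def_field]
  exact div_nonneg (sub_nonneg.2 (hmin t (Ioo_subset_Icc_self ht))) (by linarith [ht.1])

section
variable {A b v v' v'' : ℝ → ℝ} {K ℓ ε μ δ θ₁ θ₂ κ lam : ℝ}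

/-- On one side of the interface, `E` is regular and both its image under the differential operator
and its boundary value are bounded by `c`. -/
structure SmallResidual (ε μ ℓ c : ℝ) (A b E E' E'' : ℝ → ℝ) : Prop where
  continuousOn : ContinuousOn E (Icc 0 ℓ)
  deriv : ∀ t ∈ Ioo 0 ℓ, HasDerivAt E (E' t) t
  deriv' : ∀ t ∈ Ioo 0 ℓ, HasDerivAt E' (E'' t) t
  deriv_zero : HasDerivWithinAt E (E' 0) (Icc 0 ℓ) 0
  residual : ∀ t ∈ Ioo 0 ℓ, |ε * E'' t + μ * A t * E' t - b t * E t| ≤ c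
  last : |E ℓ| ≤ c

lemma SmallResidual.neg {c : ℝ} {E E' E'' : ℝ → ℝ} (h : SmallResidual ε μ ℓ c A b E E' E'') :
    SmallResidual ε μ ℓ c A b (fun t => -E t) (fun t => -E' t) (fun t => -E'' t) where
  continuousOn := h.continuousOn.fun_neg
  deriv t ht := (h.deriv t ht).fun_neg
  deriv' t ht := (h.deriv' t ht).fun_neg
  deriv_zero := h.deriv_zero.fun_neg
  residual t ht := by
    rw [← abs_neg]
    convert h.residual t ht using 2
    ring
  last := by rw [abs_neg]; exact h.last

lemma exp_barrier_hasDerivAt (r t : ℝ) :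
    HasDerivAt (fun s => Real.exp (-(r * s))) (-(r * Real.exp (-(r * t)))) t :=
  (((hasDerivAt_id t).const_mul r).fun_neg.exp).congr_deriv (by simp only [id]; ring)

lemma diff_barrier_min (H : HalfProblem K ℓ A b v v' v'')
    (R : LayerRates K ℓ ε μ δ θ₁ θ₂ κ lam A b) {C : ℝ} (hC : 0 < C) {E E' E'' : ℝ → ℝ}
    (hE : SmallResidual ε μ ℓ (C * δ) A b E E' E'') :
    ∀ t ∈ Icc 0 ℓ, min (300 * K ^ 3 * C * δ + (K * C * δ + E 0)) 0
      ≤ 300 * K ^ 3 * C * δ * Real.exp (-(κ / (4 * K ^ 2) * t)) + (K * C * δ + E t) := by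
  have hK := H.one_le
  have hδ := R.δ_pos H
  have hμ := R.μ_pos
  have hc := R.barrier_pos H
  have hrate := R.barrier_rate H
  have hP : 0 ≤ 300 * K ^ 3 * C * δ := by positivity
  set r := κ / (4 * K ^ 2)
  have := min_zero_le_of_diffOp_nonpos (ε := ε) (μ := μ) (A := A) (b := b)
    (e := fun t => 300 * K ^ 3 * C * δ * Real.exp (-(r * t)) + (K * C * δ + E t))
    (e' := fun t => 300 * K ^ 3 * C * δ * (-(r * Real.exp (-(r * t)))) + E' t)
    (e'' := fun t => 300 * K ^ 3 * C * δ * (-(r * (-(r * Real.exp (-(r * t)))))) + E'' t)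
    H.len_pos R.ε_pos (fun t ht => H.b_pos ht) ?_ ?_ ?_ ?_ ?_
  · simpa using this
  · exact (Continuous.continuousOn (by fun_prop)).add (continuousOn_const.add hE.continuousOn)
  · exact fun t ht => ((exp_barrier_hasDerivAt r t).const_mul _).add ((hE.deriv t ht).const_add _)
  · exact fun t ht => ((((exp_barrier_hasDerivAt r t).const_mul r).fun_neg).const_mul _).add
      (hE.deriv' t ht)
  · intro t ht
    have htI := Ioo_subset_Icc_self ht
    have hA := H.A_lower t htI
    have hb := H.b_lower t htI
    have hres := (abs_le.1 (hE.residual t ht)).2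
    have hX := Real.exp_pos (-(r * t))
    have h1 : ε * r ^ 2 ≤ μ * A t * r + b t := by
      have h2 : μ * K⁻¹ * r ≤ μ * A t * r := by gcongr
      have h3 : 0 ≤ μ * K⁻¹ * r := by positivity
      have h4 : 0 ≤ ε * r ^ 2 := mul_nonneg R.ε_pos.le (sq_nonneg _)
      linarith
    have h2 := mul_le_mul_of_nonneg_right h1
      (by positivity : 0 ≤ 300 * K ^ 3 * C * δ * Real.exp (-(r * t)))
    have h3 := mul_le_mul_of_nonneg_right hb (by positivity : 0 ≤ K * C * δ)
    have h4 : K⁻¹ * (K * C * δ) = C * δ := by field_simp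
    show ε * (300 * K ^ 3 * C * δ * (-(r * (-(r * Real.exp (-(r * t)))))) + E'' t)
      + μ * A t * (300 * K ^ 3 * C * δ * (-(r * Real.exp (-(r * t)))) + E' t)
      - b t * (300 * K ^ 3 * C * δ * Real.exp (-(r * t)) + (K * C * δ + E t)) ≤ 0
    linarith
  · have h1 := (abs_le.1 hE.last).1
    have h2 : C * δ ≤ K * C * δ := by
      rw [mul_assoc]; exact le_mul_of_one_le_left (by positivity) hK
    have h3 := mul_nonneg hP (Real.exp_pos (-(r * ℓ))).le
    show 0 ≤ 300 * K ^ 3 * C * δ * Real.exp (-(r * ℓ)) + (K * C * δ + E ℓ)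
    linarith

/-- A negative interface value would be a minimum of barrier plus error, so the error's slope must
compensate the barrier's slope `-75 K C δ κ`. -/
lemma diff_barrier_slope (H : HalfProblem K ℓ A b v v' v'')
    (R : LayerRates K ℓ ε μ δ θ₁ θ₂ κ lam A b) {C : ℝ} (hC : 0 < C) {E E' E'' : ℝ → ℝ}
    (hE : SmallResidual ε μ ℓ (C * δ) A b E E' E'')
    (hneg : 300 * K ^ 3 * C * δ + (K * C * δ + E 0) < 0) : C * δ * κ < E' 0 := by
  have hK := H.one_le
  have hδ := R.δ_pos H
  have hκ := R.κ_pos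
  have hmin := diff_barrier_min H R hC hE
  rw [min_eq_left hneg.le] at hmin
  have hd : HasDerivWithinAt (fun t => 300 * K ^ 3 * C * δ * Real.exp (-(κ / (4 * K ^ 2) * t))
      + (K * C * δ + E t)) _ (Icc 0 ℓ) 0 :=
    ((exp_barrier_hasDerivAt (κ / (4 * K ^ 2)) 0).const_mul (300 * K ^ 3 * C * δ)).hasDerivWithinAt.add
      (hE.deriv_zero.const_add _)
  have := hd.nonneg_of_min_left H.len_pos (fun t ht => by simpa using hmin t ht)
  rw [mul_zero, neg_zero, Real.exp_zero] at this
  have h3 : 300 * K ^ 3 * C * δ * -(κ / (4 * K ^ 2) * 1) = -(75 * K * (C * δ * κ)) := by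
    field_simp
    norm_num
  have h5 : 0 < C * δ * κ := by positivity
  nlinarith

variable {ℓ₂ κ₂ lam₂ : ℝ} {A₂ b₂ v₂ v₂' v₂'' : ℝ → ℝ}

lemma diff_lower_bound (H : HalfProblem K ℓ A b v v' v'')
    (R : LayerRates K ℓ ε μ δ θ₁ θ₂ κ lam A b) (H₂ : HalfProblem K ℓ₂ A₂ b₂ v₂ v₂' v₂'')
    (R₂ : LayerRates K ℓ₂ ε μ δ θ₁ θ₂ κ₂ lam₂ A₂ b₂) {C : ℝ} (hC : 0 < C)
    {E E' E'' E₂ E₂' E₂'' : ℝ → ℝ} (h0 : E 0 = E₂ 0)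
    (hE : SmallResidual ε μ ℓ (C * δ) A b E E' E'')
    (hE₂ : SmallResidual ε μ ℓ₂ (C * δ) A₂ b₂ E₂ E₂' E₂'')
    (hjump : |E' 0 + E₂' 0| ≤ C * δ * κ + C * δ * κ₂) :
    (∀ t ∈ Icc 0 ℓ, -(301 * K ^ 3 * C * δ) ≤ E t) ∧
    (∀ t ∈ Icc 0 ℓ₂, -(301 * K ^ 3 * C * δ) ≤ E₂ t) := by
  have hK := H.one_le
  have hδ := R.δ_pos H
  have m1 := diff_barrier_min H R hC hE
  have m2 := diff_barrier_min H₂ R₂ hC hE₂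
  have hG0 : 0 ≤ 300 * K ^ 3 * C * δ + (K * C * δ + E 0) := by
    by_contra! hneg
    have s1 := diff_barrier_slope H R hC hE hneg
    have s2 := diff_barrier_slope H₂ R₂ hC hE₂ (by rw [← h0]; exact hneg)
    have := (abs_le.1 hjump).2
    linarith
  have hKC : K * C * δ ≤ K ^ 3 * C * δ := by
    gcongr
    exact le_self_pow₀ hK (by norm_num)
  have hpos : 0 ≤ 300 * K ^ 3 * C * δ := by positivity
  have hexp : ∀ r t : ℝ, 0 < r → 0 ≤ t → Real.exp (-(r * t)) ≤ 1 := fun r t hr ht =>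
    Real.exp_le_one_iff.2 (neg_nonpos.2 (mul_nonneg hr.le ht))
  constructor
  · intro t ht
    have h1 := m1 t ht
    rw [min_eq_right hG0] at h1
    have h2 := mul_le_of_le_one_right hpos (hexp _ t (R.barrier_pos H) ht.1)
    linarith
  · intro t ht
    have h1 := m2 t ht
    rw [← h0, min_eq_right hG0] at h1
    have h2 := mul_le_of_le_one_right hpos (hexp _ t (R₂.barrier_pos H₂) ht.1)
    linarith

lemma diff_stability (H : HalfProblem K ℓ A b v v' v'')
    (R : LayerRates K ℓ ε μ δ θ₁ θ₂ κ lam A b) (H₂ : HalfProblem K ℓ₂ A₂ b₂ v₂ v₂' v₂'')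
    (R₂ : LayerRates K ℓ₂ ε μ δ θ₁ θ₂ κ₂ lam₂ A₂ b₂) {C : ℝ} (hC : 0 < C)
    {E E' E'' E₂ E₂' E₂'' : ℝ → ℝ} (h0 : E 0 = E₂ 0)
    (hE : SmallResidual ε μ ℓ (C * δ) A b E E' E'')
    (hE₂ : SmallResidual ε μ ℓ₂ (C * δ) A₂ b₂ E₂ E₂' E₂'')
    (hjump : |E' 0 + E₂' 0| ≤ C * δ * κ + C * δ * κ₂) :
    (∀ t ∈ Icc 0 ℓ, |E t| ≤ 301 * K ^ 3 * C * δ) ∧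
    (∀ t ∈ Icc 0 ℓ₂, |E₂ t| ≤ 301 * K ^ 3 * C * δ) := by
  have l1 := diff_lower_bound H R H₂ R₂ hC h0 hE hE₂ hjump
  have l2 := diff_lower_bound H R H₂ R₂ hC (by rw [h0]) hE.neg hE₂.neg
    (by rw [← neg_add, abs_neg]; exact hjump)
  exact ⟨fun j hj => abs_le.2 ⟨l1.1 j hj, by linarith [l2.1 j hj]⟩,
    fun j hj => abs_le.2 ⟨l1.2 j hj, by linarith [l2.2 j hj]⟩⟩
end

/-! ### The error estimate in terms of the two sides -/

/-- `u` solves the differential equation with right-hand side `-b v` on one side of the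
interface, with boundary value `y`. -/
structure HalfSolution (ε μ ℓ y : ℝ) (A b v u u' u'' : ℝ → ℝ) : Prop where
  continuousOn : ContinuousOn u (Icc 0 ℓ)
  deriv : ∀ t ∈ Ioo 0 ℓ, HasDerivAt u (u' t) t
  deriv' : ∀ t ∈ Ioo 0 ℓ, HasDerivAt u' (u'' t) t
  deriv_zero : HasDerivWithinAt u (u' 0) (Icc 0 ℓ) 0
  equation : ∀ t ∈ Ioo 0 ℓ, ε * u'' t + μ * A t * u' t - b t * u t = -(b t * v t)
  last : u ℓ = y

/-- `Y` solves the upwind scheme with right-hand side `-b v` on one side of the interface, with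
boundary value `y`. -/
structure HalfDiscreteSolution (N : ℕ) (ε μ y : ℝ) (A b v : ℝ → ℝ) (t Y : ℕ → ℝ) : Prop where
  equation : ∀ k, k + 1 < N / 2 →
    upwindOp ε μ A b t Y (k + 1) = -(b (t (k + 1)) * v (t (k + 1)))
  last : Y (N / 2) = y

/-- A two-by-two linear system with determinant of size `κ + κ₂`. Both rates are positive, so the
amplitudes are fractions of the value jump, bounded for every ratio `κ / κ₂`. -/
lemma exists_amplitudes {κ κ₂ w w₂ B : ℝ} (hκ : 0 < κ) (hκ₂ : 0 < κ₂) (hw : |w| ≤ B)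
    (hw₂ : |w₂| ≤ B) : ∃ a a₂ : ℝ, w + a = w₂ + a₂ ∧ a * κ + a₂ * κ₂ = 0 ∧
      |a| ≤ 2 * B ∧ |a₂| ≤ 2 * B := by
  have hs : 0 < κ + κ₂ := by linarith
  have hJ : |w₂ - w| ≤ 2 * B := by
    have := abs_sub w₂ w
    linarith
  have hfrac : ∀ c : ℝ, 0 ≤ c → c ≤ κ + κ₂ → |c * (w₂ - w) / (κ + κ₂)| ≤ 2 * B := by
    intro c h0 h1
    rw [abs_div, abs_mul, abs_of_nonneg h0, abs_of_pos hs, div_le_iff₀ hs]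
    nlinarith [abs_nonneg (w₂ - w)]
  refine ⟨κ₂ * (w₂ - w) / (κ + κ₂), -(κ * (w₂ - w) / (κ + κ₂)), ?_, ?_,
    hfrac _ hκ₂.le (by linarith), ?_⟩
  · field_simp
    ring
  · field_simp
    ring
  · rw [abs_neg]
    exact hfrac _ hκ.le (by linarith)

section
variable {K ℓ ε μ δ θ₁ θ₂ κ lam y a₀ a₁ : ℝ} {A b v v' v'' u u' u'' : ℝ → ℝ}

lemma HalfSolution.smallResidual (H : HalfProblem K ℓ A b v v' v'')
    (R : LayerRates K ℓ ε μ δ θ₁ θ₂ κ lam A b) (U : HalfSolution ε μ ℓ y A b v u u' u'')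
    (h₀ : |a₀| ≤ 6 * K) (h₁ : |a₁| ≤ 6 * K) (ha : a₁ = y - v ℓ) :
    SmallResidual ε μ ℓ (approxConst K * δ) A b (fun t => u t - layerApprox ℓ κ lam a₀ a₁ v t)
      (fun t => u' t - layerApprox ℓ κ lam (-(a₀ * κ)) (a₁ * lam) v' t)
      (fun t => u'' t - layerApprox ℓ κ lam (-(-(a₀ * κ) * κ)) (a₁ * lam * lam) v'' t) where
  continuousOn := U.continuousOn.sub fun t ht =>
    (layerApprox_hasDerivWithinAt (H.v_deriv t ht)).continuousWithinAt
  deriv t ht := (U.deriv t ht).sub (layerApprox_hasDerivAt (H.v_hasDerivAt ht))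
  deriv' t ht := (U.deriv' t ht).sub (layerApprox_hasDerivAt (H.v'_hasDerivAt ht))
  deriv_zero := U.deriv_zero.sub (layerApprox_hasDerivWithinAt (H.v_deriv 0 H.zero_mem))
  residual t ht := by
    have h := layerApprox_residual H R h₀ h₁ (Ioo_subset_Icc_self ht)
    rw [← abs_neg] at h
    convert h using 2
    linarith [U.equation t ht]
  last := by
    simpa only [U.last] using layerApprox_boundary H R h₀ ha

lemma HalfProblem.amplitude_le (H : HalfProblem K ℓ A b v v' v'') (hy : |y| ≤ K)
    (ha : a₁ = y - v ℓ) : |a₁| ≤ 2 * K := by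
  rw [ha]
  have := abs_sub y (v ℓ)
  linarith [H.v_bound ℓ H.len_mem]

lemma HalfProblem.outer_value_le (H : HalfProblem K ℓ A b v v' v'') (hl : 0 < lam)
    (h₁ : |a₁| ≤ 2 * K) : |v 0 + a₁ * Real.exp (-(lam * ℓ))| ≤ 3 * K := by
  have h := mul_pos hl H.len_pos
  have h2 := mul_abs_le_mul h₁ ((abs_of_pos (Real.exp_pos (-(lam * ℓ)))).trans_le
    (Real.exp_le_one_iff.2 (by linarith)))
  refine (abs_add_le _ _).trans ?_
  linarith [H.v_bound 0 H.zero_mem]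

lemma layerApprox_zero : layerApprox ℓ κ lam a₀ a₁ v 0
    = v 0 + a₁ * Real.exp (-(lam * ℓ)) + a₀ := by
  simp [layerApprox]

variable {N : ℕ} {t Y : ℕ → ℝ}

lemma HalfDiscreteSolution.residual (h8 : 8 ∣ N) (H : HalfProblem K ℓ A b v v' v'')
    (R : LayerRates K ℓ ε μ (N : ℝ)⁻¹ θ₁ θ₂ κ lam A b) (T : LayerAdapted N ℓ θ₁ θ₂ t)
    (D : HalfDiscreteSolution N ε μ y A b v t Y) (h₀ : |a₀| ≤ 6 * K) (h₁ : |a₁| ≤ 6 * K) :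
    ∀ k, k + 1 < N / 2 →
      |upwindOp ε μ A b t (fun i => Y i - layerApprox ℓ κ lam a₀ a₁ v (t i)) (k + 1)|
      ≤ approxConst K * (N : ℝ)⁻¹ * (1 + μ * κ * meshExp (κ / (4 * K ^ 2)) t (k + 2)) := by
  intro k hk
  have h := layerApprox_upwind_residual H R T h8 h₀ h₁ hk
  rw [← abs_neg] at h
  convert h using 2
  have hlin : upwindOp ε μ A b t (fun i => Y i - layerApprox ℓ κ lam a₀ a₁ v (t i)) (k + 1)
      = upwindOp ε μ A b t Y (k + 1)
        - upwindOp ε μ A b t (fun i => layerApprox ℓ κ lam a₀ a₁ v (t i)) (k + 1) := by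
    simp only [upwindOp, secondDiffQuot, fwdDiffQuot, bwdDiffQuot]
    ring
  rw [hlin, D.equation k hk]
  ring

variable {ℓ₂ κ₂ lam₂ y₂ : ℝ} {A₂ b₂ v₂ v₂' v₂'' u₂ u₂' u₂'' : ℝ → ℝ} {t₂ Y₂ : ℕ → ℝ}

theorem two_sided_error (h8 : 8 ∣ N) (hN : 8 ≤ N) (H : HalfProblem K ℓ A b v v' v'')
    (R : LayerRates K ℓ ε μ (N : ℝ)⁻¹ θ₁ θ₂ κ lam A b) (T : LayerAdapted N ℓ θ₁ θ₂ t)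
    (H₂ : HalfProblem K ℓ₂ A₂ b₂ v₂ v₂' v₂'')
    (R₂ : LayerRates K ℓ₂ ε μ (N : ℝ)⁻¹ θ₁ θ₂ κ₂ lam₂ A₂ b₂) (T₂ : LayerAdapted N ℓ₂ θ₁ θ₂ t₂)
    (hy : |y| ≤ K) (hy₂ : |y₂| ≤ K)
    (U : HalfSolution ε μ ℓ y A b v u u' u'') (U₂ : HalfSolution ε μ ℓ₂ y₂ A₂ b₂ v₂ u₂ u₂' u₂'')
    (hu : u 0 = u₂ 0) (hu' : u' 0 + u₂' 0 = 0)
    (D : HalfDiscreteSolution N ε μ y A b v t Y) (D₂ : HalfDiscreteSolution N ε μ y₂ A₂ b₂ v₂ t₂ Y₂)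
    (hY : Y 0 = Y₂ 0) (hY' : fwdDiffQuot t Y 0 + fwdDiffQuot t₂ Y₂ 0 = 0) :
    (∀ j ≤ N / 2, |Y j - u (t j)| ≤ 602 * K ^ 3 * approxConst K * (N : ℝ)⁻¹) ∧
    (∀ j ≤ N / 2, |Y₂ j - u₂ (t₂ j)| ≤ 602 * K ^ 3 * approxConst K * (N : ℝ)⁻¹) := by
  have hK := H.one_le
  have hC := H.approxConst_pos
  obtain ⟨a₁, ha₁⟩ : ∃ a₁, a₁ = y - v ℓ := ⟨_, rfl⟩
  obtain ⟨c₁, hc₁⟩ : ∃ c₁, c₁ = y₂ - v₂ ℓ₂ := ⟨_, rfl⟩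
  have ha := H.amplitude_le hy ha₁
  have hc := H₂.amplitude_le hy₂ hc₁
  obtain ⟨a₀, c₀, hval, hslope, ha0, hc0⟩ := exists_amplitudes R.κ_pos R₂.κ_pos
    (H.outer_value_le R.lam_pos ha) (H₂.outer_value_le R₂.lam_pos hc)
  rw [← layerApprox_zero (κ := κ), ← layerApprox_zero (κ := κ₂)] at hval
  replace ha : |a₁| ≤ 6 * K := by linarith
  replace hc : |c₁| ≤ 6 * K := by linarith
  replace ha0 : |a₀| ≤ 6 * K := by linarith
  replace hc0 : |c₀| ≤ 6 * K := by linarith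
  have hcont := diff_stability H R H₂ R₂ hC (by simp only [hu, hval])
    (U.smallResidual H R ha0 ha ha₁) (U₂.smallResidual H₂ R₂ hc0 hc hc₁) (by
      have h1 := layerApprox_slope_zero (a₀ := a₀) H R ha
      have h2 := layerApprox_slope_zero (a₀ := c₀) H₂ R₂ hc
      refine le_trans (le_of_eq ?_) ((abs_add_le _ _).trans (add_le_add h1 h2))
      rw [← abs_neg]
      congr 1
      linarith)
  have hdisc := upwind_stability H R T H₂ R₂ T₂ hN hC
    (E := fun i => Y i - layerApprox ℓ κ lam a₀ a₁ v (t i))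
    (E₂ := fun i => Y₂ i - layerApprox ℓ₂ κ₂ lam₂ c₀ c₁ v₂ (t₂ i))
    (by simp only [hY, T.zero, T₂.zero, hval]) (D.residual h8 H R T ha0 ha)
    (by simpa only [D.last, T.last] using layerApprox_boundary H R ha0 ha₁)
    (D₂.residual h8 H₂ R₂ T₂ hc0 hc)
    (by simpa only [D₂.last, T₂.last] using layerApprox_boundary H₂ R₂ hc0 hc₁) (by
      have h1 := layerApprox_fwdDiffQuot_zero H R T hN ha0 ha
      have h2 := layerApprox_fwdDiffQuot_zero H₂ R₂ T₂ hN hc0 hc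
      refine le_trans (le_of_eq ?_) ((abs_add_le _ _).trans (add_le_add h1 h2))
      rw [← abs_neg]
      congr 1
      have hlin : ∀ x F G : ℕ → ℝ, fwdDiffQuot x (fun i => F i - G i) 0
          = fwdDiffQuot x F 0 - fwdDiffQuot x G 0 := by
        intro x F G
        simp only [fwdDiffQuot]
        ring
      rw [hlin, hlin]
      linarith)
  constructor
  · intro j hj
    have h1 := hdisc.1 j hj
    have h2 := hcont.1 (t j) (T.mem_Icc hj)
    have h3 := abs_sub_le (Y j) (layerApprox ℓ κ lam a₀ a₁ v (t j)) (u (t j))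
    rw [abs_sub_comm] at h2
    linarith
  · intro j hj
    have h1 := hdisc.2 j hj
    have h2 := hcont.2 (t₂ j) (T₂.mem_Icc hj)
    have h3 := abs_sub_le (Y₂ j) (layerApprox ℓ₂ κ₂ lam₂ c₀ c₁ v₂ (t₂ j)) (u₂ (t₂ j))
    rw [abs_sub_comm] at h2
    linarith
end

/-! ### Layer rates of the operator with frozen coefficients -/

lemma exists_boundary_rate {ε m β : ℝ} (hε : 0 < ε) (hm : 0 < m) (hβ : 0 < β) :
    ∃ x : ℝ, 0 < x ∧ ε * x ^ 2 + m * x = β := by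
  have hD : 0 ≤ m ^ 2 + 4 * ε * β := by positivity
  have hs := Real.sq_sqrt hD
  refine ⟨(-m + √(m ^ 2 + 4 * ε * β)) / (2 * ε), ?_, ?_⟩
  · apply div_pos _ (by positivity)
    have : m < √(m ^ 2 + 4 * ε * β) := Real.lt_sqrt_of_sq_lt (by nlinarith [mul_pos hε hβ])
    linarith
  · generalize √(m ^ 2 + 4 * ε * β) = s at *
    field_simp
    linarith

lemma exists_interior_rate {ε m β : ℝ} (hε : 0 < ε) (hm : 0 < m) (hβ : 0 < β) :
    ∃ x : ℝ, 0 < x ∧ ε * x ^ 2 = m * x + β := by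
  have hD : 0 ≤ m ^ 2 + 4 * ε * β := by positivity
  have hs := Real.sq_sqrt hD
  refine ⟨(m + √(m ^ 2 + 4 * ε * β)) / (2 * ε), by positivity, ?_⟩
  generalize √(m ^ 2 + 4 * ε * β) = s at *
  field_simp
  linarith

lemma le_boundary_rate {ε m β x θ : ℝ} (hε : 0 < ε) (hm : 0 < m) (hx : 0 < x)
    (hxe : ε * x ^ 2 + m * x = β) (hθ : ε * θ ^ 2 + m * θ ≤ β) : θ ≤ x := by
  by_contra! h
  nlinarith [mul_pos hε (mul_pos hx (sub_pos.2 h)), mul_pos hm (sub_pos.2 h),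
    mul_pos hε (mul_pos (sub_pos.2 h) (sub_pos.2 h))]

/-- At the positive root `ε x - m = β / x > 0`, so `ε x² - m x - β` is positive beyond it. -/
lemma le_interior_rate {ε m β x θ : ℝ} (hε : 0 < ε) (hβ : 0 < β) (hx : 0 < x)
    (hxe : ε * x ^ 2 = m * x + β) (hθ : ε * θ ^ 2 ≤ m * θ + β) : θ ≤ x := by
  by_contra! h
  have h1 : 0 < ε * x - m := by
    by_contra! h2
    nlinarith
  nlinarith [mul_pos h1 (sub_pos.2 h), mul_pos hε (mul_pos hx (sub_pos.2 h)),
    mul_pos hε (mul_pos (sub_pos.2 h) (sub_pos.2 h))]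

lemma le_of_sq_le_mul_add {X z : ℝ} (hX : 0 ≤ X) (h : z ^ 2 ≤ X * z + X) : z ≤ X + 1 := by
  by_contra! h1
  nlinarith

/-- The mesh rates `θ₁`, `θ₂` are comparable to the layer rates for all frozen coefficients in the
range prescribed by `α`, `ρ`, `B`. -/
structure MeshRates (α ρ B K ε μ δ θ₁ θ₂ : ℝ) : Prop where
  θ₂_pos : 0 < θ₂
  θ₂_le_θ₁ : θ₂ ≤ θ₁
  ε_le : ε ≤ K * δ
  μ_le : μ ≤ K * δ
  one_le_θ₂ : 1 ≤ K * δ * θ₂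
  boundary : ∀ A b, α ≤ A → A ≤ B → ρ * A ≤ b → b ≤ B →
    ∃ lam, θ₂ ≤ lam ∧ lam ≤ K * θ₂ ∧ ε * lam ^ 2 + μ * A * lam = b
  interior : ∀ A b, α ≤ A → A ≤ B → ρ * A ≤ b → b ≤ B →
    ∃ κ, θ₁ ≤ κ ∧ κ ≤ K * θ₁ ∧ ε * κ ^ 2 = μ * A * κ + b

lemma meshRates_of_reaction {α ρ B : ℝ} (hα : 0 < α) (hρ : 0 < ρ) (hB : 0 < B) :
    ∃ K₀ : ℝ, ∀ K ≥ K₀, ∀ ε μ δ : ℝ, 0 < ε → 0 < μ → 0 < δ → δ ≤ 1 → α * μ ^ 2 ≤ ρ * ε →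
      √ε < δ → MeshRates α ρ B K ε μ δ (√(ρ * α) / (2 * √ε)) (√(ρ * α) / (2 * √ε)) := by
  obtain ⟨S, hS, hS0⟩ : ∃ S : ℝ, S = √(ρ * α) ∧ 0 < S := ⟨_, rfl, by positivity⟩
  have hSq : S ^ 2 = ρ * α := by rw [hS]; exact Real.sq_sqrt (by positivity)
  obtain ⟨Z, hZ⟩ : ∃ Z, Z = ρ / S * B + B := ⟨_, rfl⟩
  have hZ0 : 0 ≤ Z := by rw [hZ]; positivity
  -- The summands after the first serve, in order, the bound on `μ`, the layer width `1 ≤ K δ θ₂`,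
  -- and the upper bounds on `lam` and `κ`.
  refine ⟨1 + ρ / S + 2 / S + 2 * (B + 1) / S + 2 * (Z + 1) / S, ?_⟩
  intro K hK ε μ δ hε hμ hδ hδ1 hcase hsmall
  obtain ⟨w, hw, hw0, hww⟩ : ∃ w : ℝ, w = √ε ∧ 0 < w ∧ w ^ 2 = ε :=
    ⟨_, rfl, by positivity, Real.sq_sqrt hε.le⟩
  rw [← hS, ← hw]
  rw [← hw] at hsmall
  have p1 : 0 < ρ / S := by positivity
  have p2 : 0 < 2 / S := by positivity
  have p3 : 0 < 2 * (B + 1) / S := by positivity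
  have p4 : 0 < 2 * (Z + 1) / S := by positivity
  have k1 : 1 ≤ K := by linarith
  have k2 : ρ ≤ K * S := by rw [← div_le_iff₀ hS0]; linarith
  have k3 : 2 ≤ K * S := by rw [← div_le_iff₀ hS0]; linarith
  have k4 : 2 * (B + 1) ≤ K * S := by rw [← div_le_iff₀ hS0]; linarith
  have k5 : 2 * (Z + 1) ≤ K * S := by rw [← div_le_iff₀ hS0]; linarith
  have hμS : μ * S ≤ ρ * w := by
    refine (pow_le_pow_iff_left₀ (by positivity) (by positivity) two_ne_zero).1 ?_
    rw [mul_pow, mul_pow, hSq, hww]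
    have := mul_le_mul_of_nonneg_left hcase hρ.le
    linarith
  have hθ0 : 0 < S / (2 * w) := by positivity
  have hup : ∀ x, 2 * (x * w) ≤ K * S → x ≤ K * (S / (2 * w)) := by
    intro x hx
    rw [← mul_div_assoc, le_div_iff₀ (by positivity)]
    linarith
  have hεθ : ε * (S / (2 * w)) ^ 2 = ρ * α / 4 := by
    rw [← hSq, ← hww]; field_simp; norm_num
  refine ⟨hθ0, le_rfl, by nlinarith, ?_, ?_, ?_, ?_⟩
  · have h1 : μ * S ≤ K * δ * S := by nlinarith
    exact le_of_mul_le_mul_right h1 hS0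
  · rw [← mul_div_assoc, le_div_iff₀ (by positivity)]
    nlinarith
  · intro A b hA hAB hb hbB
    have hA0 : 0 < A := by linarith
    have hρA : ρ * α ≤ ρ * A := mul_le_mul_of_nonneg_left hA hρ.le
    have hb0 : 0 < b := (mul_pos hρ hA0).trans_le hb
    obtain ⟨x, hx0, hx⟩ := exists_boundary_rate hε (mul_pos hμ hA0) hb0
    -- The factor `1 / 2` in `θ` pays here: the two terms at `θ` are at most `ρ A / 4` and `ρ A /
    -- 2`, together below `ρ A ≤ b`.
    refine ⟨x, le_boundary_rate hε (mul_pos hμ hA0) hx0 hx ?_, hup x ?_, hx⟩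
    · rw [hεθ]
      have h1 : μ * A * (S / (2 * w)) ≤ ρ * A / 2 := by
        rw [← mul_div_assoc, div_le_iff₀ (by positivity)]
        have := mul_le_mul_of_nonneg_left hμS hA0.le
        linarith
      linarith [mul_pos hρ hA0]
    · have h1 : (x * w) ^ 2 ≤ B := by
        rw [mul_pow, hww]
        linarith [mul_pos (mul_pos hμ hA0) hx0]
      have h2 : x * w ≤ B + 1 := by nlinarith [sq_nonneg (x * w - 1)]
      linarith
  · intro A b hA hAB hb hbB
    have hA0 : 0 < A := by linarith
    have hρA : ρ * α ≤ ρ * A := mul_le_mul_of_nonneg_left hA hρ.le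
    have hb0 : 0 < b := (mul_pos hρ hA0).trans_le hb
    obtain ⟨x, hx0, hx⟩ := exists_interior_rate hε (mul_pos hμ hA0) hb0
    refine ⟨x, le_interior_rate hε hb0 hx0 hx ?_, hup x ?_, hx⟩
    · rw [hεθ]
      have : 0 < μ * A * (S / (2 * w)) := by positivity
      linarith
    · have h1 : μ ≤ ρ / S * w := by
        rw [div_mul_eq_mul_div, le_div_iff₀ hS0]; exact hμS
      have h2 : (x * w) ^ 2 ≤ Z * (x * w) + Z := by
        rw [mul_pow, hww]
        have h3 : μ * A * x ≤ ρ / S * w * B * x := by gcongr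
        have h4 : 0 ≤ B * (x * w) := by positivity
        have h5 : 0 ≤ ρ / S * B := by positivity
        rw [hZ]
        linarith
      have := le_of_sq_le_mul_add hZ0 h2
      linarith

lemma meshRates_of_convection {α ρ B : ℝ} (hα : 0 < α) (hρ : 0 < ρ) (hB : 0 < B) :
    ∃ K₀ : ℝ, ∀ K ≥ K₀, ∀ ε μ δ : ℝ, 0 < ε → 0 < μ → 0 < δ → δ ≤ 1 → ρ * ε ≤ α * μ ^ 2 →
      ε / μ < δ → μ < δ → MeshRates α ρ B K ε μ δ (α * μ / (2 * ε)) (ρ / (2 * μ)) := by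
  obtain ⟨Z, hZ⟩ : ∃ Z, Z = B + B * (α / ρ) := ⟨_, rfl⟩
  have hZ0 : 0 ≤ Z := by rw [hZ]; positivity
  refine ⟨1 + 2 / ρ + 2 * B / (α * ρ) + 2 * (Z + 1) / α, ?_⟩
  intro K hK ε μ δ hε hμ hδ hδ1 hcase hεμ hμδ
  have p2 : 0 < 2 / ρ := by positivity
  have p3 : 0 < 2 * B / (α * ρ) := by positivity
  have p4 : 0 < 2 * (Z + 1) / α := by positivity
  have k1 : 1 ≤ K := by linarith
  have k3 : 2 ≤ K * ρ := by rw [← div_le_iff₀ hρ]; linarith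
  have k4 : 2 * B ≤ K * (α * ρ) := by rw [← div_le_iff₀ (by positivity)]; linarith
  have k5 : 2 * (Z + 1) ≤ K * α := by rw [← div_le_iff₀ hα]; linarith
  have hεμ' : ε < δ * μ := by rwa [div_lt_iff₀ hμ] at hεμ
  refine ⟨by positivity, ?_, by nlinarith, by nlinarith, ?_, ?_, ?_⟩
  · rw [div_le_div_iff₀ (by positivity) (by positivity)]
    nlinarith
  · rw [← mul_div_assoc, le_div_iff₀ (by positivity)]
    nlinarith
  · intro A b hA hAB hb hbB
    have hA0 : 0 < A := by linarith
    have hρA : ρ * α ≤ ρ * A := mul_le_mul_of_nonneg_left hA hρ.le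
    have hb0 : 0 < b := (mul_pos hρ hA0).trans_le hb
    obtain ⟨x, hx0, hx⟩ := exists_boundary_rate hε (mul_pos hμ hA0) hb0
    refine ⟨x, le_boundary_rate hε (mul_pos hμ hA0) hx0 hx ?_, ?_, hx⟩
    · have h1 : μ * A * (ρ / (2 * μ)) = ρ * A / 2 := by field_simp
      have h2 : ε * (ρ / (2 * μ)) ^ 2 ≤ ρ * α / 4 := by
        rw [div_pow, ← mul_div_assoc, div_le_iff₀ (by positivity)]
        have := mul_le_mul_of_nonneg_left hcase hρ.le
        linarith
      rw [h1]
      linarith [mul_pos hρ hA0]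
    · rw [← mul_div_assoc, le_div_iff₀ (by positivity)]
      have h1 : α * (μ * x) ≤ B := by
        have : 0 ≤ ε * x ^ 2 := by positivity
        have : α * (μ * x) ≤ A * (μ * x) := by gcongr
        linarith
      have h2 : α * (x * (2 * μ)) ≤ α * (K * ρ) := by linarith
      exact le_of_mul_le_mul_left h2 hα
  · intro A b hA hAB hb hbB
    have hA0 : 0 < A := by linarith
    have hρA : ρ * α ≤ ρ * A := mul_le_mul_of_nonneg_left hA hρ.le
    have hb0 : 0 < b := (mul_pos hρ hA0).trans_le hb
    obtain ⟨x, hx0, hx⟩ := exists_interior_rate hε (mul_pos hμ hA0) hb0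
    refine ⟨x, le_interior_rate hε hb0 hx0 hx ?_, ?_, hx⟩
    · have h1 : ε * (α * μ / (2 * ε)) ^ 2 = α ^ 2 * μ ^ 2 / (4 * ε) := by field_simp; norm_num
      have h2 : μ * A * (α * μ / (2 * ε)) = 2 * A * α * μ ^ 2 / (4 * ε) := by field_simp; norm_num
      have h3 : α ^ 2 * μ ^ 2 / (4 * ε) ≤ 2 * A * α * μ ^ 2 / (4 * ε) := by
        gcongr
        nlinarith
      rw [h1, h2]
      linarith
    · rw [← mul_div_assoc, le_div_iff₀ (by positivity)]
      have hε' : ε ≤ α / ρ * μ ^ 2 := by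
        rw [div_mul_eq_mul_div, le_div_iff₀ hρ]; linarith
      -- The natural scale is `x ~ μ / ε`; in the variable `ε x / μ` the rate equation has bounded
      -- coefficients, since `ε / μ² ≤ α / ρ` in this regime.
      have h2 : (ε * x / μ) ^ 2 ≤ Z * (ε * x / μ) + Z := by
        have h3 : (ε * x / μ) ^ 2 = A * (ε * x / μ) + b * (ε / μ ^ 2) := by
          rw [div_pow, mul_pow, show ε ^ 2 * x ^ 2 = ε * (ε * x ^ 2) by ring, hx]
          field_simp
        have h4 : ε / μ ^ 2 ≤ α / ρ := by rw [div_le_iff₀ (by positivity)]; exact hε'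
        have h5 : b * (ε / μ ^ 2) ≤ B * (α / ρ) := by gcongr
        have h6 : A * (ε * x / μ) ≤ B * (ε * x / μ) := by gcongr
        have h7 : 0 ≤ B * (α / ρ) * (ε * x / μ) := by positivity
        rw [h3, hZ]
        linarith
      have h3 := le_of_sq_le_mul_add hZ0 h2
      rw [div_le_iff₀ hμ] at h3
      have := mul_le_mul_of_nonneg_right k5 hμ.le
      linarith

section
variable {α ρ B K ℓ ε μ δ θ₁ θ₂ : ℝ} {A b v v' v'' : ℝ → ℝ}

lemma MeshRates.exists_layerRates (M : MeshRates α ρ B K ε μ δ θ₁ θ₂) (hε : 0 < ε) (hμ : 0 < μ)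
    (hℓ : 0 ≤ ℓ) (hA : ∀ t ∈ Icc 0 ℓ, α ≤ A t ∧ A t ≤ B)
    (hb : ∀ t ∈ Icc 0 ℓ, ρ * A t ≤ b t ∧ b t ≤ B) :
    ∃ κ lam, LayerRates K ℓ ε μ δ θ₁ θ₂ κ lam A b := by
  have h0 : (0 : ℝ) ∈ Icc 0 ℓ := ⟨le_rfl, hℓ⟩
  have h1 : ℓ ∈ Icc 0 ℓ := ⟨hℓ, le_rfl⟩
  obtain ⟨lam, l1, l2, l3⟩ := M.boundary (A ℓ) (b ℓ) (hA ℓ h1).1 (hA ℓ h1).2 (hb ℓ h1).1 (hb ℓ h1).2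
  obtain ⟨κ, k1, k2, k3⟩ := M.interior (A 0) (b 0) (hA 0 h0).1 (hA 0 h0).2 (hb 0 h0).1 (hb 0 h0).2
  exact ⟨κ, lam, hε, hμ, M.θ₂_pos, M.θ₂_le_θ₁, M.ε_le, M.μ_le, M.one_le_θ₂, l1, l2, k1, k2, l3, k3⟩
end

/-! ### One-sided problems from smooth data -/

/-- Carries the bounds on the coefficients to their one-sided limits at the interface, which enter
the frozen rate `κ`. -/
lemma nonneg_zero_of_nonneg_Ioc {g : ℝ → ℝ} {ℓ : ℝ} (hℓ : 0 < ℓ) (hg : ContinuousOn g (Icc 0 ℓ))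
    (h : ∀ t ∈ Ioc 0 ℓ, 0 ≤ g t) : ∀ t ∈ Icc 0 ℓ, 0 ≤ g t := by
  intro t ht
  rcases ht.1.eq_or_lt with rfl | h0
  · have h1 := (hg 0 ht).mono (Ioo_subset_Icc_self (a := 0) (b := ℓ))
    have hne : (nhdsWithin (0 : ℝ) (Ioo 0 ℓ)).NeBot := by
      rw [nhdsWithin_Ioo_eq_nhdsGT hℓ]; infer_instance
    refine ge_of_tendsto h1 ?_
    filter_upwards [self_mem_nhdsWithin] with s hs using h s (Ioo_subset_Ioc_self hs)
  · exact h t ⟨h0, ht.2⟩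

lemma ContDiffOn.exists_abs_le {g : ℝ → ℝ} {ℓ : ℝ} (hg : ContDiffOn ℝ 1 g (Icc 0 ℓ)) :
    ∃ C : ℝ, ∀ t ∈ Icc 0 ℓ, |g t| ≤ C :=
  isCompact_Icc.exists_bound_of_continuousOn hg.continuousOn

lemma ContDiffOn.exists_abs_sub_le {g : ℝ → ℝ} {ℓ : ℝ} (hℓ : 0 < ℓ)
    (hg : ContDiffOn ℝ 1 g (Icc 0 ℓ)) :
    ∃ C : ℝ, ∀ t ∈ Icc 0 ℓ, ∀ s ∈ Icc 0 ℓ, |g t - g s| ≤ C * |t - s| := by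
  obtain ⟨C, hC⟩ := isCompact_Icc.exists_bound_of_continuousOn
    (hg.continuousOn_derivWithin (uniqueDiffOn_Icc hℓ) le_rfl)
  refine ⟨C, fun t ht s hs => ?_⟩
  exact (convex_Icc 0 ℓ).norm_image_sub_le_of_norm_derivWithin_le
    (hg.differentiableOn one_ne_zero) hC hs ht

lemma exists_halfProblem {ℓ α γ : ℝ} {A b F : ℝ → ℝ} (hℓ : 0 < ℓ) (hα : 0 < α) (hγ : 0 < γ)
    (hA : ContDiffOn ℝ 7 A (Icc 0 ℓ)) (hb : ContDiffOn ℝ 7 b (Icc 0 ℓ))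
    (hF : ContDiffOn ℝ 7 F (Icc 0 ℓ)) (hAα : ∀ t ∈ Icc 0 ℓ, α ≤ A t)
    (hbγ : ∀ t ∈ Icc 0 ℓ, γ ≤ b t) :
    ∃ (v' v'' : ℝ → ℝ) (K₀ : ℝ), ∀ K ≥ K₀,
      HalfProblem K ℓ A b (fun t => -F t / b t) v' v'' := by
  have hu := uniqueDiffOn_Icc hℓ
  have hv : ContDiffOn ℝ 7 (fun t => -F t / b t) (Icc 0 ℓ) :=
    hF.neg.div hb (fun t ht => (hγ.trans_le (hbγ t ht)).ne')
  obtain ⟨v, hvdef⟩ : ∃ v, v = fun t => -F t / b t := ⟨_, rfl⟩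
  rw [← hvdef] at hv ⊢
  have hv1 : ContDiffOn ℝ 6 (derivWithin v (Icc 0 ℓ)) (Icc 0 ℓ) :=
    hv.derivWithin hu (by norm_num)
  have hv2 : ContDiffOn ℝ 5 (derivWithin (derivWithin v (Icc 0 ℓ)) (Icc 0 ℓ)) (Icc 0 ℓ) :=
    hv1.derivWithin hu (by norm_num)
  obtain ⟨c1, h1⟩ := (hA.of_le (by norm_num)).exists_abs_le
  obtain ⟨c2, h2⟩ := (hb.of_le (by norm_num)).exists_abs_le
  obtain ⟨c3, h3⟩ := (hv.of_le (by norm_num)).exists_abs_le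
  obtain ⟨c4, h4⟩ := (hv1.of_le (by norm_num)).exists_abs_le
  obtain ⟨c5, h5⟩ := (hv2.of_le (by norm_num)).exists_abs_le
  obtain ⟨c6, h6⟩ := (hA.of_le (by norm_num)).exists_abs_sub_le hℓ
  obtain ⟨c7, h7⟩ := (hb.of_le (by norm_num)).exists_abs_sub_le hℓ
  refine ⟨derivWithin v (Icc 0 ℓ), derivWithin (derivWithin v (Icc 0 ℓ)) (Icc 0 ℓ),
    1 + ℓ⁻¹ + α⁻¹ + γ⁻¹ + |c1| + |c2| + |c3| + |c4| + |c5| + |c6| + |c7|, fun K hK => ?_⟩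
  have p1 : 0 < ℓ⁻¹ := by positivity
  have p2 : 0 < α⁻¹ := by positivity
  have p3 : 0 < γ⁻¹ := by positivity
  have n1 := abs_nonneg c1
  have n2 := abs_nonneg c2
  have n3 := abs_nonneg c3
  have n4 := abs_nonneg c4
  have n5 := abs_nonneg c5
  have n6 := abs_nonneg c6
  have n7 := abs_nonneg c7
  have hK1 : 1 ≤ K := by linarith
  have hKα : K⁻¹ ≤ α := inv_le_of_inv_le₀ hα (by linarith)
  have hKγ : K⁻¹ ≤ γ := inv_le_of_inv_le₀ hγ (by linarith)
  exact
    { one_le := hK1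
      len_pos := hℓ
      len := by
        have : ℓ⁻¹ * ℓ ≤ K * ℓ := mul_le_mul_of_nonneg_right (by linarith) hℓ.le
        rwa [inv_mul_cancel₀ hℓ.ne'] at this
      A_lower := fun t ht => hKα.trans (hAα t ht)
      A_upper := fun t ht => by linarith [le_abs_self (A t), h1 t ht, le_abs_self c1]
      b_lower := fun t ht => hKγ.trans (hbγ t ht)
      b_upper := fun t ht => by linarith [le_abs_self (b t), h2 t ht, le_abs_self c2]
      A_lip := fun t ht s hs => (h6 t ht s hs).trans
        (mul_le_mul_of_nonneg_right (by linarith [le_abs_self c6]) (abs_nonneg _))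
      b_lip := fun t ht s hs => (h7 t ht s hs).trans
        (mul_le_mul_of_nonneg_right (by linarith [le_abs_self c7]) (abs_nonneg _))
      v_bound := fun t ht => by linarith [h3 t ht, le_abs_self c3]
      v'_bound := fun t ht => by linarith [h4 t ht, le_abs_self c4]
      v''_bound := fun t ht => by linarith [h5 t ht, le_abs_self c5]
      v_deriv := fun t ht => (hv.differentiableOn (by norm_num) t ht).hasDerivWithinAt
      v'_deriv := fun t ht => (hv1.differentiableOn (by norm_num) t ht).hasDerivWithinAt }

namespace BVPData
variable {P : BVPData}

lemma Admissible.α_pos (hP : P.Admissible) : 0 < P.α :=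
  abs_pos.2 (lt_min hP.α₁_pos hP.α₂_pos).ne'

lemma Admissible.α_eq (hP : P.Admissible) : P.α = min P.α₁ P.α₂ :=
  abs_of_pos (lt_min hP.α₁_pos hP.α₂_pos)

lemma ρ_mul_abs_le {x : ℝ} (hx : x ∈ Icc (0 : ℝ) 1) (hd : x ≠ P.d) (ha : P.a x ≠ 0)
    (hb : 0 ≤ P.b x) : P.ρ * |P.a x| ≤ P.b x := by
  have h : P.ρ ≤ |P.b x / P.a x| := by
    apply csInf_le
    · exact ⟨0, by rintro _ ⟨z, -, rfl⟩; exact abs_nonneg _⟩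
    · exact ⟨x, ⟨hx, hd⟩, rfl⟩
  rwa [abs_div, abs_of_nonneg hb, le_div_iff₀ (abs_pos.2 ha)] at h

lemma Admissible.ρ_pos (hP : P.Admissible) {B : ℝ}
    (hB : ∀ x ∈ Icc (0 : ℝ) 1, x ≠ P.d → |P.a x| ≤ B) : 0 < P.ρ := by
  obtain ⟨hd0, hd1⟩ := hP.d_mem
  have ha : ∀ x ∈ Icc (0 : ℝ) 1, x ≠ P.d → P.a x ≠ 0 := by
    intro x hx hxd
    rcases lt_or_gt_of_ne hxd with h | h
    · exact ne_of_lt (by linarith [hP.a_left x ⟨hx.1, h⟩, hP.α₁_pos])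
    · exact ne_of_gt (by linarith [hP.a_right x ⟨h, hx.2⟩, hP.α₂_pos])
  have hB0 : 0 < B := (abs_pos.2 (ha 0 (by simp) hd0.ne)).trans_le (hB 0 (by simp) hd0.ne)
  refine (div_pos hP.γ_pos hB0).trans_le (le_csInf ⟨_, 0, ⟨by simp, hd0.ne⟩, rfl⟩ ?_)
  rintro _ ⟨x, ⟨hx, hxd⟩, rfl⟩
  have hb := hP.b_lower x hx
  show P.γ / B ≤ |P.b x / P.a x|
  rw [abs_div]
  exact div_le_div₀ (abs_nonneg _) (hb.trans (le_abs_self _)) (abs_pos.2 (ha x hx hxd))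
    (hB x hx hxd)

/-- The right-hand side of the interface: extended coefficients in the distance to it. -/
lemma Admissible.exists_right (hP : P.Admissible) :
    ∃ (A v v' v'' : ℝ → ℝ) (K₀ : ℝ),
      (∀ K ≥ K₀, HalfProblem K (1 - P.d) A (fun t => P.b (P.d + t)) v v' v'') ∧
      (∀ t ∈ Icc 0 (1 - P.d), P.α₂ ≤ A t) ∧
      (∀ t ∈ Ioc 0 (1 - P.d), P.a (P.d + t) = A t ∧
        P.f (P.d + t) = -(P.b (P.d + t) * v t)) := by
  obtain ⟨hd0, hd1⟩ := hP.d_mem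
  obtain ⟨-, ar, har, hara⟩ := hP.a_smooth
  obtain ⟨-, fr, hfr, hfrf⟩ := hP.f_smooth
  have hℓ : 0 < 1 - P.d := by linarith
  have hmap : MapsTo (fun t => P.d + t) (Icc 0 (1 - P.d)) (Icc P.d 1) := fun t ht =>
    ⟨by linarith [ht.1], by linarith [ht.2]⟩
  have hmap1 : ∀ t ∈ Ioc 0 (1 - P.d), P.d + t ∈ Ioc P.d 1 := fun t ht =>
    ⟨by linarith [ht.1], by linarith [ht.2]⟩
  have hsm : ContDiffOn ℝ 7 (fun t : ℝ => P.d + t) (Icc 0 (1 - P.d)) :=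
    (contDiff_const.add contDiff_id).contDiffOn
  have hA := har.comp hsm hmap
  have hb := (hP.b_smooth.mono (Icc_subset_Icc hd0.le le_rfl)).comp hsm hmap
  have hF := hfr.comp hsm hmap
  have hAα : ∀ t ∈ Icc 0 (1 - P.d), P.α₂ ≤ ar (P.d + t) := fun t ht => by
    have := nonneg_zero_of_nonneg_Ioc (g := fun t => ar (P.d + t) - P.α₂) hℓ
      (hA.continuousOn.sub continuousOn_const) (fun s hs => by
        rw [← hara (hmap1 s hs)]; linarith [hP.a_right _ (hmap1 s hs)]) t ht
    linarith
  have hbγ : ∀ t ∈ Icc 0 (1 - P.d), P.γ ≤ P.b (P.d + t) := fun t ht =>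
    hP.b_lower _ (Icc_subset_Icc hd0.le le_rfl (hmap ht))
  obtain ⟨v', v'', K₀, hK⟩ := exists_halfProblem hℓ hP.α₂_pos hP.γ_pos hA hb hF hAα hbγ
  refine ⟨_, _, v', v'', K₀, hK, hAα, fun t ht => ⟨hara (hmap1 t ht), ?_⟩⟩
  rw [hfrf (hmap1 t ht)]
  have : P.b (P.d + t) ≠ 0 := (hP.γ_pos.trans_le (hbγ t (Ioc_subset_Icc_self ht))).ne'
  simp only [Function.comp]
  field_simp

/-- The left-hand side of the interface: extended coefficients in the distance to it. -/
lemma Admissible.exists_left (hP : P.Admissible) :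
    ∃ (A v v' v'' : ℝ → ℝ) (K₀ : ℝ),
      (∀ K ≥ K₀, HalfProblem K P.d A (fun t => P.b (P.d - t)) v v' v'') ∧
      (∀ t ∈ Icc 0 P.d, P.α₁ ≤ A t) ∧
      (∀ t ∈ Ioc 0 P.d, P.a (P.d - t) = -A t ∧
        P.f (P.d - t) = -(P.b (P.d - t) * v t)) := by
  obtain ⟨hd0, hd1⟩ := hP.d_mem
  obtain ⟨⟨al, hal, hala⟩, -⟩ := hP.a_smooth
  obtain ⟨⟨fl, hfl, hflf⟩, -⟩ := hP.f_smooth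
  have hmap : MapsTo (fun t => P.d - t) (Icc 0 P.d) (Icc 0 P.d) := fun t ht =>
    ⟨by linarith [ht.2], by linarith [ht.1]⟩
  have hmap1 : ∀ t ∈ Ioc 0 P.d, P.d - t ∈ Ico 0 P.d := fun t ht =>
    ⟨by linarith [ht.2], by linarith [ht.1]⟩
  have hsm : ContDiffOn ℝ 7 (fun t : ℝ => P.d - t) (Icc 0 P.d) :=
    (contDiff_const.sub contDiff_id).contDiffOn
  have hA := (hal.comp hsm hmap).neg
  have hb := (hP.b_smooth.mono (Icc_subset_Icc le_rfl hd1.le)).comp hsm hmap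
  have hF := hfl.comp hsm hmap
  have hAα : ∀ t ∈ Icc 0 P.d, P.α₁ ≤ -al (P.d - t) := fun t ht => by
    have := nonneg_zero_of_nonneg_Ioc (g := fun t => -al (P.d - t) - P.α₁) hd0
      (hA.continuousOn.sub continuousOn_const) (fun s hs => by
        rw [← hala (hmap1 s hs)]; linarith [hP.a_left _ (hmap1 s hs)]) t ht
    linarith
  have hbγ : ∀ t ∈ Icc 0 P.d, P.γ ≤ P.b (P.d - t) := fun t ht =>
    hP.b_lower _ (Icc_subset_Icc le_rfl hd1.le (hmap ht))
  obtain ⟨v', v'', K₀, hK⟩ := exists_halfProblem hd0 hP.α₁_pos hP.γ_pos hA hb hF hAα hbγ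
  refine ⟨_, _, v', v'', K₀, hK, hAα, fun t ht => ⟨?_, ?_⟩⟩
  · rw [hala (hmap1 t ht)]
    exact (neg_neg _).symm
  · rw [hflf (hmap1 t ht)]
    have : P.b (P.d - t) ≠ 0 := (hP.γ_pos.trans_le (hbγ t (Ioc_subset_Icc_self ht))).ne'
    simp only [Function.comp]
    field_simp

/-! ### The exact solution seen from each side -/

variable {ε μ : ℝ} {y : ℝ → ℝ} {A v : ℝ → ℝ}

lemma IsSolution.hasDerivAt (h : P.IsSolution ε μ y) {x : ℝ} (hx : x ∈ Ioo (0 : ℝ) 1) :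
    HasDerivAt y (deriv y x) x :=
  ((h.contDiffOn_one.differentiableOn one_ne_zero).differentiableAt
    (isOpen_Ioo.mem_nhds hx)).hasDerivAt

lemma IsSolution.hasDerivAt_deriv (h : P.IsSolution ε μ y) {x : ℝ}
    (hx : x ∈ Ioo 0 P.d ∪ Ioo P.d 1) : HasDerivAt (deriv y) (deriv (deriv y) x) x := by
  have ho : IsOpen (Ioo 0 P.d ∪ Ioo P.d 1) := isOpen_Ioo.union isOpen_Ioo
  have h1 : ContDiffOn ℝ 1 (deriv y) (Ioo 0 P.d ∪ Ioo P.d 1) :=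
    h.contDiffOn_two.deriv_of_isOpen ho (by norm_num)
  exact ((h1.differentiableOn one_ne_zero).differentiableAt (ho.mem_nhds hx)).hasDerivAt

lemma IsSolution.right (h : P.IsSolution ε μ y) (hd : P.d ∈ Ioo (0 : ℝ) 1)
    (hA : ∀ t ∈ Ioc 0 (1 - P.d), P.a (P.d + t) = A t ∧
        P.f (P.d + t) = -(P.b (P.d + t) * v t)) :
    HalfSolution ε μ (1 - P.d) P.y₁ A (fun t => P.b (P.d + t)) v (fun t => y (P.d + t))
      (fun t => deriv y (P.d + t)) (fun t => deriv (deriv y) (P.d + t)) := by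
  obtain ⟨hd0, hd1⟩ := hd
  have hmem : ∀ t ∈ Ioo 0 (1 - P.d), P.d + t ∈ Ioo P.d 1 := fun t ht =>
    ⟨by linarith [ht.1], by linarith [ht.2]⟩
  have hchain : ∀ {g : ℝ → ℝ} {g' t : ℝ}, HasDerivAt g g' (P.d + t) →
      HasDerivAt (fun t => g (P.d + t)) g' t := fun hg => hg.comp_const_add _ _
  refine ⟨?_, ?_, ?_, ?_, ?_, ?_⟩
  · exact h.continuousOn.comp (by fun_prop) fun t ht => ⟨by linarith [ht.1], by linarith [ht.2]⟩
  · exact fun t ht => hchain (h.hasDerivAt ⟨hd0.trans (hmem t ht).1, (hmem t ht).2⟩)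
  · exact fun t ht => hchain (h.hasDerivAt_deriv (Or.inr (hmem t ht)))
  · exact (hchain (h.hasDerivAt (by rw [add_zero]; exact ⟨hd0, hd1⟩))).hasDerivWithinAt
  · intro t ht
    have h1 := h.equation (P.d + t) (Or.inr (hmem t ht))
    obtain ⟨h2, h3⟩ := hA t (Ioo_subset_Ioc_self ht)
    rw [h2, h3] at h1
    exact h1
  · simp only [add_sub_cancel]
    exact h.right_value

lemma IsSolution.left (h : P.IsSolution ε μ y) (hd : P.d ∈ Ioo (0 : ℝ) 1)
    (hA : ∀ t ∈ Ioc 0 P.d, P.a (P.d - t) = -A t ∧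
        P.f (P.d - t) = -(P.b (P.d - t) * v t)) :
    HalfSolution ε μ P.d P.y₀ A (fun t => P.b (P.d - t)) v (fun t => y (P.d - t))
      (fun t => -deriv y (P.d - t)) (fun t => deriv (deriv y) (P.d - t)) := by
  obtain ⟨hd0, hd1⟩ := hd
  have hmem : ∀ t ∈ Ioo 0 P.d, P.d - t ∈ Ioo 0 P.d := fun t ht =>
    ⟨by linarith [ht.2], by linarith [ht.1]⟩
  have hchain : ∀ {g : ℝ → ℝ} {g' t : ℝ}, HasDerivAt g g' (P.d - t) →
      HasDerivAt (fun t => g (P.d - t)) (-g') t := fun hg => hg.comp_const_sub _ _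
  refine ⟨?_, ?_, ?_, ?_, ?_, ?_⟩
  · exact h.continuousOn.comp (by fun_prop) fun t ht => ⟨by linarith [ht.2], by linarith [ht.1]⟩
  · exact fun t ht => hchain (h.hasDerivAt ⟨(hmem t ht).1, (hmem t ht).2.trans hd1⟩)
  · intro t ht
    have := (hchain (h.hasDerivAt_deriv (Or.inl (hmem t ht)))).fun_neg
    rwa [neg_neg] at this
  · exact (hchain (h.hasDerivAt (by rw [sub_zero]; exact ⟨hd0, hd1⟩))).hasDerivWithinAt
  · intro t ht
    have h1 := h.equation (P.d - t) (Or.inl (hmem t ht))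
    obtain ⟨h2, h3⟩ := hA t (Ioo_subset_Ioc_self ht)
    rw [h2, h3] at h1
    linarith
  · simp only [sub_self]
    exact h.left_value

/-! ### The mesh and the scheme in terms of the two sides -/

variable {N : ℕ}

lemma mesh_right (h8 : 8 ∣ N) (hN : 8 ≤ N) {j : ℕ} (hj : j ≤ N / 2) :
    P.mesh ε μ N (N / 2 + j) = P.d + halfMesh (1 - P.d) (P.θ₁ ε μ) (P.θ₂ ε μ) N j := by
  obtain ⟨n, rfl⟩ := h8
  have hn : (0 : ℝ) < n := by exact_mod_cast (by omega : 0 < n)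
  have hc : ((8 * n / 2 + j : ℕ) : ℝ) / (8 * n : ℕ) = 1 / 2 + j / (8 * n : ℕ) := by
    rw [show 8 * n / 2 = 4 * n by omega]
    push_cast
    field_simp
    ring
  have e1 : ¬ 8 * (8 * n / 2 + j) ≤ 8 * n := by omega
  have e2 : ¬ 8 * (8 * n / 2 + j) ≤ 3 * (8 * n) := by omega
  unfold mesh
  simp only [e1, e2, if_false, hc]
  -- The node `d` itself falls in the left interior branch of the mesh, so it is treated separately.
  by_cases h0 : j = 0
  · subst h0
    have e3 : 8 * (8 * n / 2 + 0) ≤ 4 * (8 * n) := by omega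
    rw [if_pos e3, halfMesh_of_le (by omega), layerMesh_zero,
      show 8 * (1 / 2 + ((0 : ℕ) : ℝ) / (8 * n : ℕ)) * (1 - 1 / √((8 * n : ℕ) : ℝ))
        + 4 * (1 / √((8 * n : ℕ) : ℝ)) - 3 = 1 by rw [Nat.cast_zero, zero_div]; ring,
      Real.log_one, mul_zero]
  have e3 : ¬ 8 * (8 * n / 2 + j) ≤ 4 * (8 * n) := by omega
  rw [if_neg e3]
  by_cases h1 : 8 * j ≤ 8 * n
  · rw [if_pos (by omega), halfMesh_of_le h1, layerMesh, layerWeight,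
      show 8 * (1 / 2 + (j : ℝ) / (8 * n : ℕ)) * (1 / √((8 * n : ℕ) : ℝ) - 1) + 5
        - 4 * (1 / √((8 * n : ℕ) : ℝ))
        = 1 - 8 * (j : ℝ) / (8 * n : ℕ) * (1 - 1 / √((8 * n : ℕ) : ℝ)) by ring]
    ring
  rw [if_neg (by omega)]
  by_cases h2 : 8 * j ≤ 3 * (8 * n)
  · rw [if_pos (by omega), halfMesh_of_mid hN (by omega) h2, σInterior, σBoundary]
    ring
  · rw [if_neg (by omega), halfMesh_of_ge (Dvd.intro n rfl) hN (by omega), layerMesh, layerWeight]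
    have hc2 : ((8 * n / 2 - j : ℕ) : ℝ) = 4 * n - j := by
      rw [show 8 * n / 2 = 4 * n by omega, Nat.cast_sub (by omega)]
      push_cast
      ring
    have : 8 * (1 / 2 + (j : ℝ) / (8 * n : ℕ)) * (1 - 1 / √((8 * n : ℕ) : ℝ))
        + 8 * (1 / √((8 * n : ℕ) : ℝ)) - 7
        = 1 - 8 * ((8 * n / 2 - j : ℕ) : ℝ) / (8 * n : ℕ) * (1 - 1 / √((8 * n : ℕ) : ℝ)) := by
      rw [hc2]
      generalize 1 / √((8 * n : ℕ) : ℝ) = s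
      push_cast
      field_simp
      ring
    rw [this]
    ring

lemma mesh_left (h8 : 8 ∣ N) (hN : 8 ≤ N) {j : ℕ} (hj : j ≤ N / 2) :
    P.mesh ε μ N (N / 2 - j) = P.d - halfMesh P.d (P.θ₁ ε μ) (P.θ₂ ε μ) N j := by
  obtain ⟨n, rfl⟩ := h8
  have hn : (0 : ℝ) < n := by exact_mod_cast (by omega : 0 < n)
  have hc : ((8 * n / 2 - j : ℕ) : ℝ) / (8 * n : ℕ) = 1 / 2 - j / (8 * n : ℕ) := by
    rw [show 8 * n / 2 = 4 * n by omega, Nat.cast_sub (by omega)]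
    push_cast
    field_simp
    ring
  unfold mesh
  simp only [hc]
  by_cases h1 : 3 * (8 * n) ≤ 8 * j
  · rw [if_pos (by omega), halfMesh_of_ge (Dvd.intro n rfl) hN h1, layerMesh, layerWeight,
      mul_div_assoc 8 ((8 * n / 2 - j : ℕ) : ℝ), hc,
      show 1 + 8 * (1 / 2 - (j : ℝ) / (8 * n : ℕ)) * (1 / √((8 * n : ℕ) : ℝ) - 1)
        = 1 - 8 * (1 / 2 - (j : ℝ) / (8 * n : ℕ)) * (1 - 1 / √((8 * n : ℕ) : ℝ)) by ring]
    ring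
  rw [if_neg (by omega)]
  by_cases h2 : 8 * n ≤ 8 * j
  · rw [if_pos (by omega), halfMesh_of_mid hN h2 (by omega), σInterior, σBoundary]
    ring
  · rw [if_neg (by omega), if_pos (by omega), halfMesh_of_le (by omega), layerMesh, layerWeight,
      show 8 * (1 / 2 - (j : ℝ) / (8 * n : ℕ)) * (1 - 1 / √((8 * n : ℕ) : ℝ))
        + 4 * (1 / √((8 * n : ℕ) : ℝ)) - 3
        = 1 - 8 * (j : ℝ) / (8 * n : ℕ) * (1 - 1 / √((8 * n : ℕ) : ℝ)) by ring]
    ring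

variable {Y : ℕ → ℝ} {θ₁ θ₂ : ℝ}

lemma IsDiscreteSolution.right (h : P.IsDiscreteSolution ε μ N Y) (h8 : 8 ∣ N) (hN : 8 ≤ N)
    (T : LayerAdapted N (1 - P.d) θ₁ θ₂ (halfMesh (1 - P.d) (P.θ₁ ε μ) (P.θ₂ ε μ) N))
    (hA : ∀ t ∈ Ioc 0 (1 - P.d), P.a (P.d + t) = A t ∧
        P.f (P.d + t) = -(P.b (P.d + t) * v t)) :
    HalfDiscreteSolution N ε μ P.y₁ A (fun t => P.b (P.d + t)) v
      (halfMesh (1 - P.d) (P.θ₁ ε μ) (P.θ₂ ε μ) N) (fun j => Y (N / 2 + j)) := by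
  constructor
  · intro k hk
    have h1 := h.equation (N / 2 + (k + 1)) (by omega) (by omega) (by omega)
    have hx0 := mesh_right (P := P) (ε := ε) (μ := μ) h8 hN (j := k) (by omega)
    have hx1 := mesh_right (P := P) (ε := ε) (μ := μ) h8 hN (j := k + 1) (by omega)
    have hx2 := mesh_right (P := P) (ε := ε) (μ := μ) h8 hN (j := k + 1 + 1) (by omega)
    have htI := T.mem_Icc (j := k + 1) (by omega)
    have ht0 : 0 < halfMesh (1 - P.d) (P.θ₁ ε μ) (P.θ₂ ε μ) N (k + 1) :=
      (T.mem_Icc (j := k) (by omega)).1.trans_lt (T.lt_succ k (by omega))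
    obtain ⟨ha, hf⟩ := hA _ ⟨ht0, htI.2⟩
    have e : N / 2 + (k + 1) - 1 = N / 2 + k := by omega
    have e' : N / 2 + (k + 1) + 1 = N / 2 + (k + 1 + 1) := by omega
    simp only [secondDiffQuot, upwindDiffQuot, if_neg (show ¬ 2 * (N / 2 + (k + 1)) < N by omega),
      fwdDiffQuot, bwdDiffQuot, e, e', hx0, hx1, hx2, ha, hf, add_sub_add_left_eq_sub] at h1
    simp only [upwindOp, secondDiffQuot, fwdDiffQuot, bwdDiffQuot, Nat.add_sub_cancel]
    exact h1
  · show Y (N / 2 + N / 2) = P.y₁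
    rw [show N / 2 + N / 2 = N by omega]
    exact h.right_value

/-- Reflection exchanges backward and forward quotients with a change of sign, which the sign of `a`
compensates; the second quotient is unchanged. -/
lemma IsDiscreteSolution.left (h : P.IsDiscreteSolution ε μ N Y) (h8 : 8 ∣ N) (hN : 8 ≤ N)
    (T : LayerAdapted N P.d θ₁ θ₂ (halfMesh P.d (P.θ₁ ε μ) (P.θ₂ ε μ) N))
    (hA : ∀ t ∈ Ioc 0 P.d, P.a (P.d - t) = -A t ∧
        P.f (P.d - t) = -(P.b (P.d - t) * v t)) :
    HalfDiscreteSolution N ε μ P.y₀ A (fun t => P.b (P.d - t)) v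
      (halfMesh P.d (P.θ₁ ε μ) (P.θ₂ ε μ) N) (fun j => Y (N / 2 - j)) := by
  constructor
  · intro k hk
    have h1 := h.equation (N / 2 - (k + 1)) (by omega) (by omega) (by omega)
    have hx0 := mesh_left (P := P) (ε := ε) (μ := μ) h8 hN (j := k) (by omega)
    have hx1 := mesh_left (P := P) (ε := ε) (μ := μ) h8 hN (j := k + 1) (by omega)
    have hx2 := mesh_left (P := P) (ε := ε) (μ := μ) h8 hN (j := k + 1 + 1) (by omega)
    have htI := T.mem_Icc (j := k + 1) (by omega)
    have ht0 : 0 < halfMesh P.d (P.θ₁ ε μ) (P.θ₂ ε μ) N (k + 1) :=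
      (T.mem_Icc (j := k) (by omega)).1.trans_lt (T.lt_succ k (by omega))
    obtain ⟨ha, hf⟩ := hA _ ⟨ht0, htI.2⟩
    have e : N / 2 - (k + 1) - 1 = N / 2 - (k + 1 + 1) := by omega
    have e' : N / 2 - (k + 1) + 1 = N / 2 - k := by omega
    simp only [secondDiffQuot, upwindDiffQuot, if_pos (show 2 * (N / 2 - (k + 1)) < N by omega),
      fwdDiffQuot, bwdDiffQuot, e, e', hx0, hx1, hx2, ha, hf, sub_sub_sub_cancel_left] at h1
    simp only [upwindOp, secondDiffQuot, fwdDiffQuot, bwdDiffQuot, Nat.add_sub_cancel]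
    rw [← h1]
    ring
  · show Y (N / 2 - N / 2) = P.y₀
    rw [Nat.sub_self]
    exact h.left_value

lemma IsDiscreteSolution.jump (h : P.IsDiscreteSolution ε μ N Y) (h8 : 8 ∣ N) (hN : 8 ≤ N) :
    fwdDiffQuot (halfMesh P.d (P.θ₁ ε μ) (P.θ₂ ε μ) N) (fun j => Y (N / 2 - j)) 0
      + fwdDiffQuot (halfMesh (1 - P.d) (P.θ₁ ε μ) (P.θ₂ ε μ) N) (fun j => Y (N / 2 + j)) 0
      = 0 := by
  have h1 := h.three_point
  have l0 := mesh_left (P := P) (ε := ε) (μ := μ) h8 hN (j := 0) (by omega)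
  have l1 := mesh_left (P := P) (ε := ε) (μ := μ) h8 hN (j := 1) (by omega)
  have r0 := mesh_right (P := P) (ε := ε) (μ := μ) h8 hN (j := 0) (by omega)
  have r1 := mesh_right (P := P) (ε := ε) (μ := μ) h8 hN (j := 1) (by omega)
  rw [Nat.sub_zero] at l0
  rw [add_zero] at r0
  rw [bwdDiffQuot, fwdDiffQuot, r1, l1] at h1
  nth_rewrite 1 [l0] at h1
  rw [r0] at h1
  rw [add_sub_add_left_eq_sub, sub_sub_sub_cancel_left] at h1
  simp only [fwdDiffQuot, Nat.sub_zero, add_zero, zero_add]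
  rw [← h1]
  ring

end BVPData

/-! ### Uniform mesh rates and assembly of the estimate -/

namespace BVPData
variable {P : BVPData}

/-- Uniformly in the parameters, the rates used in the mesh are comparable to the layer rates. -/
lemma exists_meshRates {B : ℝ} (hα : 0 < P.α) (hρ : 0 < P.ρ) (hB : 0 < B) :
    ∃ K₀ : ℝ, ∀ K ≥ K₀, ∀ ε μ δ : ℝ, 0 < ε → 0 < μ → 0 < δ → δ ≤ 1 →
      (√P.α * μ ≤ √(P.ρ * ε) → √ε < δ) → (√(P.ρ * ε) < √P.α * μ → max (ε / μ) μ < δ) →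
      MeshRates P.α P.ρ B K ε μ δ (P.θ₁ ε μ) (P.θ₂ ε μ) := by
  obtain ⟨K₁, h₁⟩ := meshRates_of_reaction hα hρ hB
  obtain ⟨K₂, h₂⟩ := meshRates_of_convection hα hρ hB
  refine ⟨max K₁ K₂, fun K hK ε μ δ hε hμ hδ hδ1 hr hc => ?_⟩
  have hsq : (√P.α * μ) ^ 2 = P.α * μ ^ 2 := by rw [mul_pow, Real.sq_sqrt hα.le]
  have hsq' : √(P.ρ * ε) ^ 2 = P.ρ * ε := Real.sq_sqrt (by positivity)
  by_cases h : √P.α * μ ≤ √(P.ρ * ε)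
  · have hcase : P.α * μ ^ 2 ≤ P.ρ * ε := by
      rw [← hsq, ← hsq']
      gcongr
    rw [θ₁, θ₂, if_pos h, if_pos h]
    exact h₁ K (le_of_max_le_left hK) ε μ δ hε hμ hδ hδ1 hcase (hr h)
  · have hcase : P.ρ * ε ≤ P.α * μ ^ 2 := by
      rw [← hsq, ← hsq']
      gcongr
      exact (not_le.1 h).le
    obtain ⟨c1, c2⟩ := max_lt_iff.1 (hc (not_le.1 h))
    rw [θ₁, θ₂, if_neg h, if_neg h]
    exact h₂ K (le_of_max_le_right hK) ε μ δ hε hμ hδ hδ1 hcase c1 c2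

end BVPData

theorem mainTheorem1 (P : BVPData) (hP : P.Admissible) :
    ∃ C : ℝ, 0 < C ∧
      ∀ (ε μ : ℝ) (N : ℕ), 0 < ε → 0 < μ → 0 < N → 8 ∣ N →
        (√P.α * μ ≤ √(P.ρ * ε) → √ε < (N : ℝ)⁻¹) →
        (√(P.ρ * ε) < √P.α * μ → max (ε / μ) μ < (N : ℝ)⁻¹) →
        -- the six mesh regions do not overlap
        P.σBoundary ε μ N + P.σInterior ε μ N < P.d →
        P.σInterior ε μ N + P.σBoundary ε μ N < 1 - P.d →
        ∀ y : ℝ → ℝ, P.IsSolution ε μ y →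
        ∀ Y : ℕ → ℝ, P.IsDiscreteSolution ε μ N Y →
          ∀ i : ℕ, i ≤ N → |Y i - y (P.mesh ε μ N i)| ≤ C * (N : ℝ)⁻¹ := by
  obtain ⟨hd0, hd1⟩ := hP.d_mem
  obtain ⟨A, v, v', v'', K₁, HL, hAL, hL⟩ := hP.exists_left
  obtain ⟨A₂, v₂, v₂', v₂'', K₂, HR, hAR, hR⟩ := hP.exists_right
  have HL' := HL (max K₁ K₂) (le_max_left _ _)
  have HR' := HR (max K₁ K₂) (le_max_right _ _)
  -- The coefficient bound `B` is fixed first, because the threshold `K₃` for comparable rates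
  -- depends on it; the final `K` is then taken above both.
  obtain ⟨B, hBdef⟩ : ∃ B, B = max K₁ K₂ := ⟨_, rfl⟩
  rw [← hBdef] at HL' HR'
  have hB : 0 < B := zero_lt_one.trans_le HL'.one_le
  have hρ : 0 < P.ρ := hP.ρ_pos (B := B) fun x hx hxd => by
    rcases lt_or_gt_of_ne hxd with h | h
    · have ht : P.d - x ∈ Ioc 0 P.d := ⟨by linarith, by linarith [hx.1]⟩
      have h1 := (hL _ ht).1
      rw [sub_sub_cancel] at h1
      rw [h1, abs_neg, abs_of_pos (HL'.A_pos (Ioc_subset_Icc_self ht))]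
      exact HL'.A_upper _ (Ioc_subset_Icc_self ht)
    · have ht : x - P.d ∈ Ioc 0 (1 - P.d) := ⟨by linarith, by linarith [hx.2]⟩
      have h1 := (hR _ ht).1
      rw [add_sub_cancel] at h1
      rw [h1, abs_of_pos (HR'.A_pos (Ioc_subset_Icc_self ht))]
      exact HR'.A_upper _ (Ioc_subset_Icc_self ht)
  have hρL : ∀ t ∈ Icc 0 P.d, P.ρ * A t ≤ P.b (P.d - t) := fun t ht => by
    have hA : ContinuousOn A (Icc 0 P.d) := by
      refine (LipschitzOnWith.of_dist_le_mul (K := ⟨B, hB.le⟩) fun s hs r hr => ?_).continuousOn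
      exact HL'.A_lip s hs r hr
    have hb : ContinuousOn (fun t => P.b (P.d - t)) (Icc 0 P.d) := by
      refine (LipschitzOnWith.of_dist_le_mul (K := ⟨B, hB.le⟩) fun s hs r hr => ?_).continuousOn
      exact HL'.b_lip s hs r hr
    have := nonneg_zero_of_nonneg_Ioc (g := fun t => P.b (P.d - t) - P.ρ * A t) hd0
      (hb.sub (continuousOn_const.mul hA)) (fun s hs => by
        have hsA := HL'.A_pos (Ioc_subset_Icc_self hs)
        have h1 := P.ρ_mul_abs_le (x := P.d - s) ⟨by linarith [hs.2], by linarith [hs.1]⟩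
          (by linarith [hs.1]) (by rw [(hL s hs).1]; exact (neg_neg_of_pos hsA).ne)
          (HL'.b_pos (Ioc_subset_Icc_self hs)).le
        rw [(hL s hs).1, abs_neg, abs_of_pos hsA] at h1
        linarith) t ht
    linarith
  have hρR : ∀ t ∈ Icc 0 (1 - P.d), P.ρ * A₂ t ≤ P.b (P.d + t) := fun t ht => by
    have hA : ContinuousOn A₂ (Icc 0 (1 - P.d)) := by
      refine (LipschitzOnWith.of_dist_le_mul (K := ⟨B, hB.le⟩) fun s hs r hr => ?_).continuousOn
      exact HR'.A_lip s hs r hr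
    have hb : ContinuousOn (fun t => P.b (P.d + t)) (Icc 0 (1 - P.d)) := by
      refine (LipschitzOnWith.of_dist_le_mul (K := ⟨B, hB.le⟩) fun s hs r hr => ?_).continuousOn
      exact HR'.b_lip s hs r hr
    have := nonneg_zero_of_nonneg_Ioc (g := fun t => P.b (P.d + t) - P.ρ * A₂ t) (by linarith)
      (hb.sub (continuousOn_const.mul hA)) (fun s hs => by
        have hsA := HR'.A_pos (Ioc_subset_Icc_self hs)
        have h1 := P.ρ_mul_abs_le (x := P.d + s) ⟨by linarith [hs.1], by linarith [hs.2]⟩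
          (by linarith [hs.1]) (by rw [(hR s hs).1]; exact hsA.ne')
          (HR'.b_pos (Ioc_subset_Icc_self hs)).le
        rw [(hR s hs).1, abs_of_pos hsA] at h1
        linarith) t ht
    linarith
  obtain ⟨K₃, hM⟩ := P.exists_meshRates hP.α_pos hρ hB
  obtain ⟨K, hKdef⟩ : ∃ K, K = max B (max K₃ (max |P.y₀| |P.y₁|)) := ⟨_, rfl⟩
  have hKB : B ≤ K := hKdef ▸ le_max_left _ _
  have hK3 : K₃ ≤ K := hKdef ▸ (le_max_left _ _).trans (le_max_right _ _)
  have hKy : max |P.y₀| |P.y₁| ≤ K := hKdef ▸ (le_max_right _ _).trans (le_max_right _ _)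
  have H₁ := HL K ((le_max_left K₁ K₂).trans (hBdef ▸ hKB))
  have H₂ := HR K ((le_max_right K₁ K₂).trans (hBdef ▸ hKB))
  have hKpos := H₁.one_le
  have hCpos := H₁.approxConst_pos
  refine ⟨602 * K ^ 3 * approxConst K, by positivity, ?_⟩
  intro ε μ N hε hμ hN0 h8 hreac hconv hσL hσR y hy Y hY i hi
  have hN : 8 ≤ N := Nat.le_of_dvd hN0 h8
  have hδ : (0 : ℝ) < (N : ℝ)⁻¹ := by
    have : (0 : ℝ) < N := by exact_mod_cast hN0
    positivity
  have hδ1 : (N : ℝ)⁻¹ ≤ 1 := inv_le_one_of_one_le₀ (by exact_mod_cast hN0)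
  have M := hM K hK3 ε μ _ hε hμ hδ hδ1 hreac hconv
  have hαL : ∀ t ∈ Icc 0 P.d, P.α ≤ A t := fun t ht =>
    (hP.α_eq.trans_le (min_le_left _ _)).trans (hAL t ht)
  have hαR : ∀ t ∈ Icc 0 (1 - P.d), P.α ≤ A₂ t := fun t ht =>
    (hP.α_eq.trans_le (min_le_right _ _)).trans (hAR t ht)
  obtain ⟨κ, lam, R₁⟩ := M.exists_layerRates (A := A) (b := fun t => P.b (P.d - t)) hε hμ hd0.le
    (fun t ht => ⟨hαL t ht, HL'.A_upper t ht⟩) (fun t ht => ⟨hρL t ht, HL'.b_upper t ht⟩)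
  obtain ⟨κ₂, lam₂, R₂⟩ := M.exists_layerRates (A := A₂) (b := fun t => P.b (P.d + t)) hε hμ
    (sub_nonneg.2 hd1.le)
    (fun t ht => ⟨hαR t ht, HR'.A_upper t ht⟩) (fun t ht => ⟨hρR t ht, HR'.b_upper t ht⟩)
  have T₁ := layerAdapted_halfMesh M.θ₂_pos M.θ₂_le_θ₁ h8 hN hσL
  have T₂ := layerAdapted_halfMesh M.θ₂_pos M.θ₂_le_θ₁ h8 hN ((add_comm _ _).trans_lt hσR)
  have key := two_sided_error h8 hN H₁ R₁ T₁ H₂ R₂ T₂ ((le_max_left _ _).trans hKy)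
    ((le_max_right _ _).trans hKy) (hy.left hP.d_mem hL) (hy.right hP.d_mem hR)
    (by rw [sub_zero, add_zero]) (by rw [sub_zero, add_zero, neg_add_cancel])
    (hY.left h8 hN T₁ hL) (hY.right h8 hN T₂ hR) rfl (hY.jump h8 hN)
  rcases le_total i (N / 2) with h | h
  · have h1 := key.1 (N / 2 - i) (by omega)
    rw [← BVPData.mesh_left h8 hN (by omega), show N / 2 - (N / 2 - i) = i by omega] at h1
    exact h1
  · have h1 := key.2 (i - N / 2) (by omega)
    rw [← BVPData.mesh_right h8 hN (by omega), show N / 2 + (i - N / 2) = i by omega] at h1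
    exact h1
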